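/- Let $\mathcal U\subset\mathbb R^N$ be open and let $A:\mathcal U\to\mathbb R^{N\times N}$, $q:\mathcal U\to\mathbb R^N$ be smooth; put $Q:=dq$. Assume: 1. (Profile) $\bar U:\mathbb R\to\mathcal U$ is smooth, $A(\bar U)\bar U_x=q(\bar U)$, and there are $U^\pm\in\mathcal U$ and, for every $k\ge 0$, constants $c_k,\theta_k>0$ with $|\partial_x^k(\bar U-U^\pm)(x)|\le c_ke^{-\theta_k|x|}$ for $x\gtrless 0$. 2. (Strict hyperbolicity, non-characteristicity) There is $c>0$ such that for every $u\in\overline{\bar U(\mathbb R)}$ the matrix $A(u)$ has $N$ distinct real eigenvalues $\lambda_1(u)<\dots<\lambda_N(u)$, and $|\lambda_j(u)|\ge c$ for all $j$. 3. (High-frequency stability) There are $C_0,c_0>0$ such that $\operatorname{Re}\,\sigma(i\xi A(U^\pm)+Q(U^\pm))\le -c_0$ for all $\xi\in\mathbb R$ with $|\xi|\ge C_0$. No symmetry of $A$ or $Q$ is assumed. Then there are constants $C,\theta,\varepsilon>0$, depending only on $A,q,\bar U$, such that the following holds for every $T>0$. Let $\tilde U\in C^1([0,T]\times\mathbb R;\mathcal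 U)$ solve $\tilde U_t+A(\tilde U)\tilde U_x=q(\tilde U)$, let $\delta\in C^1([0,T];\mathbb R)$, and suppose that the shifted perturbation $$U(t,x):=\tilde U(t,x+\delta(t))-\bar U(x)$$ belongs to $C([0,T];H^2(\mathbb R))$ (in particular $U(0)\in H^2$) and satisfies $$\|U(t)\|_{H^1(\mathbb R)}\le\varepsilon,\qquad \|U(t)\|_{W^{1,\infty}(\mathbb R)}\le\varepsilon,\qquad |\dot\delta(t)|\le\varepsilon\qquad (t\in[0,T]).$$ Then for all $t\in[0,T]$ $$\|U(t)\|_{H^2}^2\le Ce^{-\theta t}\|U(0)\|_{H^2}^2+C\int_0^te^{-\theta(t-s)}\bigl(\|U(s)\|_{L^2}^2+|\dot\delta(s)|^2\bigr)\,ds .$$ -/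

import Mathlib

open MeasureTheory Set Filter Topology
open scoped ENNReal ContDiff

noncomputable section

/-- The state space `ℝ^N` with the Euclidean norm. -/
abbrev StateSpace (N : ℕ) : Type := EuclideanSpace ℝ (Fin N)

/-- The action `M v` of a real `N × N` matrix on a vector of `ℝ^N`. -/
def matApply {N : ℕ} (M : Matrix (Fin N) (Fin N) ℝ) (v : StateSpace N) : StateSpace N :=
  Matrix.toEuclideanCLM (n := Fin N) (𝕜 := ℝ) M v

/-- The Jacobian matrix `Q(u) = dq(u)` of a map `q` at the point `u`. -/
def jacobianMatrix {N : ℕ} (q : StateSpace N → StateSpace N) (u : StateSpace N) :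
    Matrix (Fin N) (Fin N) ℝ :=
  (Matrix.toEuclideanCLM (n := Fin N) (𝕜 := ℝ)).symm (fderiv ℝ q u)

/-- `g` is a weak derivative of `f` on `ℝ`. -/
structure IsWeakDeriv {N : ℕ} (f g : ℝ → StateSpace N) : Prop where
  locallyIntegrable : LocallyIntegrable f volume
  locallyIntegrable_deriv : LocallyIntegrable g volume
  integral_eq : ∀ φ : ℝ → ℝ, ContDiff ℝ ∞ φ → HasCompactSupport φ →
    ∫ x, deriv φ x • f x = -∫ x, φ x • g x

/-- The square of the `H^k(ℝ)`-norm, `∑_{j ≤ k} ‖∂ₓʲ f‖_{L²}²`, with weak derivatives.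
Weak derivatives are unique up to null sets, so the infimum is the value at the weak derivative
of `f`; it is `∞` if `f` has none. -/
def sobolevSq {N : ℕ} : ℕ → (ℝ → StateSpace N) → ℝ≥0∞
  | 0, f => eLpNorm f 2 volume ^ 2
  | k + 1, f => eLpNorm f 2 volume ^ 2 +
      ⨅ (g : ℝ → StateSpace N) (_ : IsWeakDeriv f g), sobolevSq k g

/-- Membership in `H^k(ℝ)`; `H^0 = L²`. -/
def MemH {N : ℕ} (k : ℕ) (f : ℝ → StateSpace N) : Prop :=
  AEStronglyMeasurable f volume ∧ sobolevSq k f < (⊤ : ℝ≥0∞)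

/-- The norm of `H^k(ℝ)`, meaningful for `f` with `MemH k f`; `k = 0` is the `L²`-norm. -/
def hNorm {N : ℕ} (k : ℕ) (f : ℝ → StateSpace N) : ℝ :=
  Real.sqrt (sobolevSq k f).toReal

/-- The norm of `W^{1,∞}(ℝ)`, equal to `∞` if `f` has no weak derivative. -/
def w1InfNorm {N : ℕ} (f : ℝ → StateSpace N) : ℝ≥0∞ :=
  max (eLpNorm f ⊤ volume)
    (⨅ (g : ℝ → StateSpace N) (_ : IsWeakDeriv f g), eLpNorm g ⊤ volume)

/-- `V ∈ C([0,T]; H^k(ℝ))`. -/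
def ContinuousInH {N : ℕ} (k : ℕ) (T : ℝ) (V : ℝ → ℝ → StateSpace N) : Prop :=
  (∀ t ∈ Icc 0 T, MemH k (V t)) ∧
  ∀ t₀ ∈ Icc 0 T, Tendsto (fun t => sobolevSq k (V t - V t₀)) (𝓝[Icc 0 T] t₀) (𝓝 0)

/-- The coefficient matrix and the source term are smooth on the open set `𝒰` of states. -/
structure SmoothCoefficients {N : ℕ} (𝒰 : Set (StateSpace N))
    (A : StateSpace N → Matrix (Fin N) (Fin N) ℝ) (q : StateSpace N → StateSpace N) : Prop where
  isOpen : IsOpen 𝒰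
  smooth_matrix : ∀ i j, ContDiffOn ℝ ∞ (fun u => A u i j) 𝒰
  smooth_source : ContDiffOn ℝ ∞ q 𝒰

/-- `Ubar` is a smooth stationary solution with values in `𝒰` that converges to the end states
`Uminus, Uplus ∈ 𝒰`, together with all its derivatives, at exponential rates. -/
structure IsProfile {N : ℕ} (𝒰 : Set (StateSpace N))
    (A : StateSpace N → Matrix (Fin N) (Fin N) ℝ) (q : StateSpace N → StateSpace N)
    (Ubar : ℝ → StateSpace N) (Uminus Uplus : StateSpace N) : Prop where
  mem : ∀ x, Ubar x ∈ 𝒰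
  mem_minus : Uminus ∈ 𝒰
  mem_plus : Uplus ∈ 𝒰
  smooth : ContDiff ℝ ∞ Ubar
  stationary : ∀ x, matApply (A (Ubar x)) (deriv Ubar x) = q (Ubar x)
  decay : ∀ k : ℕ, ∃ c θ : ℝ, 0 < θ ∧
    (∀ x : ℝ, 0 < x → ‖iteratedDeriv k (fun y => Ubar y - Uplus) x‖ ≤ c * Real.exp (-θ * |x|)) ∧
    (∀ x : ℝ, x < 0 → ‖iteratedDeriv k (fun y => Ubar y - Uminus) x‖ ≤ c * Real.exp (-θ * |x|))

/-- Strict hyperbolicity and non-characteristicity on the set `K` of states: `A(u)` has `N`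
distinct real eigenvalues, bounded away from `0` uniformly in `u ∈ K`. -/
def StrictlyHyperbolicNoncharacteristic {N : ℕ}
    (A : StateSpace N → Matrix (Fin N) (Fin N) ℝ) (K : Set (StateSpace N)) : Prop :=
  ∃ c : ℝ, 0 < c ∧ ∀ u ∈ K, ∃ ev : Fin N → ℝ, StrictMono ev ∧
    (∀ j, Module.End.HasEigenvalue (Matrix.toLin' (A u)) (ev j)) ∧ ∀ j, c ≤ |ev j|

/-- Stability at high frequencies at the state `u`:
`Re σ(i ξ A(u) + Q(u)) ≤ -c < 0` for all real `ξ` with `|ξ| ≥ C`. -/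
def HighFrequencyStable {N : ℕ} (A : StateSpace N → Matrix (Fin N) (Fin N) ℝ)
    (q : StateSpace N → StateSpace N) (u : StateSpace N) : Prop :=
  ∃ C c : ℝ, 0 < C ∧ 0 < c ∧ ∀ ξ : ℝ, C ≤ |ξ| →
    ∀ z ∈ spectrum ℂ ((Complex.I * (ξ : ℂ)) • (A u).map Complex.ofReal +
      (jacobianMatrix q u).map Complex.ofReal), z.re ≤ -c

/-- `u` is a (classical, `C¹`) solution of `u_t + A(u) u_x = q(u)` on `[0,T] × ℝ`
with values in `𝒰`. -/
structure IsSolution {N : ℕ} (𝒰 : Set (StateSpace N))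
    (A : StateSpace N → Matrix (Fin N) (Fin N) ℝ) (q : StateSpace N → StateSpace N)
    (T : ℝ) (u : ℝ → ℝ → StateSpace N) : Prop where
  mem : ∀ t ∈ Icc 0 T, ∀ x, u t x ∈ 𝒰
  contDiffOn : ContDiffOn ℝ 1 (Function.uncurry u) (Icc 0 T ×ˢ univ)
  equation : ∀ t ∈ Icc 0 T, ∀ x,
    derivWithin (fun s => u s x) (Icc 0 T) t + matApply (A (u t x)) (deriv (u t) x) = q (u t x)

/-- The shifted perturbation `U(t,x) = u(t, x + δ(t)) - Ubar(x)`. -/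
def shiftedPerturbation {N : ℕ} (Ubar : ℝ → StateSpace N) (u : ℝ → ℝ → StateSpace N)
    (δ : ℝ → ℝ) (t x : ℝ) : StateSpace N :=
  u t (x + δ t) - Ubar x

end

/-! The estimate is a weighted `L²` energy estimate for the second derivative of the perturbation.
Let `W` be the shifted solution, `a(W)` the operator of `A(W)`, `d` the speed of the shift, and `v =
U_x`, `w = U_xx`. Two differentiations give `w_t + (a(W) - d) w_x = L w + source`, where `L` is
`linPart`. The source is of size `|U| + |v| + |d| |U₃|`, because the stationary equation and its
first two derivatives vanish along the profile.

Without symmetry of `A`, energies are taken field by field, on the images of the spectral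
projections `P_j(W)`. The fields are coupled at order zero by `L` and by the derivatives of `P_j`.
This coupling is removed by the substitution `y = w + S v`: since `v` obeys the same transport law
and `v_x = w`, it adds the commutator `[a, S]` to the zeroth order operator. The eigenvalues are
distinct, so `S` can be chosen along the profile to cancel every contribution of another field to
the `j`-th equation (`mul_add_commutator_eq`, `fieldOp_profile`).

Each `Y_j = P_j y` is then transported with the scalar speed `λ_j - d` and has a single block at
order zero, up to errors that are small with the perturbation. Damping has two sources. Near the end
states, stability at high frequencies says exactly that the diagonal block is a negative multiple of
`P_j`: this multiple is the first-order correction, for large `ξ`, to the eigenvalue of `iξA + Q`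
near `iξλ_j` (`diagonal_neg_of_highFrequencyStable`). On the remaining bounded interval the block
has no sign, but `λ_j` stays away from zero, and the weight `exp(-∫ β/λ_j)` turns transport into
damping of any prescribed strength (`exists_weight`). Together they give `exists_damping`.

The function `U` itself is not damped. Its energy grows at a rate controlled by `‖U‖²`, `‖v‖²` and
`d²`; the middle term is interpolated between `‖U‖²` and `‖w‖²` and absorbed by the damping of `y`.
Only `‖U‖²` and `d²` remain on the right, and the factor `exp(θt)` turns the inequality into the
claim (`exists_sobolev_estimate`).

The regularity available is too low for this computation, since `w` is merely square integrable in
`x`. The energy identity is therefore proved for second difference quotients (`transport_energy`)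
and passed to the limit (`energy_limit`, `PerturbedSolution.field_energy`). The time and space
derivatives of the regularised unknowns need not converge separately; the transport combination `Y_t
+ (λ_j - d) Y_x` does, because the equation expresses it without third derivatives of `W`. -/

/-- `f n i → g i` in `L²(ℝ)` for every parameter `i`, with norms bounded uniformly in `n, i`. -/
structure L2Conv {ι G : Type*} [NormedAddCommGroup G] (f : ℕ → ι → ℝ → G) (g : ι → ℝ → G) :
    Prop where
  memLp : ∀ n i, MemLp (f n i) 2 volume
  memLp_lim : ∀ i, MemLp (g i) 2 volume
  bound : ∃ B : NNReal, ∀ n i, eLpNorm (f n i) 2 volume ≤ B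
  tendsto : ∀ i, Tendsto (fun n => eLpNorm (f n i - g i) 2 volume) atTop (𝓝 0)

/-- A family of functions that is bounded in `L²(ℝ)`. -/
structure L2Bdd {ι G : Type*} [NormedAddCommGroup G] (g : ι → ℝ → G) : Prop where
  memLp : ∀ i, MemLp (g i) 2 volume
  bound : ∃ B : NNReal, ∀ i, eLpNorm (g i) 2 volume ≤ B

/-! ### Families bounded or convergent in `L²`: algebra, translations, multipliers, averages. -/

section L2

variable {ι G G' : Type*} [NormedAddCommGroup G] [NormedAddCommGroup G']

theorem L2Bdd.const {g : ι → ℝ → G} (h : L2Bdd g) : L2Conv (fun _ => g) g where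
  memLp _ := h.memLp
  memLp_lim := h.memLp
  bound := let ⟨B, hB⟩ := h.bound; ⟨B, fun _ i => hB i⟩
  tendsto i := by simp

theorem L2Bdd.of_memLp {g : ℝ → G} (h : MemLp g 2 volume) : L2Bdd (fun _ : ι => g) where
  memLp _ := h
  bound := ⟨(eLpNorm g 2 volume).toNNReal, fun _ => by
    rw [ENNReal.coe_toNNReal h.eLpNorm_lt_top.ne]⟩

theorem L2Bdd.mono {g : ι → ℝ → G} {f : ι → ℝ → G'} (h : L2Bdd g)
    (hf : ∀ i, AEStronglyMeasurable (f i) volume) (C : ℝ)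
    (hfg : ∀ i, ∀ᵐ x, ‖f i x‖ ≤ C * ‖g i x‖) : L2Bdd f := by
  obtain ⟨B, hB⟩ := h.bound
  have key : ∀ i, eLpNorm (f i) 2 volume ≤ (C.toNNReal * B : NNReal) := fun i =>
    (eLpNorm_le_mul_eLpNorm_of_ae_le_mul (hfg i) 2).trans (by
      push_cast; exact mul_le_mul_right (hB i) _)
  exact ⟨fun i => ⟨hf i, (key i).trans_lt ENNReal.coe_lt_top⟩, _, key⟩

theorem L2Bdd.add {f g : ι → ℝ → G} (hf : L2Bdd f) (hg : L2Bdd g) :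
    L2Bdd (fun i x => f i x + g i x) := by
  obtain ⟨B, hB⟩ := hf.bound
  obtain ⟨B', hB'⟩ := hg.bound
  refine ⟨fun i => (hf.memLp i).add (hg.memLp i), B + B', fun i => ?_⟩
  push_cast
  exact (eLpNorm_add_le (hf.memLp i).1 (hg.memLp i).1 (by norm_num)).trans
    (add_le_add (hB i) (hB' i))

theorem L2Bdd.neg {f : ι → ℝ → G} (hf : L2Bdd f) : L2Bdd (fun i x => -f i x) :=
  hf.mono (fun i => (hf.memLp i).1.neg) 1 (fun i => by simp)

theorem L2Bdd.sub {f g : ι → ℝ → G} (hf : L2Bdd f) (hg : L2Bdd g) :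
    L2Bdd (fun i x => f i x - g i x) := by
  simpa only [sub_eq_add_neg] using hf.add hg.neg

theorem L2Bdd.comp_add {f : ι → ℝ → G} (hf : L2Bdd f) (s : ℝ) :
    L2Bdd (fun i x => f i (x + s)) := by
  obtain ⟨B, hB⟩ := hf.bound
  have hm := measurePreserving_add_right (volume : Measure ℝ) s
  refine ⟨fun i => (hf.memLp i).comp_measurePreserving hm, B, fun i => ?_⟩
  exact (eLpNorm_comp_measurePreserving (hf.memLp i).1 hm).trans_le (hB i)

theorem L2Conv.bdd {f : ℕ → ι → ℝ → G} {g : ι → ℝ → G} (h : L2Conv f g) (n : ℕ) :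
    L2Bdd (f n) :=
  ⟨h.memLp n, let ⟨B, hB⟩ := h.bound; ⟨B, hB n⟩⟩

theorem L2Conv.bdd_lim {f : ℕ → ι → ℝ → G} {g : ι → ℝ → G} (h : L2Conv f g) : L2Bdd g := by
  obtain ⟨B, hB⟩ := h.bound
  refine ⟨h.memLp_lim, B, fun i => ?_⟩
  have h1 : ∀ n, eLpNorm (g i) 2 volume ≤ B + eLpNorm (f n i - g i) 2 volume := fun n => by
    have h2 : g i = f n i - (f n i - g i) := by abel
    calc eLpNorm (g i) 2 volume = eLpNorm (f n i - (f n i - g i)) 2 volume := by rw [← h2]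
      _ ≤ _ := eLpNorm_sub_le (h.memLp n i).1 ((h.memLp n i).sub (h.memLp_lim i)).1 (by norm_num)
      _ ≤ _ := by gcongr; exact hB n i
  have h3 := (tendsto_const_nhds (x := (B : ℝ≥0∞))).add (h.tendsto i)
  simpa using ge_of_tendsto' h3 h1

theorem L2Conv.add {f f' : ℕ → ι → ℝ → G} {g g' : ι → ℝ → G} (h : L2Conv f g)
    (h' : L2Conv f' g') : L2Conv (fun n i x => f n i x + f' n i x) (fun i x => g i x + g' i x) := by
  obtain ⟨B, hB⟩ := h.bound
  obtain ⟨B', hB'⟩ := h'.bound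
  refine ⟨fun n i => (h.memLp n i).add (h'.memLp n i),
    fun i => (h.memLp_lim i).add (h'.memLp_lim i), ⟨B + B', fun n i => ?_⟩, fun i => ?_⟩
  · push_cast
    exact (eLpNorm_add_le (h.memLp n i).1 (h'.memLp n i).1 (by norm_num)).trans
      (add_le_add (hB n i) (hB' n i))
  · refine tendsto_of_tendsto_of_tendsto_of_le_of_le tendsto_const_nhds
      (by simpa using (h.tendsto i).add (h'.tendsto i)) (fun n => zero_le) (fun n => ?_)
    have h1 : (fun x => f n i x + f' n i x) - (fun x => g i x + g' i x)
        = (f n i - g i) + (f' n i - g' i) := by ext x; simp; abel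
    simp only [h1]
    exact eLpNorm_add_le ((h.memLp n i).sub (h.memLp_lim i)).1
      ((h'.memLp n i).sub (h'.memLp_lim i)).1 (by norm_num)

theorem L2Conv.neg {f : ℕ → ι → ℝ → G} {g : ι → ℝ → G} (h : L2Conv f g) :
    L2Conv (fun n i x => -f n i x) (fun i x => -g i x) := by
  obtain ⟨B, hB⟩ := h.bound
  refine ⟨fun n i => (h.memLp n i).neg, fun i => (h.memLp_lim i).neg, ⟨B, fun n i => ?_⟩,
    fun i => ?_⟩
  · exact (eLpNorm_neg (f n i) 2 volume).trans_le (hB n i)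
  · refine (h.tendsto i).congr (fun n => ?_)
    rw [← eLpNorm_neg]; congr 1; ext x; simp; abel

theorem L2Conv.sub {f f' : ℕ → ι → ℝ → G} {g g' : ι → ℝ → G} (h : L2Conv f g)
    (h' : L2Conv f' g') : L2Conv (fun n i x => f n i x - f' n i x) (fun i x => g i x - g' i x) := by
  simpa only [sub_eq_add_neg] using h.add h'.neg

/-- Strong continuity of the translation group on `L²`, an instance of the continuity of composition
with measure-preserving maps on `Lp`. -/
theorem tendsto_eLpNorm_translation [CompleteSpace G] {f : ℝ → G} (hf : MemLp f 2 volume) :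
    Tendsto (fun y : ℝ => eLpNorm (fun x => f (x + y) - f x) 2 volume) (𝓝 0) (𝓝 0) := by
  have : Fact ((1 : ℝ≥0∞) ≤ 2) := ⟨by norm_num⟩
  let g : ℝ → C(ℝ, ℝ) := fun y => ⟨fun x => x + y, by fun_prop⟩
  have hg : Continuous g := by
    refine ContinuousMap.continuous_of_continuous_uncurry _ ?_
    show Continuous fun p : ℝ × ℝ => p.2 + p.1
    fun_prop
  have hgm : ∀ y, MeasurePreserving (g y) (volume : Measure ℝ) volume := fun y =>
    measurePreserving_add_right volume y
  have h1 := (continuous_const (y := hf.toLp f)).compMeasurePreservingLp hg hgm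
    (by norm_num : (2 : ℝ≥0∞) ≠ ⊤)
  have h2 : Tendsto (fun y => ‖Lp.compMeasurePreserving (g y) (hgm y) (hf.toLp f)
      - Lp.compMeasurePreserving (g 0) (hgm 0) (hf.toLp f)‖ₑ) (𝓝 0) (𝓝 0) := by
    have := (h1.sub (continuous_const
      (y := Lp.compMeasurePreserving (g 0) (hgm 0) (hf.toLp f)))).enorm.tendsto (0 : ℝ)
    simpa using this
  refine h2.congr (fun y => ?_)
  rw [Lp.enorm_def]
  refine eLpNorm_congr_ae ?_
  filter_upwards [Lp.coeFn_sub (Lp.compMeasurePreserving (g y) (hgm y) (hf.toLp f))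
    (Lp.compMeasurePreserving (g 0) (hgm 0) (hf.toLp f)),
    Lp.coeFn_compMeasurePreserving (hf.toLp f) (hgm y),
    Lp.coeFn_compMeasurePreserving (hf.toLp f) (hgm 0),
    hf.coeFn_toLp, (hgm y).quasiMeasurePreserving.ae hf.coeFn_toLp] with x h3 h4 h5 h6 h7
  rw [h3, Pi.sub_apply, h4, h5]
  simp only [Function.comp_apply]
  rw [h7]
  simp only [g, ContinuousMap.coe_mk, add_zero]
  rw [h6]

theorem eLpNorm_sub_translation_le [CompleteSpace G] {f g : ℝ → G} (hf : MemLp f 2 volume)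
    (hg : MemLp g 2 volume) (y : ℝ) :
    eLpNorm (fun x => f (x + y) - g x) 2 volume
      ≤ eLpNorm (f - g) 2 volume + eLpNorm (fun x => g (x + y) - g x) 2 volume := by
  have hm := measurePreserving_add_right (volume : Measure ℝ) y
  have h1 : (fun x => f (x + y) - g x)
      = ((f - g) ∘ fun x => x + y) + (fun x => g (x + y) - g x) := by ext x; simp
  rw [h1, ← eLpNorm_comp_measurePreserving (hf.sub hg).1 hm]
  exact eLpNorm_add_le ((hf.sub hg).comp_measurePreserving hm).1
    ((hg.comp_measurePreserving hm).sub hg).1 (by norm_num)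

/-- Discrete product rules evaluate one factor at a translated point; translations that tend to zero
do not affect the limit, since they are isometries and are strongly continuous at `g`. -/
theorem L2Conv.comp_add [CompleteSpace G] {f : ℕ → ι → ℝ → G} {g : ι → ℝ → G} (h : L2Conv f g)
    {s : ℕ → ℝ} (hs : Tendsto s atTop (𝓝 0)) : L2Conv (fun n i x => f n i (x + s n)) g := by
  obtain ⟨B, hB⟩ := h.bound
  have hm := fun n => measurePreserving_add_right (volume : Measure ℝ) (s n)
  refine ⟨fun n i => (h.memLp n i).comp_measurePreserving (hm n), h.memLp_lim,
    ⟨B, fun n i => (eLpNorm_comp_measurePreserving (h.memLp n i).1 (hm n)).trans_le (hB n i)⟩,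
    fun i => ?_⟩
  refine tendsto_of_tendsto_of_tendsto_of_le_of_le tendsto_const_nhds
    (by simpa using (h.tendsto i).add ((tendsto_eLpNorm_translation (h.memLp_lim i)).comp hs))
    (fun n => zero_le) (fun n => eLpNorm_sub_translation_le (h.memLp n i) (h.memLp_lim i) (s n))

theorem tendsto_eLpNorm_two_of_dominated {F : ℕ → ℝ → G} {g : ℝ → G'}
    (hF : ∀ n, AEStronglyMeasurable (F n) volume) (hg : MemLp g 2 volume) (C : ℝ)
    (hb : ∀ n, ∀ᵐ x, ‖F n x‖ ≤ C * ‖g x‖) (hlim : ∀ᵐ x, Tendsto (fun n => F n x) atTop (𝓝 0)) :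
    Tendsto (fun n => eLpNorm (F n) 2 volume) atTop (𝓝 0) := by
  have h1 : Tendsto (fun n => ∫⁻ x, ‖F n x‖ₑ ^ (2 : ℝ)) atTop (𝓝 (∫⁻ _ : ℝ, 0)) := by
    refine tendsto_lintegral_of_dominated_convergence' (fun x => ‖C * ‖g x‖‖ₑ ^ (2 : ℝ))
      (fun n => (hF n).enorm.pow_const _) (fun n => ?_) ?_ ?_
    · filter_upwards [hb n] with x hx
      refine ENNReal.rpow_le_rpow ?_ (by norm_num)
      rw [enorm_le_iff_norm_le]
      exact hx.trans (Real.le_norm_self _)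
    · have h2 : MemLp (fun x => C * ‖g x‖) 2 volume := hg.norm.const_mul C
      have h3 := h2.eLpNorm_lt_top
      rw [eLpNorm_lt_top_iff_lintegral_rpow_enorm_lt_top (by norm_num) (by norm_num)] at h3
      simpa using h3.ne
    · filter_upwards [hlim] with x hx
      have h4 : Tendsto (fun n => ‖F n x‖ₑ) atTop (𝓝 0) := by simpa using hx.enorm
      simpa [Function.comp_def] using ((ENNReal.continuous_rpow_const (y := 2)).tendsto 0).comp h4
  have h2 := ((ENNReal.continuous_rpow_const (y := 1 / 2)).tendsto _).comp h1
  simp only [lintegral_zero] at h2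
  rw [ENNReal.zero_rpow_of_pos (by norm_num)] at h2
  refine h2.congr (fun n => ?_)
  rw [eLpNorm_eq_lintegral_rpow_enorm_toReal (by norm_num) (by norm_num)]
  simp

variable [NormedSpace ℝ G] [NormedSpace ℝ G']

theorem L2Bdd.clm {g : ι → ℝ → G} (h : L2Bdd g) {M : ι → ℝ → G →L[ℝ] G'}
    (hM : ∀ i, AEStronglyMeasurable (M i) volume) (C : ℝ) (hC : ∀ i x, ‖M i x‖ ≤ C) :
    L2Bdd (fun i x => M i x (g i x)) :=
  h.mono (fun i => (ContinuousLinearMap.id ℝ (G →L[ℝ] G')).aestronglyMeasurable_comp₂ (hM i)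
    (h.memLp i).1) C (fun i => .of_forall fun x => (M i x).le_of_opNorm_le (hC i x) _)

/-- Multipliers that are bounded and converge pointwise preserve convergence in `L²`. -/
theorem L2Conv.clm {f : ℕ → ι → ℝ → G} {g : ι → ℝ → G} (h : L2Conv f g)
    {M : ℕ → ι → ℝ → G →L[ℝ] G'} {L : ι → ℝ → G →L[ℝ] G'}
    (hM : ∀ n i, AEStronglyMeasurable (M n i) volume) (C : ℝ) (hC : ∀ n i x, ‖M n i x‖ ≤ C)
    (hlim : ∀ i x, Tendsto (fun n => M n i x) atTop (𝓝 (L i x))) :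
    L2Conv (fun n i x => M n i x (f n i x)) (fun i x => L i x (g i x)) := by
  have hL : ∀ i, AEStronglyMeasurable (L i) volume := fun i =>
    aestronglyMeasurable_of_tendsto_ae atTop (fun n => hM n i) (.of_forall fun x => hlim i x)
  have hLC : ∀ i x, ‖L i x‖ ≤ C := fun i x =>
    le_of_tendsto' (hlim i x).norm (fun n => hC n i x)
  have ap : ∀ {M : ℝ → G →L[ℝ] G'} {f : ℝ → G}, AEStronglyMeasurable M volume →
      AEStronglyMeasurable f volume → AEStronglyMeasurable (fun x => M x (f x)) volume :=
    fun hM hf => (ContinuousLinearMap.id ℝ (G →L[ℝ] G')).aestronglyMeasurable_comp₂ hM hf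
  have hlimBdd := h.bdd_lim.clm hL C hLC
  obtain ⟨B, hB⟩ := h.bound
  have key : ∀ n i, eLpNorm (fun x => M n i x (f n i x)) 2 volume ≤ (C.toNNReal * B : NNReal) :=
    fun n i => (eLpNorm_le_mul_eLpNorm_of_ae_le_mul (g := f n i) (c := C)
      (.of_forall fun x => (M n i x).le_of_opNorm_le (hC n i x) _) 2).trans (by
        push_cast; exact mul_le_mul_right (hB n i) _)
  refine ⟨fun n i => ⟨ap (hM n i) (h.memLp n i).1, (key n i).trans_lt ENNReal.coe_lt_top⟩,
    hlimBdd.memLp, ⟨_, key⟩, fun i => ?_⟩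
  -- Splitting `M f - L g = M (f - g) + (M - L) g`: the first term is small by the uniform bound on
  -- `M`, the second by dominated convergence, since `M → L` only pointwise.
  have t1 : Tendsto (fun n => ENNReal.ofReal C * eLpNorm (f n i - g i) 2 volume) atTop (𝓝 0) := by
    simpa using ENNReal.Tendsto.const_mul (h.tendsto i) (Or.inr ENNReal.ofReal_ne_top)
  have t2 : Tendsto (fun n => eLpNorm (fun x => (M n i x - L i x) (g i x)) 2 volume)
      atTop (𝓝 0) := by
    refine tendsto_eLpNorm_two_of_dominated
      (fun n => ap ((hM n i).sub (hL i)) (h.memLp_lim i).1) (h.memLp_lim i) (C + C)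
      (fun n => .of_forall fun x => ?_) (.of_forall fun x => ?_)
    · exact (M n i x - L i x).le_of_opNorm_le
        ((norm_sub_le _ _).trans (add_le_add (hC n i x) (hLC i x))) _
    · have h5 : Tendsto (fun n => M n i x - L i x) atTop (𝓝 0) := by
        simpa using (hlim i x).sub_const (L i x)
      have h6 := ((ContinuousLinearMap.apply ℝ G' (g i x)).continuous.tendsto 0).comp h5
      rw [map_zero] at h6
      exact h6
  refine tendsto_of_tendsto_of_tendsto_of_le_of_le tendsto_const_nhds
    (by simpa using t1.add t2) (fun n => zero_le) (fun n => ?_)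
  have h6 : (fun x => M n i x (f n i x)) - (fun x => L i x (g i x))
      = (fun x => M n i x (f n i x - g i x)) + (fun x => (M n i x - L i x) (g i x)) := by
    ext x; simp
  simp only [h6]
  refine (eLpNorm_add_le (ap (hM n i) ((h.memLp n i).sub (h.memLp_lim i)).1)
    (ap ((hM n i).sub (hL i)) (h.memLp_lim i).1) (by norm_num)).trans ?_
  exact add_le_add (eLpNorm_le_mul_eLpNorm_of_ae_le_mul (g := f n i - g i)
      (.of_forall fun x => (M n i x).le_of_opNorm_le (hC n i x) _) 2) le_rfl

theorem L2Conv.clm_const {f : ℕ → ι → ℝ → G} {g : ι → ℝ → G} (h : L2Conv f g)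
    {L : ι → ℝ → G →L[ℝ] G'}
    (hM : ∀ i, AEStronglyMeasurable (L i) volume) (C : ℝ) (hC : ∀ i x, ‖L i x‖ ≤ C) :
    L2Conv (fun n i x => L i x (f n i x)) (fun i x => L i x (g i x)) :=
  h.clm (fun _ => hM) C (fun _ => hC) (fun _ _ => tendsto_const_nhds)

theorem L2Conv.smul_const {f : ℕ → ι → ℝ → G} {g : ι → ℝ → G} (h : L2Conv f g)
    {a : ι → ℝ → ℝ} (ha : ∀ i, AEStronglyMeasurable (a i) volume) (C : ℝ)
    (hC : ∀ i x, |a i x| ≤ C) :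
    L2Conv (fun n i x => a i x • f n i x) (fun i x => a i x • g i x) := by
  have h1 := h.clm_const (G' := G) (L := fun i x => a i x • ContinuousLinearMap.id ℝ G)
    (fun i => (ha i).smul_const _) C (fun i x => by
      refine ContinuousLinearMap.opNorm_le_bound _ ((abs_nonneg _).trans (hC i x)) (fun y => ?_)
      simp only [smul_apply, ContinuousLinearMap.id_apply, norm_smul,
        Real.norm_eq_abs]
      gcongr
      exact hC i x)
  simpa using h1

/-- Averages over short intervals: `L²` estimate by Jensen's inequality. -/
theorem eLpNorm_average_sub_le [CompleteSpace G] {f k z : ℝ → G} (hf : StronglyMeasurable f)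
    (hf2 : MemLp f 2 volume) (hk : StronglyMeasurable k) {h : ℝ} (hh : h ≠ 0)
    (hz : ∀ x, z x = ∫ s in (0 : ℝ)..1, f (x + h * s)) (B : ℝ≥0∞)
    (hB : ∀ s ∈ Icc (0 : ℝ) 1, eLpNorm (fun x => f (x + h * s) - k x) 2 volume ≤ B) :
    eLpNorm (fun x => z x - k x) 2 volume ≤ B := by
  have : IsProbabilityMeasure (volume.restrict (Ioc (0 : ℝ) 1)) := ⟨by simp⟩
  have hfi : ∀ x, IntervalIntegrable (fun s => f (x + h * s)) volume 0 1 := fun x => by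
    have h1 : LocallyIntegrable f volume := hf2.locallyIntegrable (by norm_num)
    have h2 : IntervalIntegrable f volume (x + h * 0) (x + h * 1) :=
      (h1.integrableOn_isCompact isCompact_uIcc).intervalIntegrable
    have h3 := (h2.comp_add_left x).comp_mul_left (c := h)
    simpa [hh] using h3
  have hjm : StronglyMeasurable (fun p : ℝ × ℝ => f (p.1 + h * p.2) - k p.1) :=
    (hf.comp_measurable (by fun_prop)).sub (hk.comp_measurable measurable_fst)
  have pt : ∀ x, ‖z x - k x‖ₑ ^ (2 : ℝ)
      ≤ ∫⁻ s in Ioc (0 : ℝ) 1, ‖f (x + h * s) - k x‖ₑ ^ (2 : ℝ) := fun x => by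
    have e1 : z x - k x = ∫ s in Ioc (0 : ℝ) 1, (f (x + h * s) - k x) := by
      rw [hz, intervalIntegral.integral_of_le zero_le_one,
        integral_sub ((intervalIntegrable_iff_integrableOn_Ioc_of_le zero_le_one).1 (hfi x))
          (integrable_const _)]
      simp
    have m1 : AEStronglyMeasurable (fun s => f (x + h * s) - k x)
        (volume.restrict (Ioc (0 : ℝ) 1)) :=
      (hjm.comp_measurable (measurable_const.prodMk measurable_id)).aestronglyMeasurable
    have e2 : ‖z x - k x‖ₑ ≤ eLpNorm (fun s => f (x + h * s) - k x) 2
        (volume.restrict (Ioc (0 : ℝ) 1)) := by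
      rw [e1]
      refine (enorm_integral_le_lintegral_enorm _).trans ?_
      rw [← eLpNorm_one_eq_lintegral_enorm]
      exact eLpNorm_le_eLpNorm_of_exponent_le (by norm_num) m1
    rw [eLpNorm_eq_lintegral_rpow_enorm_toReal (by norm_num) (by norm_num)] at e2
    have e3 := ENNReal.rpow_le_rpow e2 (z := 2) (by norm_num)
    rw [← ENNReal.rpow_mul] at e3
    simpa using e3
  rw [eLpNorm_eq_lintegral_rpow_enorm_toReal (by norm_num) (by norm_num)]
  have e4 : ∫⁻ x, ‖z x - k x‖ₑ ^ (2 : ℝ) ≤ B ^ (2 : ℝ) := by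
    calc ∫⁻ x, ‖z x - k x‖ₑ ^ (2 : ℝ)
        ≤ ∫⁻ x, ∫⁻ s in Ioc (0 : ℝ) 1, ‖f (x + h * s) - k x‖ₑ ^ (2 : ℝ) := lintegral_mono pt
      _ = ∫⁻ s in Ioc (0 : ℝ) 1, ∫⁻ x, ‖f (x + h * s) - k x‖ₑ ^ (2 : ℝ) := by
        refine lintegral_lintegral_swap ?_
        exact (hjm.enorm.pow_const _).aemeasurable
      _ ≤ ∫⁻ s in Ioc (0 : ℝ) 1, B ^ (2 : ℝ) := by
        refine setLIntegral_mono measurable_const (fun s hs => ?_)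
        have := ENNReal.rpow_le_rpow (hB s ⟨hs.1.le, hs.2⟩) (z := 2) (by norm_num)
        rw [eLpNorm_eq_lintegral_rpow_enorm_toReal (by norm_num) (by norm_num),
          ← ENNReal.rpow_mul] at this
        simpa using this
      _ = B ^ (2 : ℝ) := by simp
  have e5 := ENNReal.rpow_le_rpow e4 (z := 1 / 2) (by norm_num)
  rw [← ENNReal.rpow_mul] at e5
  simpa using e5

theorem eLpNorm_average_le [CompleteSpace G] {f z : ℝ → G} (hf : StronglyMeasurable f)
    (hf2 : MemLp f 2 volume) {h : ℝ} (hh : h ≠ 0)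
    (hz : ∀ x, z x = ∫ s in (0 : ℝ)..1, f (x + h * s)) :
    eLpNorm z 2 volume ≤ eLpNorm f 2 volume := by
  have := eLpNorm_average_sub_le hf hf2 (k := fun _ => 0) stronglyMeasurable_const hh hz
    (eLpNorm f 2 volume) (fun s _ => by
      simp only [sub_zero]
      exact (eLpNorm_comp_measurePreserving hf2.1
        (measurePreserving_add_right (volume : Measure ℝ) (h * s))).le)
  simpa using this

/-- By Jensen the distance of an average to `g` is at most the worst distance of a translate of `f
n` to `g`. That is bounded by `‖f n - g‖` plus the translation error of `g` over lengths at most `|h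
n|`, and both tend to zero. -/
theorem L2Conv.average [CompleteSpace G] {f z : ℕ → ι → ℝ → G} {g : ι → ℝ → G} (H : L2Conv f g)
    (hf : ∀ n i, StronglyMeasurable (f n i)) (hzm : ∀ n i, AEStronglyMeasurable (z n i) volume)
    {h : ℕ → ℝ} (hh : ∀ n, h n ≠ 0) (hlim : Tendsto h atTop (𝓝 0))
    (hz : ∀ n i x, z n i x = ∫ s in (0 : ℝ)..1, f n i (x + h n * s)) : L2Conv z g := by
  obtain ⟨B, hB⟩ := H.bound
  have hzB : ∀ n i, eLpNorm (z n i) 2 volume ≤ B := fun n i =>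
    (eLpNorm_average_le (hf n i) (H.memLp n i) (hh n) (hz n i)).trans (hB n i)
  refine ⟨fun n i => ⟨hzm n i, (hzB n i).trans_lt ENNReal.coe_lt_top⟩, H.memLp_lim, ⟨B, hzB⟩,
    fun i => ?_⟩
  -- The Tonelli argument inside the averaging estimate needs joint measurability, hence a strongly
  -- measurable representative of the limit.
  obtain ⟨k, hk, hgk⟩ : ∃ k : ℝ → G, StronglyMeasurable k ∧ g i =ᵐ[volume] k :=
    ⟨_, (H.memLp_lim i).1.stronglyMeasurable_mk, (H.memLp_lim i).1.ae_eq_mk⟩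
  have hk2 : MemLp k 2 volume := (memLp_congr_ae hgk).1 (H.memLp_lim i)
  have t1 : Tendsto (fun n => eLpNorm (f n i - k) 2 volume) atTop (𝓝 0) :=
    (H.tendsto i).congr fun n => eLpNorm_congr_ae (by
      filter_upwards [hgk] with x hx using by simp [hx])
  rw [ENNReal.tendsto_nhds_zero]
  intro ε hε
  have hε2 : 0 < ε / 2 := ENNReal.half_pos hε.ne'
  have t2 := (ENNReal.tendsto_nhds_zero.1 (tendsto_eLpNorm_translation hk2)) (ε / 2) hε2
  obtain ⟨δ, hδ, hδb⟩ := Metric.eventually_nhds_iff.1 t2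
  filter_upwards [(ENNReal.tendsto_nhds_zero.1 t1) (ε / 2) hε2,
    (Metric.tendsto_nhds.1 hlim) δ hδ] with n h1 h2
  have h3 : eLpNorm (z n i - g i) 2 volume = eLpNorm (fun x => z n i x - k x) 2 volume :=
    eLpNorm_congr_ae (by filter_upwards [hgk] with x hx using by simp [hx])
  rw [h3]
  refine eLpNorm_average_sub_le (hf n i) (H.memLp n i) hk (hh n) (hz n i) ε (fun s hs => ?_)
  refine (eLpNorm_sub_translation_le (H.memLp n i) hk2 (h n * s)).trans ?_
  rw [← ENNReal.add_halves ε]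
  refine add_le_add h1 (hδb ?_)
  rw [dist_zero_right] at h2 ⊢
  rw [norm_mul]
  refine lt_of_le_of_lt ?_ h2
  have : ‖s‖ ≤ 1 := by rw [Real.norm_eq_abs, abs_of_nonneg hs.1]; exact hs.2
  nlinarith [norm_nonneg (h n)]

end L2

theorem integral_norm_sq_eq {G : Type*} [NormedAddCommGroup G] {f : ℝ → G} (hf : MemLp f 2 volume) :
    ∫ x, ‖f x‖ ^ 2 = (eLpNorm f 2 volume).toReal ^ 2 := by
  have h1 := hf.eLpNorm_eq_integral_rpow_norm (by norm_num) (by norm_num)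
  simp only [ENNReal.toReal_ofNat, Real.rpow_ofNat] at h1
  have h0 : 0 ≤ ∫ x, ‖f x‖ ^ 2 := integral_nonneg fun x => by positivity
  rw [h1, ENNReal.toReal_ofReal (by positivity), ← Real.rpow_natCast, ← Real.rpow_mul h0]
  norm_num

/-! ### Pairings of `L²` families. -/

section Inner

variable {ι G : Type*} [NormedAddCommGroup G] [InnerProductSpace ℝ G]

theorem MeasureTheory.MemLp.integrable_inner_two {f g : ℝ → G} (hf : MemLp f 2 volume)
    (hg : MemLp g 2 volume) : Integrable (fun x => inner ℝ (f x) (g x)) volume := by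
  refine (hf.norm.integrable_mul hg.norm).mono' (hf.1.inner hg.1) (.of_forall fun x => ?_)
  exact norm_inner_le_norm (f x) (g x)

theorem abs_integral_inner_le {f g : ℝ → G} (hf : MemLp f 2 volume) (hg : MemLp g 2 volume) :
    |∫ x, inner ℝ (f x) (g x)| ≤ (eLpNorm f 2 volume).toReal * (eLpNorm g 2 volume).toReal := by
  rw [← ENNReal.toReal_mul]
  have h1 : eLpNorm (fun x => inner ℝ (f x) (g x)) 1 volume
      ≤ (1 : NNReal) * eLpNorm f 2 volume * eLpNorm g 2 volume :=
    eLpNorm_le_eLpNorm_mul_eLpNorm_of_nnnorm hf.1 hg.1 (fun a b => inner ℝ a b) 1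
      (.of_forall fun x => by
        simpa using nnnorm_inner_le_nnnorm (𝕜 := ℝ) (f x) (g x))
  rw [eLpNorm_one_eq_lintegral_enorm] at h1
  have h2 := norm_integral_le_lintegral_norm (μ := volume) (fun x => inner ℝ (f x) (g x))
  rw [Real.norm_eq_abs] at h2
  refine h2.trans (ENNReal.toReal_mono (ENNReal.mul_ne_top hf.eLpNorm_ne_top hg.eLpNorm_ne_top) ?_)
  simpa [← Real.norm_eq_abs, ofReal_norm] using h1

theorem L2Conv.tendsto_integral_inner {f f' : ℕ → ι → ℝ → G} {g g' : ι → ℝ → G} (h : L2Conv f g)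
    (h' : L2Conv f' g') (i : ι) :
    Tendsto (fun n => ∫ x, inner ℝ (f n i x) (f' n i x)) atTop
      (𝓝 (∫ x, inner ℝ (g i x) (g' i x))) := by
  obtain ⟨B, hB⟩ := h.bound
  have s1 : ∀ n, ∫ x, inner ℝ (f n i x) (f' n i x) = (∫ x, inner ℝ (f n i x) ((f' n i - g' i) x))
      + (∫ x, inner ℝ ((f n i - g i) x) (g' i x)) + ∫ x, inner ℝ (g i x) (g' i x) := fun n => by
    have i1 := (h.memLp n i).integrable_inner_two ((h'.memLp n i).sub (h'.memLp_lim i))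
    have i2 := ((h.memLp n i).sub (h.memLp_lim i)).integrable_inner_two (h'.memLp_lim i)
    have i3 : Integrable (fun x => inner ℝ (f n i x) ((f' n i - g' i) x)
        + inner ℝ ((f n i - g i) x) (g' i x)) volume := i1.add i2
    rw [← integral_add i1 i2, ← integral_add i3 ((h.memLp_lim i).integrable_inner_two (h'.memLp_lim i))]
    congr 1; ext x
    simp only [Pi.sub_apply, inner_sub_left, inner_sub_right]; ring
  have z1 : Tendsto (fun n => (eLpNorm (f' n i - g' i) 2 volume).toReal) atTop (𝓝 0) := by
    exact (ENNReal.tendsto_toReal ENNReal.zero_ne_top).comp (h'.tendsto i)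
  have z2 : Tendsto (fun n => (eLpNorm (f n i - g i) 2 volume).toReal) atTop (𝓝 0) := by
    exact (ENNReal.tendsto_toReal ENNReal.zero_ne_top).comp (h.tendsto i)
  have t1 : Tendsto (fun n => ∫ x, inner ℝ (f n i x) ((f' n i - g' i) x)) atTop (𝓝 0) := by
    refine squeeze_zero_norm (fun n => ?_) (by simpa using z1.const_mul (B : ℝ))
    refine (abs_integral_inner_le (h.memLp n i) ((h'.memLp n i).sub (h'.memLp_lim i))).trans ?_
    gcongr
    simpa using ENNReal.toReal_mono ENNReal.coe_ne_top (hB n i)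
  have t2 : Tendsto (fun n => ∫ x, inner ℝ ((f n i - g i) x) (g' i x)) atTop (𝓝 0) := by
    refine squeeze_zero_norm (fun n => ?_)
      (by simpa using z2.mul_const (eLpNorm (g' i) 2 volume).toReal)
    exact abs_integral_inner_le ((h.memLp n i).sub (h.memLp_lim i)) (h'.memLp_lim i)
  have := (t1.add t2).add_const (∫ x, inner ℝ (g i x) (g' i x))
  simp only [zero_add] at this
  exact this.congr fun n => (s1 n).symm

theorem L2Conv.bound_integral_inner {f f' : ℕ → ι → ℝ → G} {g g' : ι → ℝ → G} (h : L2Conv f g)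
    (h' : L2Conv f' g') : ∃ C : ℝ, ∀ n i, |∫ x, inner ℝ (f n i x) (f' n i x)| ≤ C := by
  obtain ⟨B, hB⟩ := h.bound
  obtain ⟨B', hB'⟩ := h'.bound
  refine ⟨B * B', fun n i => (abs_integral_inner_le (h.memLp n i) (h'.memLp n i)).trans ?_⟩
  gcongr
  · simpa using ENNReal.toReal_mono ENNReal.coe_ne_top (hB n i)
  · simpa using ENNReal.toReal_mono ENNReal.coe_ne_top (hB' n i)

end Inner

/-! ### Weak derivatives, Sobolev norms and their values on `C¹` functions. -/

section WeakDeriv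

variable {N : ℕ}

theorem IsWeakDeriv.ae_unique {f g g' : ℝ → StateSpace N} (h : IsWeakDeriv f g)
    (h' : IsWeakDeriv f g') : g =ᵐ[volume] g' := by
  refine ae_eq_of_integral_contDiff_smul_eq h.locallyIntegrable_deriv h'.locallyIntegrable_deriv
    (fun φ hφ hs => ?_)
  have h1 := h.integral_eq φ hφ hs
  rw [h'.integral_eq φ hφ hs] at h1
  exact (neg_injective h1).symm

theorem IsWeakDeriv.congr {f f' g g' : ℝ → StateSpace N} (h : IsWeakDeriv f g)
    (hf : f =ᵐ[volume] f') (hg : g =ᵐ[volume] g') : IsWeakDeriv f' g' where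
  locallyIntegrable := h.locallyIntegrable.congr hf
  locallyIntegrable_deriv := h.locallyIntegrable_deriv.congr hg
  integral_eq φ hφ hs := by
    have e1 : ∫ x, deriv φ x • f' x = ∫ x, deriv φ x • f x :=
      integral_congr_ae (by filter_upwards [hf] with x hx using by rw [hx])
    have e2 : ∫ x, φ x • g' x = ∫ x, φ x • g x :=
      integral_congr_ae (by filter_upwards [hg] with x hx using by rw [hx])
    rw [e1, e2, h.integral_eq φ hφ hs]

theorem integrable_testFun_smul {f : ℝ → StateSpace N} (hf : LocallyIntegrable f volume)
    {φ : ℝ → ℝ} (hφ : Continuous φ) (hs : HasCompactSupport φ) :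
    Integrable (fun x => φ x • f x) volume :=
  hf.integrable_smul_left_of_hasCompactSupport hφ hs

theorem IsWeakDeriv.sub {f f' g g' : ℝ → StateSpace N} (h : IsWeakDeriv f g)
    (h' : IsWeakDeriv f' g') : IsWeakDeriv (f - f') (g - g') where
  locallyIntegrable := h.locallyIntegrable.sub h'.locallyIntegrable
  locallyIntegrable_deriv := h.locallyIntegrable_deriv.sub h'.locallyIntegrable_deriv
  integral_eq φ hφ hs := by
    have hφ' : Continuous (deriv φ) := hφ.continuous_deriv (by simp)
    simp only [Pi.sub_apply, smul_sub]
    rw [integral_sub (integrable_testFun_smul h.locallyIntegrable hφ' hs.deriv)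
        (integrable_testFun_smul h'.locallyIntegrable hφ' hs.deriv),
      integral_sub (integrable_testFun_smul h.locallyIntegrable_deriv hφ.continuous hs)
        (integrable_testFun_smul h'.locallyIntegrable_deriv hφ.continuous hs),
      h.integral_eq φ hφ hs, h'.integral_eq φ hφ hs]
    abel

theorem isWeakDeriv_of_hasDerivAt {f f' : ℝ → StateSpace N} (h : ∀ x, HasDerivAt f (f' x) x)
    (hc : Continuous f') : IsWeakDeriv f f' := by
  have hf : Continuous f := continuous_iff_continuousAt.2 fun x => (h x).continuousAt
  refine ⟨hf.locallyIntegrable, hc.locallyIntegrable, fun φ hφ hs => ?_⟩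
  have hφ' : Continuous (deriv φ) := hφ.continuous_deriv (by simp)
  have i1 := integrable_testFun_smul hf.locallyIntegrable hφ' hs.deriv
  have i2 := integrable_testFun_smul hc.locallyIntegrable hφ.continuous hs
  have h1 := integral_eq_zero_of_hasDerivAt_of_integrable (f := fun x => φ x • f x)
    (f' := fun x => φ x • f' x + deriv φ x • f x)
    (fun x => ((hφ.differentiable (by simp) x).hasDerivAt).smul (h x)) (i2.add i1)
    (integrable_testFun_smul hf.locallyIntegrable hφ.continuous hs)
  rw [integral_add i2 i1] at h1
  exact eq_neg_of_add_eq_zero_right h1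

theorem deriv_smoothTransition_eq_zero {y : ℝ} (hy : y ∉ Icc (0 : ℝ) 1) :
    deriv Real.smoothTransition y = 0 := by
  rw [mem_Icc, not_and_or, not_le, not_le] at hy
  rcases hy with hy | hy
  · have : Real.smoothTransition =ᶠ[𝓝 y] fun _ => 0 := by
      filter_upwards [gt_mem_nhds hy] with z hz using Real.smoothTransition.zero_of_nonpos hz.le
    rw [this.deriv_eq]; simp
  · have : Real.smoothTransition =ᶠ[𝓝 y] fun _ => 1 := by
      filter_upwards [lt_mem_nhds hy] with z hz using Real.smoothTransition.one_of_one_le hz.le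
    rw [this.deriv_eq]; simp

/-- The rescaled derivative of the smooth transition is a one-sided approximate identity: it has
integral one and is supported in `[a, a + 1/(n+1)]`. -/
theorem tendsto_integral_deriv_smoothTransition_smul {f : ℝ → StateSpace N} (hf : Continuous f)
    (a : ℝ) : Tendsto (fun n : ℕ => ∫ x, (deriv Real.smoothTransition (((n : ℝ) + 1) * (x - a))
      * ((n : ℝ) + 1)) • f x) atTop (𝓝 (f a)) := by
  have hS : ContDiff ℝ ∞ Real.smoothTransition := Real.smoothTransition.contDiff
  have hS' : Continuous (deriv Real.smoothTransition) := hS.continuous_deriv (by simp)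
  have e : ∀ n : ℕ, ∫ x, (deriv Real.smoothTransition (((n : ℝ) + 1) * (x - a))
      * ((n : ℝ) + 1)) • f x
      = ∫ y in (0 : ℝ)..1, deriv Real.smoothTransition y • f (a + y / ((n : ℝ) + 1)) := fun n => by
    have hn : (0 : ℝ) < (n : ℝ) + 1 := by positivity
    have h1 : ∀ x, (deriv Real.smoothTransition (((n : ℝ) + 1) * (x - a)) * ((n : ℝ) + 1)) • f x
        = (fun z => (fun y => ((n : ℝ) + 1) • (deriv Real.smoothTransition y
          • f (a + y / ((n : ℝ) + 1)))) (((n : ℝ) + 1) * z)) (x - a) := fun x => by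
      simp only [smul_smul]
      rw [mul_comm, mul_div_cancel_left₀ _ hn.ne', add_sub_cancel]
    simp_rw [h1]
    rw [integral_sub_right_eq_self (fun z => (fun y => ((n : ℝ) + 1)
      • (deriv Real.smoothTransition y • f (a + y / ((n : ℝ) + 1)))) (((n : ℝ) + 1) * z)) a,
      Measure.integral_comp_mul_left (fun y => ((n : ℝ) + 1)
        • (deriv Real.smoothTransition y • f (a + y / ((n : ℝ) + 1)))), integral_smul, abs_of_pos (inv_pos.2 hn), smul_smul,
      inv_mul_cancel₀ hn.ne', one_smul, intervalIntegral.integral_of_le zero_le_one,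
      ← integral_Icc_eq_integral_Ioc, setIntegral_eq_integral_of_forall_compl_eq_zero]
    intro y hy
    rw [deriv_smoothTransition_eq_zero hy, zero_smul]
  simp_rw [e]
  have h2 : f a = ∫ y in (0 : ℝ)..1, deriv Real.smoothTransition y • f a := by
    rw [intervalIntegral.integral_smul_const, intervalIntegral.integral_deriv_eq_sub
      (fun x _ => hS.differentiable (by simp) x) (hS'.intervalIntegrable _ _)]
    simp
  rw [h2]
  obtain ⟨C, hC⟩ := (isCompact_Icc (a := a) (b := a + 1)).exists_bound_of_continuousOn
    hf.continuousOn
  refine intervalIntegral.tendsto_integral_filter_of_dominated_convergence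
    (fun y => ‖deriv Real.smoothTransition y‖ * C) (.of_forall fun n => ?_) (.of_forall fun n => ?_)
    ((hS'.norm.mul continuous_const).intervalIntegrable _ _) (.of_forall fun y _ => ?_)
  · exact (Continuous.aestronglyMeasurable (by fun_prop))
  · refine .of_forall fun y hy => ?_
    rw [uIoc_of_le zero_le_one] at hy
    rw [norm_smul]
    gcongr
    refine hC _ ⟨by have := hy.1; simp; positivity, ?_⟩
    gcongr
    rw [div_le_one (by positivity)]
    have := hy.2
    have : (0 : ℝ) ≤ n := by positivity
    linarith
  · refine tendsto_const_nhds.smul ((hf.tendsto a).comp ?_)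
    have h3 : Tendsto (fun n : ℕ => y / ((n : ℝ) + 1)) atTop (𝓝 0) :=
      tendsto_const_nhds.div_atTop (tendsto_atTop_add_const_right _ _ tendsto_natCast_atTop_atTop)
    simpa using h3.const_add a

/-- The test functions rise from 0 to 1 just to the right of `a` and fall back to 0 just to the
right of `b`. They tend pointwise to the indicator of `(a, b]`, and their derivatives act on
continuous functions like `δ_a - δ_b` in the limit. -/
theorem IsWeakDeriv.sub_eq_integral_of_lt {f g : ℝ → StateSpace N} (h : IsWeakDeriv f g)
    (hf : Continuous f) {a b : ℝ} (hab : a < b) : f b - f a = ∫ x in a..b, g x := by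
  have hS : ContDiff ℝ ∞ Real.smoothTransition := Real.smoothTransition.contDiff
  let φ : ℕ → ℝ → ℝ := fun n x => Real.smoothTransition (((n : ℝ) + 1) * (x - a))
    - Real.smoothTransition (((n : ℝ) + 1) * (x - b))
  have hφd : ∀ n x, HasDerivAt (φ n) (deriv Real.smoothTransition (((n : ℝ) + 1) * (x - a))
      * ((n : ℝ) + 1) - deriv Real.smoothTransition (((n : ℝ) + 1) * (x - b)) * ((n : ℝ) + 1)) x := by
    intro n x
    have key : ∀ c : ℝ, HasDerivAt (fun x => Real.smoothTransition (((n : ℝ) + 1) * (x - c)))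
        (deriv Real.smoothTransition (((n : ℝ) + 1) * (x - c)) * ((n : ℝ) + 1)) x := fun c => by
      have h1 := (hS.differentiable (by simp) (((n : ℝ) + 1) * (x - c))).hasDerivAt
      have h2 : HasDerivAt (fun x => ((n : ℝ) + 1) * (x - c)) ((n : ℝ) + 1) x := by
        simpa using ((hasDerivAt_id x).sub_const c).const_mul ((n : ℝ) + 1)
      exact h1.comp x h2
    exact (key a).sub (key b)
  have hφs : ∀ n, ContDiff ℝ ∞ (φ n) := fun n =>
    (hS.comp (by fun_prop)).sub (hS.comp (by fun_prop))
  -- Each ramp has length `1/(n+1) ≤ 1`, so one compact interval contains all the supports.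
  have hφ0 : ∀ n x, x ∉ Icc a (b + 1) → φ n x = 0 := fun n x hx => by
    have hn : (1 : ℝ) ≤ (n : ℝ) + 1 := by linarith [(Nat.cast_nonneg n : (0 : ℝ) ≤ n)]
    rw [mem_Icc, not_and_or, not_le, not_le] at hx
    simp only [φ]
    rcases hx with hx | hx
    · rw [Real.smoothTransition.zero_of_nonpos (by nlinarith),
        Real.smoothTransition.zero_of_nonpos (by nlinarith), sub_zero]
    · rw [Real.smoothTransition.one_of_one_le (by nlinarith),
        Real.smoothTransition.one_of_one_le (by nlinarith), sub_self]
  have hφc : ∀ n, HasCompactSupport (φ n) := fun n => HasCompactSupport.intro isCompact_Icc (hφ0 n)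
  have t1 : Tendsto (fun n => ∫ x, deriv (φ n) x • f x) atTop (𝓝 (f a - f b)) := by
    refine ((tendsto_integral_deriv_smoothTransition_smul hf a).sub
      (tendsto_integral_deriv_smoothTransition_smul hf b)).congr fun n => ?_
    have hint : ∀ c : ℝ, Integrable (fun x => (deriv Real.smoothTransition
        (((n : ℝ) + 1) * (x - c)) * ((n : ℝ) + 1)) • f x) volume := fun c => by
      have hS' : Continuous (deriv Real.smoothTransition) := hS.continuous_deriv (by simp)
      refine integrable_testFun_smul hf.locallyIntegrable (by fun_prop)
        (HasCompactSupport.intro (isCompact_Icc (a := c) (b := c + 1)) fun x hx => ?_)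
      rw [deriv_smoothTransition_eq_zero, zero_mul]
      have hn : (1 : ℝ) ≤ (n : ℝ) + 1 := by linarith [(Nat.cast_nonneg n : (0 : ℝ) ≤ n)]
      rw [mem_Icc, not_and_or, not_le, not_le] at hx ⊢
      rcases hx with hx | hx
      · left; nlinarith
      · right; nlinarith
    rw [← integral_sub (hint a) (hint b)]
    congr 1; ext1 x
    rw [(hφd n x).deriv, sub_smul]
  have t2 : Tendsto (fun n => ∫ x, φ n x • g x) atTop (𝓝 (∫ x, (Ioc a b).indicator g x)) := by
    have hb1 : ∀ n x, ‖φ n x‖ ≤ 1 := fun n x => by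
      have h1 := Real.smoothTransition.nonneg (((n : ℝ) + 1) * (x - a))
      have h2 := Real.smoothTransition.le_one (((n : ℝ) + 1) * (x - a))
      have h3 := Real.smoothTransition.nonneg (((n : ℝ) + 1) * (x - b))
      have h4 := Real.smoothTransition.le_one (((n : ℝ) + 1) * (x - b))
      rw [Real.norm_eq_abs, abs_le]
      constructor <;> simp only [φ] <;> linarith
    have hgi : IntegrableOn g (Icc a (b + 1)) volume :=
      h.locallyIntegrable_deriv.integrableOn_isCompact isCompact_Icc
    refine tendsto_integral_of_dominated_convergence
      ((Icc a (b + 1)).indicator fun x => ‖g x‖) (fun n => ?_) ?_ (fun n => ?_) ?_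
    · exact ((hφs n).continuous.aestronglyMeasurable).smul
        h.locallyIntegrable_deriv.aestronglyMeasurable
    · rw [integrable_indicator_iff measurableSet_Icc]; exact hgi.norm
    · refine .of_forall fun x => ?_
      by_cases hx : x ∈ Icc a (b + 1)
      · rw [indicator_of_mem hx, norm_smul]
        exact mul_le_of_le_one_left (norm_nonneg _) (hb1 n x)
      · rw [indicator_of_notMem hx, hφ0 n x hx]; simp
    · refine .of_forall fun x => ?_
      have lim : ∀ c : ℝ, c < x → Tendsto (fun n : ℕ => Real.smoothTransition
          (((n : ℝ) + 1) * (x - c))) atTop (𝓝 1) := fun c hc => by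
        refine tendsto_const_nhds.congr' ?_
        have h1 : Tendsto (fun n : ℕ => ((n : ℝ) + 1) * (x - c)) atTop atTop :=
          (tendsto_atTop_add_const_right _ _ tendsto_natCast_atTop_atTop).atTop_mul_const
            (sub_pos.2 hc)
        filter_upwards [h1.eventually_ge_atTop 1] with n hn
        rw [Real.smoothTransition.one_of_one_le hn]
      have z : ∀ c : ℝ, x ≤ c → ∀ n : ℕ,
          Real.smoothTransition (((n : ℝ) + 1) * (x - c)) = 0 := fun c hc n =>
        Real.smoothTransition.zero_of_nonpos
          (mul_nonpos_of_nonneg_of_nonpos (by positivity) (by linarith))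
      simp only [φ]
      by_cases hxa : x ≤ a
      · simp [z a hxa, z b (hxa.trans hab.le), hxa.not_gt]
      · rw [not_le] at hxa
        by_cases hxb : x ≤ b
        · rw [indicator_of_mem (s := Ioc a b) ⟨hxa, hxb⟩]
          simpa [z b hxb] using (lim a hxa).smul_const (g x)
        · rw [not_le] at hxb
          rw [indicator_of_notMem (s := Ioc a b) (fun hx => hxb.not_ge hx.2)]
          simpa using ((lim a hxa).sub (lim b hxb)).smul_const (g x)
  have t3 : Tendsto (fun n => ∫ x, deriv (φ n) x • f x) atTop
      (𝓝 (-∫ x, (Ioc a b).indicator g x)) :=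
    t2.neg.congr fun n => (h.integral_eq (φ n) (hφs n) (hφc n)).symm
  have h4 := tendsto_nhds_unique t1 t3
  rw [integral_indicator measurableSet_Ioc, ← intervalIntegral.integral_of_le hab.le] at h4
  rw [← neg_sub, h4, neg_neg]

theorem IsWeakDeriv.sub_eq_integral {f g : ℝ → StateSpace N} (h : IsWeakDeriv f g)
    (hf : Continuous f) (a b : ℝ) : f b - f a = ∫ x in a..b, g x := by
  rcases lt_trichotomy a b with hab | hab | hab
  · exact h.sub_eq_integral_of_lt hf hab
  · simp [hab]
  · rw [intervalIntegral.integral_symm, ← h.sub_eq_integral_of_lt hf hab, neg_sub]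

theorem sobolevSq_congr {f g : ℝ → StateSpace N} (h : f =ᵐ[volume] g) (k : ℕ) :
    sobolevSq k f = sobolevSq k g := by
  cases k with
  | zero => simp only [sobolevSq, eLpNorm_congr_ae h]
  | succ k =>
    simp only [sobolevSq, eLpNorm_congr_ae h]
    congr 1
    refine iInf_congr fun k' => iInf_congr_Prop ?_ fun _ => rfl
    exact ⟨fun h' => h'.congr h .rfl, fun h' => h'.congr h.symm .rfl⟩

/-- Weak derivatives agree almost everywhere, so the infimum is over a single class. -/
theorem sobolevSq_succ_eq {f g : ℝ → StateSpace N} (h : IsWeakDeriv f g) (k : ℕ) :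
    sobolevSq (k + 1) f = eLpNorm f 2 volume ^ 2 + sobolevSq k g := by
  rw [sobolevSq]
  congr 1
  refine le_antisymm (iInf₂_le g h) (le_iInf₂ fun g' hg' => ?_)
  rw [sobolevSq_congr (h.ae_unique hg') k]

theorem sobolevSq_two_eq {f g w : ℝ → StateSpace N} (h : IsWeakDeriv f g) (h' : IsWeakDeriv g w) :
    sobolevSq 2 f
      = eLpNorm f 2 volume ^ 2 + (eLpNorm g 2 volume ^ 2 + eLpNorm w 2 volume ^ 2) := by
  rw [sobolevSq_succ_eq h, sobolevSq_succ_eq h', sobolevSq]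

/-- A finite infimum must be attained by some actual weak derivative. Its strongly measurable
version is kept because averages of it are formed later. -/
theorem MemH.exists_second_deriv {f f' : ℝ → StateSpace N} (hf : MemH 2 f)
    (hd : ∀ x, HasDerivAt f (f' x) x) (hc : Continuous f') :
    ∃ w : ℝ → StateSpace N, StronglyMeasurable w ∧ MemLp f 2 volume ∧ MemLp f' 2 volume ∧
      MemLp w 2 volume ∧ IsWeakDeriv f' w := by
  have hw := isWeakDeriv_of_hasDerivAt hd hc
  have h1 : sobolevSq 2 f < ⊤ := hf.2
  rw [sobolevSq_succ_eq hw, ENNReal.add_lt_top, sobolevSq, ENNReal.add_lt_top] at h1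
  obtain ⟨h2, h3, h4⟩ := h1
  obtain ⟨w, h5⟩ := iInf_lt_iff.1 h4
  obtain ⟨hw', h6⟩ := iInf_lt_iff.1 h5
  have hwm := hw'.locallyIntegrable_deriv.aestronglyMeasurable
  have h7 := hwm.ae_eq_mk
  rw [sobolevSq] at h6
  refine ⟨hwm.mk w, hwm.stronglyMeasurable_mk, ⟨hf.1, ?_⟩, ⟨hc.aestronglyMeasurable, ?_⟩,
    (memLp_congr_ae h7).1 ⟨hwm, ?_⟩, hw'.congr .rfl h7⟩
  · simpa [ENNReal.pow_lt_top_iff] using h2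
  · simpa [ENNReal.pow_lt_top_iff] using h3
  · simpa [ENNReal.pow_lt_top_iff] using h6

/-- The set where a continuous function exceeds its essential bound is open and null, hence empty.
-/
theorem norm_le_of_eLpNorm_top_le {f : ℝ → StateSpace N} (hf : Continuous f) {ε : ℝ} (hε : 0 ≤ ε)
    (h : eLpNorm f ⊤ volume ≤ ENNReal.ofReal ε) (x : ℝ) : ‖f x‖ ≤ ε := by
  have h1 : ∀ᵐ x, ‖f x‖ ≤ ε := by
    filter_upwards [ae_le_eLpNormEssSup (f := f) (μ := volume)] with x hx
    rw [eLpNorm_exponent_top] at h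
    have h2 := hx.trans h
    rwa [← ofReal_norm, ENNReal.ofReal_le_ofReal_iff hε] at h2
  have ho : IsOpen {x | ε < ‖f x‖} := isOpen_lt continuous_const hf.norm
  have h2 : volume {x | ε < ‖f x‖} = 0 := by simpa [ae_iff] using h1
  have h3 := ho.eq_empty_of_measure_zero h2
  by_contra hx
  exact notMem_empty x (h3 ▸ (not_le.1 hx : x ∈ {x | ε < ‖f x‖}))

theorem norm_le_of_w1InfNorm_le {f f' : ℝ → StateSpace N} (hd : ∀ x, HasDerivAt f (f' x) x)
    (hc : Continuous f') {ε : ℝ} (hε : 0 ≤ ε) (h : w1InfNorm f ≤ ENNReal.ofReal ε) (x : ℝ) :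
    ‖f x‖ ≤ ε ∧ ‖f' x‖ ≤ ε := by
  have hf : Continuous f := continuous_iff_continuousAt.2 fun x => (hd x).continuousAt
  rw [w1InfNorm, max_le_iff] at h
  refine ⟨norm_le_of_eLpNorm_top_le hf hε h.1 x, norm_le_of_eLpNorm_top_le hc hε (le_trans ?_ h.2) x⟩
  refine le_iInf₂ fun g hg => ?_
  rw [eLpNorm_congr_ae ((isWeakDeriv_of_hasDerivAt hd hc).ae_unique hg)]

theorem hNorm_two_sq {f g w : ℝ → StateSpace N} (h : IsWeakDeriv f g) (h' : IsWeakDeriv g w)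
    (hf : MemLp f 2 volume) (hg : MemLp g 2 volume) (hw : MemLp w 2 volume) :
    hNorm 2 f ^ 2 = (∫ x, ‖f x‖ ^ 2) + (∫ x, ‖g x‖ ^ 2) + ∫ x, ‖w x‖ ^ 2 := by
  rw [hNorm, Real.sq_sqrt ENNReal.toReal_nonneg, sobolevSq_two_eq h h', integral_norm_sq_eq hf,
    integral_norm_sq_eq hg, integral_norm_sq_eq hw]
  have := hf.eLpNorm_ne_top
  have := hg.eLpNorm_ne_top
  have := hw.eLpNorm_ne_top
  rw [ENNReal.toReal_add (by finiteness) (by finiteness),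
    ENNReal.toReal_add (by finiteness) (by finiteness)]
  simp only [ENNReal.toReal_pow]
  ring

theorem hNorm_zero_sq {f : ℝ → StateSpace N} (hf : MemLp f 2 volume) :
    hNorm 0 f ^ 2 = ∫ x, ‖f x‖ ^ 2 := by
  rw [hNorm, Real.sq_sqrt ENNReal.toReal_nonneg, sobolevSq, integral_norm_sq_eq hf,
    ENNReal.toReal_pow]

theorem continuousOn_eLpNorm_toReal {T : ℝ} {F : ℝ → ℝ → StateSpace N}
    (hF : ∀ t ∈ Icc 0 T, MemLp (F t) 2 volume)
    (hc : ∀ t₀ ∈ Icc 0 T,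
      Tendsto (fun t => eLpNorm (F t - F t₀) 2 volume) (𝓝[Icc 0 T] t₀) (𝓝 0)) :
    ContinuousOn (fun t => (eLpNorm (F t) 2 volume).toReal) (Icc 0 T) := by
  intro t₀ h₀
  rw [ContinuousWithinAt, tendsto_iff_dist_tendsto_zero]
  have h1 : Tendsto (fun t => (eLpNorm (F t - F t₀) 2 volume).toReal) (𝓝[Icc 0 T] t₀) (𝓝 0) :=
    (ENNReal.tendsto_toReal ENNReal.zero_ne_top).comp (hc t₀ h₀)
  refine squeeze_zero' (.of_forall fun _ => dist_nonneg) ?_ h1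
  filter_upwards [self_mem_nhdsWithin] with t ht
  have e : eLpNorm (F t - F t₀) 2 volume = eLpNorm (F t₀ - F t) 2 volume := eLpNorm_sub_comm _ _ _ _
  have key : ∀ a b : ℝ → StateSpace N, MemLp a 2 volume → MemLp b 2 volume →
      (eLpNorm a 2 volume).toReal - (eLpNorm b 2 volume).toReal
        ≤ (eLpNorm (a - b) 2 volume).toReal := fun a b ha hb => by
    rw [sub_le_iff_le_add, ← ENNReal.toReal_add (ha.sub hb).eLpNorm_ne_top hb.eLpNorm_ne_top]
    refine ENNReal.toReal_mono
      (ENNReal.add_ne_top.2 ⟨(ha.sub hb).eLpNorm_ne_top, hb.eLpNorm_ne_top⟩) ?_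
    simpa using eLpNorm_add_le (ha.sub hb).1 hb.1 (by norm_num : (1 : ℝ≥0∞) ≤ 2)
  rw [Real.dist_eq, abs_sub_le_iff]
  exact ⟨key _ _ (hF t ht) (hF t₀ h₀), e ▸ key _ _ (hF t₀ h₀) (hF t ht)⟩

/-- A continuous norm on the compact time interval is bounded. -/
theorem l2Bdd_of_tendsto {T : ℝ} {F : ℝ → ℝ → StateSpace N}
    (hF : ∀ t ∈ Icc 0 T, MemLp (F t) 2 volume)
    (hc : ∀ t₀ ∈ Icc 0 T,
      Tendsto (fun t => eLpNorm (F t - F t₀) 2 volume) (𝓝[Icc 0 T] t₀) (𝓝 0)) :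
    L2Bdd (fun t : Icc 0 T => F t) := by
  obtain ⟨C, hC⟩ := isCompact_Icc.exists_bound_of_continuousOn (continuousOn_eLpNorm_toReal hF hc)
  refine ⟨fun t => hF t t.2, C.toNNReal, fun t => ?_⟩
  have h1 := hC t t.2
  rw [← ENNReal.ofReal_toReal (hF t t.2).eLpNorm_ne_top]
  exact ENNReal.ofReal_le_ofReal ((Real.le_norm_self _).trans h1)

theorem ContinuousInH.tendsto_eLpNorm {T : ℝ} {V g w : ℝ → ℝ → StateSpace N}
    (hV : ContinuousInH 2 T V) (hg : ∀ t ∈ Icc 0 T, IsWeakDeriv (V t) (g t))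
    (hw : ∀ t ∈ Icc 0 T, IsWeakDeriv (g t) (w t)) (t₀ : ℝ) (h₀ : t₀ ∈ Icc 0 T) :
    Tendsto (fun t => eLpNorm (V t - V t₀) 2 volume) (𝓝[Icc 0 T] t₀) (𝓝 0) ∧
    Tendsto (fun t => eLpNorm (g t - g t₀) 2 volume) (𝓝[Icc 0 T] t₀) (𝓝 0) ∧
    Tendsto (fun t => eLpNorm (w t - w t₀) 2 volume) (𝓝[Icc 0 T] t₀) (𝓝 0) := by
  have h1 := ((ENNReal.continuous_rpow_const (y := 1 / 2)).tendsto 0).comp (hV.2 t₀ h₀)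
  rw [ENNReal.zero_rpow_of_pos (by norm_num)] at h1
  have key : ∀ F : ℝ → ℝ≥0∞, (∀ t ∈ Icc 0 T, F t ^ 2 ≤ sobolevSq 2 (V t - V t₀)) →
      Tendsto F (𝓝[Icc 0 T] t₀) (𝓝 0) := fun F hF => by
    refine tendsto_of_tendsto_of_tendsto_of_le_of_le' tendsto_const_nhds h1
      (.of_forall fun _ => zero_le) ?_
    filter_upwards [self_mem_nhdsWithin] with t ht
    have h2 := ENNReal.rpow_le_rpow (hF t ht) (z := 1 / 2) (by norm_num)
    rw [← ENNReal.rpow_natCast, ← ENNReal.rpow_mul] at h2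
    simpa using h2
  have e : ∀ t ∈ Icc 0 T, _ := fun t ht =>
    sobolevSq_two_eq ((hg t ht).sub (hg t₀ h₀)) ((hw t ht).sub (hw t₀ h₀))
  refine ⟨key _ fun t ht => ?_, key _ fun t ht => ?_, key _ fun t ht => ?_⟩
  · rw [e t ht]; exact le_self_add
  · rw [e t ht]; exact le_self_add.trans le_add_self
  · rw [e t ht]; exact le_add_self.trans le_add_self

end WeakDeriv

/-! ### Simple real spectra: smooth spectral resolutions and the meaning of stability at high
frequencies. -/

section Spectral

variable {N : ℕ}

/-- `ev` lists `N` distinct real eigenvalues of `A` in increasing order. -/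
structure IsSimpleSpectrum (A : Matrix (Fin N) (Fin N) ℝ) (ev : Fin N → ℝ) : Prop where
  strictMono : StrictMono ev
  isRoot : ∀ j, A.charpoly.IsRoot (ev j)

theorem IsSimpleSpectrum.charpoly_eq {A : Matrix (Fin N) (Fin N) ℝ} {ev : Fin N → ℝ}
    (h : IsSimpleSpectrum A ev) :
    A.charpoly = ∏ j, (Polynomial.X - Polynomial.C (ev j)) := by
  refine Polynomial.eq_of_monic_of_dvd_of_natDegree_le
    (Polynomial.monic_prod_of_monic _ _ fun j _ => Polynomial.monic_X_sub_C _)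
    (Matrix.charpoly_monic A) ?_ ?_
  · refine Finset.prod_dvd_of_coprime (fun i _ j _ hij =>
      Polynomial.pairwise_coprime_X_sub_C h.strictMono.injective hij) fun j _ => ?_
    exact Polynomial.dvd_iff_isRoot.2 (h.isRoot j)
  · rw [Matrix.charpoly_natDegree_eq_dim, Polynomial.natDegree_prod_of_monic _ _
      fun j _ => Polynomial.monic_X_sub_C _]
    simp

/-- Both lists enumerate the roots of the characteristic polynomial in increasing order. The ordered
eigenvalues are thus functions of the matrix, and locally constructed branches agree with any global
choice. -/
theorem IsSimpleSpectrum.unique {A : Matrix (Fin N) (Fin N) ℝ} {ev ev' : Fin N → ℝ}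
    (h : IsSimpleSpectrum A ev) (h' : IsSimpleSpectrum A ev') : ev = ev' := by
  refine (h.strictMono.range_inj h'.strictMono).1 ?_
  have key : ∀ {e : Fin N → ℝ}, IsSimpleSpectrum A e → range e = {x | A.charpoly.IsRoot x} := by
    intro e he
    ext x
    rw [mem_ofPred_eq, he.charpoly_eq, Polynomial.IsRoot, Polynomial.eval_prod,
      Finset.prod_eq_zero_iff]
    simp [sub_eq_zero, eq_comm]
  rw [key h, key h']

theorem IsSimpleSpectrum.derivative_ne_zero {A : Matrix (Fin N) (Fin N) ℝ} {ev : Fin N → ℝ}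
    (h : IsSimpleSpectrum A ev) (j : Fin N) : A.charpoly.derivative.eval (ev j) ≠ 0 := by
  have h1 : A.charpoly.Separable := by
    rw [h.charpoly_eq, Polynomial.separable_prod_X_sub_C_iff]
    exact h.strictMono.injective
  simpa using h1.aeval_derivative_ne_zero (x := ev j) (by simpa using h.isRoot j)

theorem IsSimpleSpectrum.exists_basis {A : Matrix (Fin N) (Fin N) ℝ} {ev : Fin N → ℝ}
    (h : IsSimpleSpectrum A ev) : ∃ b : Module.Basis (Fin N) ℝ (StateSpace N),
      ∀ j, Matrix.toEuclideanCLM (n := Fin N) (𝕜 := ℝ) A (b j) = ev j • b j := by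
  have h1 : ∀ j, ∃ v : StateSpace N,
      Module.End.HasEigenvector (Matrix.toEuclideanCLM (n := Fin N) (𝕜 := ℝ) A :
        StateSpace N →ₗ[ℝ] StateSpace N) (ev j) v := fun j => by
    have h2 : Module.End.HasEigenvalue (Matrix.toLin' A) (ev j) := by
      rw [Module.End.hasEigenvalue_iff_isRoot_charpoly, Matrix.charpoly_toLin']
      exact h.isRoot j
    obtain ⟨v, hv⟩ := h2.exists_hasEigenvector
    refine ⟨WithLp.toLp 2 v, Module.End.mem_eigenspace_iff.2 ?_, fun h0 => hv.2 ?_⟩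
    · have := hv.apply_eq_smul
      rw [Matrix.toLin'_apply] at this
      simp [Matrix.toEuclideanCLM_toLp, this]
    · simpa using h0
  choose v hv using h1
  have hli : LinearIndependent ℝ v :=
    Module.End.eigenvectors_linearIndependent' _ ev h.strictMono.injective v hv
  have hsp : ⊤ ≤ Submodule.span ℝ (range v) :=
    (hli.span_eq_top_of_card_eq_finrank' (by simp)).ge
  refine ⟨Module.Basis.mk hli hsp, fun j => ?_⟩
  simpa using (hv j).apply_eq_smul

/-- The spectral projection of `a` at the eigenvalue `ev j`, as a polynomial in `a`. -/
noncomputable def specProj (a : StateSpace N →L[ℝ] StateSpace N) (ev : Fin N → ℝ) (j : Fin N) :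
    StateSpace N →L[ℝ] StateSpace N :=
  ((List.finRange N).map fun k =>
    if k = j then 1 else (ev j - ev k)⁻¹ • (a - ev k • 1)).prod

theorem list_prod_apply_eigenvector {G : Type*} [NormedAddCommGroup G] [NormedSpace ℝ G]
    {κ : Type*} (l : List κ) (f : κ → G →L[ℝ] G) (c : κ → ℝ) (v : G)
    (h : ∀ k ∈ l, f k v = c k • v) : (l.map f).prod v = (l.map c).prod • v := by
  induction l with
  | nil => simp
  | cons k l ih =>
    rw [List.map_cons, List.prod_cons, mul_apply_eq_comp,
      ih fun k' hk' => h k' (List.mem_cons_of_mem _ hk'), map_smul, h k (by simp), smul_smul,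
      List.map_cons, List.prod_cons, mul_comm]

theorem specProj_apply_basis {a : StateSpace N →L[ℝ] StateSpace N} {ev : Fin N → ℝ}
    (hev : Function.Injective ev) {b : Module.Basis (Fin N) ℝ (StateSpace N)}
    (hb : ∀ j, a (b j) = ev j • b j) (j m : Fin N) :
    specProj a ev j (b m) = if m = j then b m else 0 := by
  rw [specProj, list_prod_apply_eigenvector _ _
    (fun k => if k = j then 1 else (ev j - ev k)⁻¹ * (ev m - ev k)) (b m)]
  · split_ifs with hm
    · subst hm
      rw [List.prod_eq_one, one_smul]
      intro x hx
      simp only [List.mem_map] at hx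
      obtain ⟨k, -, rfl⟩ := hx
      split_ifs with hk
      · rfl
      · exact inv_mul_cancel₀ (sub_ne_zero.2 (hev.ne (Ne.symm hk)))
    · rw [List.prod_eq_zero, zero_smul]
      simp only [List.mem_map]
      exact ⟨m, List.mem_finRange m, by simp [hm]⟩
  · intro k _
    split_ifs
    · simp
    · rw [smul_apply, sub_apply, hb, smul_apply, one_apply_eq_self, ← sub_smul, smul_smul]

theorem specProj_apply {a : StateSpace N →L[ℝ] StateSpace N} {ev : Fin N → ℝ}
    (hev : Function.Injective ev) {b : Module.Basis (Fin N) ℝ (StateSpace N)}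
    (hb : ∀ j, a (b j) = ev j • b j) (j : Fin N) (v : StateSpace N) :
    specProj a ev j v = b.repr v j • b j := by
  conv_lhs => rw [← b.sum_repr v]
  rw [map_sum, Finset.sum_eq_single j]
  · rw [map_smul, specProj_apply_basis hev hb, if_pos rfl]
  · intro m _ hm
    rw [map_smul, specProj_apply_basis hev hb, if_neg hm, smul_zero]
  · simp

/-- The algebraic relations between an operator and its spectral projections. -/
structure IsSpectralResolution (a : StateSpace N →L[ℝ] StateSpace N) (ev : Fin N → ℝ)
    (P : Fin N → StateSpace N →L[ℝ] StateSpace N) : Prop where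
  injective : Function.Injective ev
  mul_self : ∀ j, P j * P j = P j
  mul_of_ne : ∀ j k, j ≠ k → P j * P k = 0
  sum_eq_one : ∑ j, P j = 1
  mul_op : ∀ j, P j * a = ev j • P j

theorem isSpectralResolution_specProj {a : StateSpace N →L[ℝ] StateSpace N} {ev : Fin N → ℝ}
    (hev : Function.Injective ev) {b : Module.Basis (Fin N) ℝ (StateSpace N)}
    (hb : ∀ j, a (b j) = ev j • b j) : IsSpectralResolution a ev (specProj a ev) := by
  have hP := specProj_apply_basis hev hb
  have ext' : ∀ {f g : StateSpace N →L[ℝ] StateSpace N}, (∀ m, f (b m) = g (b m)) → f = g :=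
    fun h => ContinuousLinearMap.coe_injective (b.ext h)
  refine ⟨hev, fun j => ext' fun m => ?_, fun j k hjk => ext' fun m => ?_, ext' fun m => ?_,
    fun j => ext' fun m => ?_⟩
  · by_cases h : m = j <;> simp [hP, h]
  · by_cases h : m = k
    · subst h; simp [hP, Ne.symm hjk]
    · simp [hP, h]
  · simp [hP]
  · by_cases h : m = j
    · subst h; simp [hP, hb]
    · simp [hP, hb, h]

theorem contDiffAt_list_prod {X R : Type*} [NormedAddCommGroup X] [NormedSpace ℝ X] [NormedRing R]
    [NormedAlgebra ℝ R] {κ : Type*} (l : List κ) {f : κ → X → R} {x : X} {n : WithTop ℕ∞}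
    (h : ∀ k, ContDiffAt ℝ n (f k) x) : ContDiffAt ℝ n (fun y => (l.map fun k => f k y).prod) x := by
  induction l with
  | nil => simpa using contDiffAt_const
  | cons k l ih =>
    simp only [List.map_cons, List.prod_cons]
    exact (h k).mul ih

theorem contDiffAt_specProj {a : StateSpace N → StateSpace N →L[ℝ] StateSpace N}
    {ev : Fin N → StateSpace N → ℝ} {u : StateSpace N} (ha : ContDiffAt ℝ ∞ a u)
    (hev : ∀ j, ContDiffAt ℝ ∞ (ev j) u) (hne : ∀ j k, j ≠ k → ev j u ≠ ev k u) (j : Fin N) :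
    ContDiffAt ℝ ∞ (fun u => specProj (a u) (fun j => ev j u) j) u := by
  unfold specProj
  refine contDiffAt_list_prod _ fun k => ?_
  split_ifs with hk
  · exact contDiffAt_const
  · exact (((hev j).sub (hev k)).inv (sub_ne_zero.2 (hne j k (Ne.symm hk)))).smul
      (ha.sub ((hev k).smul contDiffAt_const))

theorem contDiffAt_toEuclideanCLM {A : StateSpace N → Matrix (Fin N) (Fin N) ℝ} {u : StateSpace N}
    (hA : ∀ i j, ContDiffAt ℝ ∞ (fun u => A u i j) u) :
    ContDiffAt ℝ ∞ (fun u => Matrix.toEuclideanCLM (n := Fin N) (𝕜 := ℝ) (A u)) u := by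
  have h1 : ∀ u, Matrix.toEuclideanCLM (n := Fin N) (𝕜 := ℝ) (A u)
      = ∑ i, ∑ j, A u i j • Matrix.toEuclideanCLM (n := Fin N) (𝕜 := ℝ) (Matrix.single i j 1) :=
    fun u => by
      conv_lhs => rw [Matrix.matrix_eq_sum_single (A u)]
      simp only [map_sum]
      refine Finset.sum_congr rfl fun i _ => Finset.sum_congr rfl fun j _ => ?_
      rw [← map_smul, Matrix.smul_single, smul_eq_mul, mul_one]
  simp only [h1]
  exact ContDiffAt.sum fun i _ => ContDiffAt.sum fun j _ => (hA i j).smul contDiffAt_const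

theorem contDiffAt_charpoly_eval {A : StateSpace N → Matrix (Fin N) (Fin N) ℝ} {u : StateSpace N}
    (hA : ∀ i j, ContDiffAt ℝ ∞ (fun u => A u i j) u) (z : ℝ) :
    ContDiffAt ℝ ∞ (fun p : StateSpace N × ℝ => (A p.1).charpoly.eval p.2) (u, z) := by
  simp only [Matrix.eval_charpoly, Matrix.det_apply', Matrix.sub_apply]
  refine ContDiffAt.sum fun σ _ => contDiffAt_const.mul (contDiffAt_prod fun i _ => ?_)
  refine ContDiffAt.sub ?_ (ContDiffAt.comp (u, z) (g := fun u => A u (σ i) i) (hA _ _) contDiffAt_fst)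
  simp only [Matrix.scalar_apply, Matrix.diagonal_apply]
  split_ifs
  · exact contDiffAt_snd
  · exact contDiffAt_const

/-- A simple eigenvalue depends smoothly on the coefficients of the matrix. -/
theorem exists_smooth_eigenvalue {A : StateSpace N → Matrix (Fin N) (Fin N) ℝ} {u : StateSpace N}
    (hA : ∀ i j, ContDiffAt ℝ ∞ (fun u => A u i j) u) {z : ℝ} (hz : (A u).charpoly.eval z = 0)
    (hz' : (A u).charpoly.derivative.eval z ≠ 0) :
    ∃ ψ : StateSpace N → ℝ, ContDiffAt ℝ ∞ ψ u ∧ ψ u = z ∧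
      ∀ᶠ y in 𝓝 u, (A y).charpoly.eval (ψ y) = 0 := by
  have hf := contDiffAt_charpoly_eval hA z
  have hd := (hf.differentiableAt (by simp)).hasFDerivAt
  have e1 : HasDerivAt (fun s : ℝ => (A u).charpoly.eval s)
      (fderiv ℝ (fun p : StateSpace N × ℝ => (A p.1).charpoly.eval p.2) (u, z) (0, 1)) z := by
    have h2 : HasDerivAt (fun s : ℝ => (u, s)) ((0 : StateSpace N), (1 : ℝ)) z :=
      (hasDerivAt_const z u).prodMk (hasDerivAt_id z)
    exact HasFDerivAt.comp_hasDerivAt z hd h2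
  have e2 := e1.unique ((A u).charpoly.hasDerivAt z)
  -- The partial derivative in the spectral parameter is the derivative of the characteristic
  -- polynomial at a simple root; it is nonzero, which is the hypothesis of the implicit function
  -- theorem.
  have hinv : (fderiv ℝ (fun p : StateSpace N × ℝ => (A p.1).charpoly.eval p.2) (u, z)
      ∘L .inr ℝ (StateSpace N) ℝ).IsInvertible := by
    refine ⟨ContinuousLinearEquiv.unitsEquivAut ℝ (Units.mk0 _ hz'), ?_⟩
    ext
    simp [e2]
  refine ⟨hf.implicitFunction (by simp) hinv, hf.contDiffAt_implicitFunction (by simp) hinv,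
    hf.implicitFunction_apply_self (by simp) hinv, ?_⟩
  filter_upwards [hf.eventually_apply_implicitFunction (by simp) hinv] with y hy
  rw [hy, hz]

/-- Near a matrix with simple real spectrum, the eigenvalues and the spectral projections are
smooth. -/
theorem exists_smooth_spectral_resolution {𝒰 K : Set (StateSpace N)}
    {A : StateSpace N → Matrix (Fin N) (Fin N) ℝ} (h𝒰 : IsOpen 𝒰)
    (hA : ∀ i j, ContDiffOn ℝ ∞ (fun u => A u i j) 𝒰) (hK : K ⊆ 𝒰)
    (hspec : ∀ u ∈ K, ∃ ev, IsSimpleSpectrum (A u) ev) :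
    ∃ (Ω : Set (StateSpace N)) (ev : Fin N → StateSpace N → ℝ)
      (P : Fin N → StateSpace N → StateSpace N →L[ℝ] StateSpace N),
      IsOpen Ω ∧ K ⊆ Ω ∧ Ω ⊆ 𝒰 ∧ (∀ j, ContDiffOn ℝ ∞ (ev j) Ω) ∧ (∀ j, ContDiffOn ℝ ∞ (P j) Ω) ∧
      (∀ u ∈ Ω, IsSimpleSpectrum (A u) fun j => ev j u) ∧
      (∀ u j, P j u = specProj (Matrix.toEuclideanCLM (n := Fin N) (𝕜 := ℝ) (A u))
        (fun j => ev j u) j) := by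
  classical
  let Ω : Set (StateSpace N) := {u | u ∈ 𝒰 ∧ ∃ ev, IsSimpleSpectrum (A u) ev}
  let ev : StateSpace N → Fin N → ℝ := fun u =>
    if h : ∃ ev, IsSimpleSpectrum (A u) ev then h.choose else 0
  have hev : ∀ u ∈ Ω, IsSimpleSpectrum (A u) (ev u) := fun u hu => by
    simp only [ev, dif_pos hu.2]; exact hu.2.choose_spec
  -- The implicit branches through the eigenvalues at `u` keep their strict order nearby, so they
  -- list the whole spectrum there. This shows that `Ω` is open, and uniqueness identifies the
  -- branches with `ev`, which is therefore smooth although it was obtained by choice.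
  have key : ∀ u ∈ Ω, Ω ∈ 𝓝 u ∧ ∀ j, ContDiffAt ℝ ∞ (fun u => ev u j) u := fun u hu => by
    have hAu : ∀ i j, ContDiffAt ℝ ∞ (fun u => A u i j) u := fun i j =>
      (hA i j).contDiffAt (h𝒰.mem_nhds hu.1)
    have h1 := fun j => exists_smooth_eigenvalue hAu ((hev u hu).isRoot j)
      ((hev u hu).derivative_ne_zero j)
    choose ψ hψ hψu hψz using h1
    have h2 : ∀ᶠ y in 𝓝 u, ∀ j k, j < k → ψ j y < ψ k y := by
      simp only [eventually_all]
      intro j k hjk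
      refine (hψ j).continuousAt.eventually_lt (hψ k).continuousAt ?_
      rw [hψu, hψu]
      exact (hev u hu).strictMono hjk
    have h3 : ∀ᶠ y in 𝓝 u, IsSimpleSpectrum (A y) fun j => ψ j y := by
      filter_upwards [h2, eventually_all.2 hψz] with y hy hy'
      exact ⟨fun j k hjk => hy j k hjk, hy'⟩
    refine ⟨?_, fun j => (hψ j).congr_of_eventuallyEq ?_⟩
    · filter_upwards [h3, h𝒰.mem_nhds hu.1] with y hy hy'
      exact ⟨hy', _, hy⟩
    · filter_upwards [h3, h𝒰.mem_nhds hu.1] with y hy hy'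
      exact congrFun ((hev y ⟨hy', _, hy⟩).unique hy) j
  refine ⟨Ω, fun j u => ev u j, fun j u => specProj _ (ev u) j,
    isOpen_iff_mem_nhds.2 fun u hu => (key u hu).1, fun u hu => ⟨hK hu, hspec u hu⟩,
    fun u hu => hu.1, fun j u hu => ((key u hu).2 j).contDiffWithinAt,
    fun j u hu => (contDiffAt_specProj (contDiffAt_toEuclideanCLM fun i k =>
      (hA i k).contDiffAt (h𝒰.mem_nhds hu.1)) (key u hu).2
      (fun j k hjk => (hev u hu).strictMono.injective.ne hjk) j).contDiffWithinAt, hev,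
    fun u j => rfl⟩

/-- The value of a monic polynomial of degree `N` is a product of `N` distances to roots, each at
least the distance to the nearest root. This replaces perturbation theory for eigenvalues: a small
value at `z` forces an eigenvalue near `z`. -/
theorem exists_root_near {M : Matrix (Fin N) (Fin N) ℂ} (hN : 0 < N) (z : ℂ) :
    ∃ r ∈ M.charpoly.roots, ‖z - r‖ ^ N ≤ ‖M.charpoly.eval z‖ := by
  have hs := IsAlgClosed.splits M.charpoly
  have hcard : M.charpoly.roots.card = N := by
    rw [Polynomial.splits_iff_card_roots.1 hs, Matrix.charpoly_natDegree_eq_dim]; simp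
  have he := hs.eval_eq_prod_roots z
  rw [(Matrix.charpoly_monic M).leadingCoeff, one_mul] at he
  obtain ⟨r, hr, hmin⟩ := M.charpoly.roots.toFinset.exists_min_image (fun r => ‖z - r‖) (by
    have : M.charpoly.roots ≠ 0 := fun h0 => by rw [h0] at hcard; simp at hcard; omega
    obtain ⟨r, hr⟩ := Multiset.exists_mem_of_ne_zero this
    exact ⟨r, Multiset.mem_toFinset.2 hr⟩)
  refine ⟨r, Multiset.mem_toFinset.1 hr, ?_⟩
  have key : ∀ s : Multiset ℂ, (∀ x ∈ s, ‖z - r‖ ≤ ‖z - x‖) →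
      ‖z - r‖ ^ s.card ≤ ‖(s.map fun x => z - x).prod‖ := fun s => by
    induction s using Multiset.induction_on with
    | empty => simp
    | cons a s ih =>
      intro h
      rw [Multiset.card_cons, Multiset.map_cons, Multiset.prod_cons, norm_mul, pow_succ, mul_comm]
      exact mul_le_mul (h a (by simp)) (ih fun x hx => h x (by simp [hx])) (by positivity)
        (norm_nonneg _)
  have := key M.charpoly.roots fun x hx => hmin x (Multiset.mem_toFinset.2 hx)
  rwa [hcard, ← he] at this

theorem exists_eigenvector_near {M : Matrix (Fin N) (Fin N) ℂ} (hN : 0 < N) (z : ℂ) :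
    ∃ (r : ℂ) (v : Fin N → ℂ), ‖v‖ = 1 ∧ M.mulVec v = r • v ∧
      ‖z - r‖ ^ N ≤ ‖M.charpoly.eval z‖ := by
  obtain ⟨r, hr, hle⟩ := exists_root_near (M := M) hN z
  have h1 : Module.End.HasEigenvalue (Matrix.toLin' M) r := by
    rw [Module.End.hasEigenvalue_iff_isRoot_charpoly, Matrix.charpoly_toLin']
    exact (Polynomial.mem_roots'.1 hr).2
  obtain ⟨v, hv⟩ := h1.exists_hasEigenvector
  have h2 := hv.apply_eq_smul
  rw [Matrix.toLin'_apply] at h2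
  refine ⟨r, ((‖v‖⁻¹ : ℝ) : ℂ) • v, ?_, ?_, hle⟩
  · rw [norm_smul]
    simp [hv.2]
  · rw [Matrix.mulVec_smul, h2, smul_comm]

theorem mem_spectrum_of_mulVec_eq {M : Matrix (Fin N) (Fin N) ℂ} {r : ℂ} {v : Fin N → ℂ}
    (hv : v ≠ 0) (h : M.mulVec v = r • v) : r ∈ spectrum ℂ M := by
  have h1 : Module.End.HasEigenvalue (Matrix.toLin' M) r :=
    Module.End.hasEigenvalue_of_hasEigenvector (x := v)
      ⟨Module.End.mem_eigenspace_iff.2 (by rw [Matrix.toLin'_apply, h]), hv⟩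
  rw [Matrix.mem_spectrum_iff_isRoot_charpoly, ← Matrix.charpoly_toLin',
    ← Module.End.hasEigenvalue_iff_isRoot_charpoly]
  exact h1

/-- The entries of a complex eigenvector of a real matrix with simple real eigenvalue. -/
theorem exists_eq_smul_ofReal {A : Matrix (Fin N) (Fin N) ℝ} {ev : Fin N → ℝ}
    (hev : Function.Injective ev) {b : Module.Basis (Fin N) ℝ (StateSpace N)}
    (hb : ∀ j, Matrix.toEuclideanCLM (n := Fin N) (𝕜 := ℝ) A (b j) = ev j • b j) {j : Fin N}
    {v : Fin N → ℂ} (hv : (A.map Complex.ofReal).mulVec v = (ev j : ℂ) • v) :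
    ∃ α : ℂ, ∀ i, v i = α * (b j i : ℂ) := by
  have real_case : ∀ w : Fin N → ℝ, A.mulVec w = ev j • w → ∃ c : ℝ, ∀ i, w i = c * b j i := by
    intro w hw
    let w' : StateSpace N := WithLp.toLp 2 w
    have hw' : Matrix.toEuclideanCLM (n := Fin N) (𝕜 := ℝ) A w' = ev j • w' := by
      simp [w', Matrix.toEuclideanCLM_toLp, hw]
    have h1 : ∀ k, k ≠ j → b.repr w' k = 0 := fun k hk => by
      have e1 : ∑ m, (b.repr w' m * ev m) • b m = ∑ m, (ev j * b.repr w' m) • b m := by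
        have e2 := hw'
        conv_lhs at e2 => rw [← b.sum_repr w']
        conv_rhs at e2 => rw [← b.sum_repr w']
        simpa only [map_sum, map_smul, hb, smul_smul, Finset.smul_sum] using e2
      have e3 := congrArg (fun y => b.repr y k) e1
      simp only [map_sum, map_smul, Module.Basis.repr_self, Finsupp.finsetSum_apply,
        Finsupp.smul_apply, Finsupp.single_apply, smul_eq_mul, mul_ite, mul_one, mul_zero,
        Finset.sum_ite_eq', Finset.mem_univ, if_true] at e3
      have e4 : b.repr w' k * (ev k - ev j) = 0 := by linarith
      exact (mul_eq_zero.1 e4).resolve_right (sub_ne_zero.2 (hev.ne hk))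
    refine ⟨b.repr w' j, fun i => ?_⟩
    have e5 : w' = b.repr w' j • b j := by
      conv_lhs => rw [← b.sum_repr w']
      rw [Finset.sum_eq_single j (fun m _ hm => by rw [h1 m hm, zero_smul]) (by simp)]
    have e6 := congrArg (fun y : StateSpace N => y i) e5
    simpa [w'] using e6
  have hre : A.mulVec (fun i => (v i).re) = ev j • fun i => (v i).re := by
    ext i
    have := congrArg Complex.re (congrFun hv i)
    simpa [Matrix.mulVec, dotProduct] using this
  have him : A.mulVec (fun i => (v i).im) = ev j • fun i => (v i).im := by
    ext i
    have := congrArg Complex.im (congrFun hv i)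
    simpa [Matrix.mulVec, dotProduct] using this
  obtain ⟨c, hc⟩ := real_case _ hre
  obtain ⟨d, hd⟩ := real_case _ him
  refine ⟨⟨c, d⟩, fun i => ?_⟩
  apply Complex.ext
  · simpa using hc i
  · simpa using hd i

/-- Stability at high frequencies forces the diagonal blocks of `Q`, in the eigenbasis of `A`, to be
negative. -/
theorem diagonal_neg_of_highFrequencyStable {A Q : Matrix (Fin N) (Fin N) ℝ} {ev : Fin N → ℝ}
    (hev : Function.Injective ev) {b : Module.Basis (Fin N) ℝ (StateSpace N)}
    (hb : ∀ j, Matrix.toEuclideanCLM (n := Fin N) (𝕜 := ℝ) A (b j) = ev j • b j)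
    (hQ : ∃ C c : ℝ, 0 < C ∧ 0 < c ∧ ∀ ξ : ℝ, C ≤ |ξ| →
      ∀ z ∈ spectrum ℂ ((Complex.I * (ξ : ℂ)) • A.map Complex.ofReal + Q.map Complex.ofReal),
        z.re ≤ -c) (j : Fin N) :
    b.repr (Matrix.toEuclideanCLM (n := Fin N) (𝕜 := ℝ) Q (b j)) j < 0 := by
  obtain ⟨C, c, hC, hc, hstab⟩ := hQ
  have hN : 0 < N := Fin.pos j
  set AC : Matrix (Fin N) (Fin N) ℂ := A.map Complex.ofReal with hAC
  set QC : Matrix (Fin N) (Fin N) ℂ := Q.map Complex.ofReal with hQC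
  -- The coefficients of the `j`-th coordinate functional, a left eigenvector of `A`; `L` is its
  -- complex extension.
  let l : Fin N → ℝ := fun i => b.repr (EuclideanSpace.single i (1 : ℝ)) j
  have hl : ∀ w : StateSpace N, b.repr w j = ∑ i, l i * w i := fun w => by
    have e1 : w = ∑ i, w i • EuclideanSpace.single i (1 : ℝ) := by
      ext k
      simp [Finset.sum_apply, Pi.single_apply]
    conv_lhs => rw [e1]
    simp [l, mul_comm]
  let L : (Fin N → ℂ) → ℂ := fun v => ∑ i, (l i : ℂ) * v i
  have hLcont : Continuous L := by fun_prop
  have hLsmul : ∀ (a : ℂ) v, L (a • v) = a * L v := fun a v => by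
    simp only [L, Pi.smul_apply, smul_eq_mul, Finset.mul_sum]
    exact Finset.sum_congr rfl fun i _ => by ring
  have hLadd : ∀ v w, L (v + w) = L v + L w := fun v w => by
    simp only [L, Pi.add_apply, mul_add, Finset.sum_add_distrib]
  have hlA : ∀ k, ∑ i, l i * A i k = ev j * l k := fun k => by
    have e1 : b.repr (Matrix.toEuclideanCLM (n := Fin N) (𝕜 := ℝ) A
        (EuclideanSpace.single k (1 : ℝ))) j = ev j * l k := by
      conv_lhs => rw [← b.sum_repr (EuclideanSpace.single k (1 : ℝ))]
      simp only [map_sum, map_smul, hb, Module.Basis.repr_self, Finsupp.finsetSum_apply,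
        Finsupp.smul_apply, Finsupp.single_apply, smul_eq_mul, mul_ite, mul_one, mul_zero,
        Finset.sum_ite_eq', Finset.mem_univ, if_true]
      exact mul_comm _ _
    rw [hl] at e1
    simpa [Matrix.ofLp_toEuclideanCLM, Matrix.mulVec_single] using e1
  have hLA : ∀ v, L (AC.mulVec v) = ev j * L v := fun v => by
    simp only [L, Matrix.mulVec, dotProduct, Finset.mul_sum]
    rw [Finset.sum_comm]
    refine Finset.sum_congr rfl fun k _ => ?_
    have := congrArg (fun t : ℝ => (t : ℂ) * v k) (hlA k)
    simp only [Complex.ofReal_sum, Complex.ofReal_mul, Finset.sum_mul] at this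
    rw [← mul_assoc, ← this]
    exact Finset.sum_congr rfl fun i _ => by simp [hAC, mul_assoc]
  set μ := b.repr (Matrix.toEuclideanCLM (n := Fin N) (𝕜 := ℝ) Q (b j)) j with hμ
  let ξ : ℕ → ℝ := fun n => n + C
  have hξ : ∀ n, C ≤ ξ n := fun n => by simp [ξ]
  have hξ0 : ∀ n, Complex.I * (ξ n : ℂ) ≠ 0 := fun n => by
    have : ξ n ≠ 0 := (hC.trans_le (hξ n)).ne'
    simp [this]
  let η : ℕ → ℂ := fun n => (Complex.I * (ξ n : ℂ))⁻¹
  have hη : Tendsto η atTop (𝓝 0) := by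
    rw [tendsto_zero_iff_norm_tendsto_zero]
    have : Tendsto (fun n : ℕ => (ξ n)⁻¹) atTop (𝓝 0) :=
      (tendsto_atTop_add_const_right _ _ tendsto_natCast_atTop_atTop).inv_tendsto_atTop
    refine this.congr fun n => ?_
    simp [η, abs_of_pos (hC.trans_le (hξ n))]
  -- Dividing `iξA + Q` by `iξ` turns high frequencies into a small perturbation of `A`. The
  -- eigenvalue `r n` of `M n` is chosen near the simple eigenvalue `ev j` of `A`.
  let M : ℕ → Matrix (Fin N) (Fin N) ℂ := fun n => AC + η n • QC
  choose r v hv1 hMv hr using fun n => exists_eigenvector_near (M := M n) hN (ev j : ℂ)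
  have hMlim : Tendsto M atTop (𝓝 AC) := by
    simpa using tendsto_const_nhds.add (hη.smul_const QC)
  obtain ⟨hvec⟩ : Nonempty (AC.mulVec (fun i => (b j i : ℂ)) = (ev j : ℂ) • fun i => (b j i : ℂ)) := by
    refine ⟨?_⟩
    ext i
    have := congrArg (fun y : StateSpace N => ((y i : ℝ) : ℂ)) (hb j)
    simpa [Matrix.ofLp_toEuclideanCLM, Matrix.mulVec, dotProduct, hAC] using this
  have hbj : (fun i => (b j i : ℂ)) ≠ 0 := fun h0 => b.ne_zero j (by
    ext i; simpa using congrFun h0 i)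
  have hA0 : AC.charpoly.eval (ev j : ℂ) = 0 := by
    have := mem_spectrum_of_mulVec_eq hbj hvec
    rwa [Matrix.mem_spectrum_iff_isRoot_charpoly] at this
  have hrlim : Tendsto r atTop (𝓝 (ev j : ℂ)) := by
    have h1 : Tendsto (fun n => ‖(M n).charpoly.eval (ev j : ℂ)‖) atTop (𝓝 0) := by
      have h2 : Continuous fun B : Matrix (Fin N) (Fin N) ℂ => ‖B.charpoly.eval (ev j : ℂ)‖ := by
        simp only [Matrix.eval_charpoly]
        exact (Continuous.matrix_det (continuous_const.sub continuous_id)).norm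
      simpa [hA0, Function.comp_def] using (h2.tendsto AC).comp hMlim
    have h3 : Tendsto (fun n => ‖(ev j : ℂ) - r n‖ ^ N) atTop (𝓝 0) :=
      squeeze_zero (fun n => by positivity) hr h1
    have h4 : Tendsto (fun n => ‖(ev j : ℂ) - r n‖) atTop (𝓝 0) := by
      have h5 := h3.rpow_const (p := (N : ℝ)⁻¹) (Or.inr (by positivity))
      rw [Real.zero_rpow (by positivity)] at h5
      exact h5.congr fun n => Real.pow_rpow_inv_natCast (norm_nonneg _) hN.ne'
    rw [tendsto_iff_norm_sub_tendsto_zero]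
    exact h4.congr fun n => norm_sub_rev _ _
  obtain ⟨v0, hv0, φ, hφ, hvlim⟩ := (isCompact_sphere (0 : Fin N → ℂ) 1).tendsto_subseq
    (x := v) fun n => by simp [hv1]
  have hAv0 : AC.mulVec v0 = (ev j : ℂ) • v0 := by
    have h1 : Continuous fun p : Matrix (Fin N) (Fin N) ℂ × (Fin N → ℂ) => p.1.mulVec p.2 :=
      continuous_fst.matrix_mulVec continuous_snd
    have h2 := (h1.tendsto (AC, v0)).comp ((hMlim.comp hφ.tendsto_atTop).prodMk_nhds hvlim)
    have h3 := (hrlim.comp hφ.tendsto_atTop).smul hvlim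
    exact tendsto_nhds_unique (h2.congr fun n => hMv (φ n)) h3
  obtain ⟨α, hα⟩ := exists_eq_smul_ofReal hev hb hAv0
  have hv0' : v0 = α • fun i => (b j i : ℂ) := by ext i; simp [hα i]
  have hα0 : α ≠ 0 := fun h0 => by
    rw [h0, zero_smul] at hv0'
    simp [hv0'] at hv0
  have hLb : L (fun i => (b j i : ℂ)) = 1 := by
    have := hl (b j)
    simp only [Module.Basis.repr_self, Finsupp.single_eq_same] at this
    have h2 := congrArg (fun t : ℝ => (t : ℂ)) this
    simpa [L] using h2.symm
  have hLQ : L (QC.mulVec fun i => (b j i : ℂ)) = μ := by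
    rw [hμ, hl]
    simp [L, Matrix.ofLp_toEuclideanCLM, Matrix.mulVec, dotProduct, hQC]
  -- Pairing the eigenvalue equation with the left eigenvector eliminates `A` and leaves `iξ (r n -
  -- ev j)` as the quotient of `L (Q v)` by `L v`. In the limit this quotient is the diagonal entry
  -- `μ`.
  have hrel : ∀ n, L (QC.mulVec (v n)) = (Complex.I * ξ n) * (r n - ev j) * L (v n) := fun n => by
    have h1 := congrArg L (hMv n)
    simp only [M, Matrix.add_mulVec, Matrix.smul_mulVec, hLadd, hLsmul, hLA] at h1
    have h2 : η n * (Complex.I * ξ n) = 1 := inv_mul_cancel₀ (hξ0 n)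
    linear_combination (Complex.I * ξ n) * h1 - L (QC.mulVec (v n)) * h2
  have hle : ∀ n, ((Complex.I * ξ n) * (r n - ev j)).re ≤ -c := fun n => by
    have hvn : v n ≠ 0 := fun h0 => by have := hv1 n; simp [h0] at this
    have h1 : ((Complex.I * (ξ n : ℂ)) • AC + QC).mulVec (v n)
        = ((Complex.I * ξ n) * r n) • v n := by
      have h2 : (Complex.I * (ξ n : ℂ)) • AC + QC = (Complex.I * (ξ n : ℂ)) • M n := by
        simp only [M, smul_add, smul_smul, η]
        rw [mul_inv_cancel₀ (hξ0 n), one_smul]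
      rw [h2, Matrix.smul_mulVec, hMv, smul_smul]
    have h3 := hstab (ξ n) ((hξ n).trans (le_abs_self _)) _ (mem_spectrum_of_mulVec_eq hvn h1)
    -- `ev j` and `ξ n` are real, so subtracting `iξ · ev j` does not change the real part, and the
    -- spectral bound for `iξA + Q` applies.
    have h4 : ((Complex.I * ξ n) * (r n - ev j)).re = ((Complex.I * ξ n) * r n).re := by
      simp [mul_sub]
    rwa [h4]
  have hQv : Continuous fun w : Fin N → ℂ => L (QC.mulVec w) :=
    hLcont.comp (continuous_const.matrix_mulVec continuous_id)
  have t1 : Tendsto (fun n => L (QC.mulVec (v (φ n))) / L (v (φ n))) atTop (𝓝 (μ : ℂ)) := by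
    have h1 := ((hQv.tendsto v0).comp hvlim).div ((hLcont.tendsto v0).comp hvlim)
      (by rw [hv0', hLsmul, hLb]; simpa using hα0)
    have h2 : L (QC.mulVec v0) / L v0 = μ := by
      rw [hv0', Matrix.mulVec_smul, hLsmul, hLsmul, hLb, hLQ]
      field_simp
    rwa [h2] at h1
  have t2 : ∀ᶠ n in atTop, L (v (φ n)) ≠ 0 := by
    have h1 := (hLcont.tendsto v0).comp hvlim
    refine h1.eventually_ne ?_
    rw [hv0', hLsmul, hLb]; simpa using hα0
  have t3 := (Complex.continuous_re.tendsto (μ : ℂ)).comp t1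
  have h5 : μ ≤ -c := by
    refine le_of_tendsto t3 ?_
    filter_upwards [t2] with n hn
    simp only [Function.comp_apply]
    rw [hrel, mul_div_assoc, div_self hn, mul_one]
    exact hle (φ n)
  linarith

/-- The projection has rank one, so compressing an operator to its range gives a scalar. -/
theorem specProj_mul_mul {a : StateSpace N →L[ℝ] StateSpace N} {ev : Fin N → ℝ}
    (hev : Function.Injective ev) {b : Module.Basis (Fin N) ℝ (StateSpace N)}
    (hb : ∀ j, a (b j) = ev j • b j) (j : Fin N) (M : StateSpace N →L[ℝ] StateSpace N) :
    specProj a ev j * M * specProj a ev j = b.repr (M (b j)) j • specProj a ev j := by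
  ext1 v
  simp only [mul_apply_eq_comp, smul_apply, specProj_apply hev hb, map_smul, smul_smul]
  rw [mul_comm]

end Spectral

/-! ### Weights that exploit non-characteristicity. -/

section Weight

/-- Exponential weights that produce damping of arbitrary strength on a bounded interval. -/
theorem exists_weight {lam : ℝ → ℝ} (hlam : Continuous lam) {c : ℝ} (hc : 0 < c)
    (hlc : ∀ x, c ≤ |lam x|) (R : ℝ) {b : ℝ} (hb : 0 ≤ b) :
    ∃ (ρ ρ' β : ℝ → ℝ) (m M : ℝ), 0 < m ∧ Continuous ρ' ∧ (∀ x, HasDerivAt ρ (ρ' x) x) ∧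
      (∀ x, m ≤ ρ x) ∧ (∀ x, ρ x ≤ M) ∧ (∀ x, |ρ' x| ≤ M) ∧
      (∀ x, lam x * ρ' x = -(β x * ρ x)) ∧ (∀ x, 0 ≤ β x) ∧ ∀ x, |x| ≤ R → b ≤ β x := by
  have hl0 : ∀ x, lam x ≠ 0 := fun x h0 => by
    have := hlc x
    rw [h0, abs_zero] at this
    linarith
  -- The damping profile equals `b` on `|x| ≤ R` and falls linearly to zero at `|x| = R + 1`. The
  -- weight is `ρ = exp(-G)` with `G' = β/lam`; compact support of `β` keeps `G` bounded, hence `ρ`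
  -- between positive constants.
  let β : ℝ → ℝ := fun x => b * max 0 (min 1 (R + 1 - |x|))
  have hβc : Continuous β := by fun_prop
  have hβ0 : ∀ x, 0 ≤ β x := fun x => mul_nonneg hb (le_max_left _ _)
  have hβb : ∀ x, β x ≤ b := fun x => by
    refine mul_le_of_le_one_right hb (max_le zero_le_one (min_le_left _ _))
  let g : ℝ → ℝ := fun x => β x / lam x
  have hgc : Continuous g := hβc.div hlam hl0
  have hgs : HasCompactSupport g := by
    refine HasCompactSupport.intro (isCompact_Icc (a := -(R + 1)) (b := R + 1)) fun x hx => ?_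
    have : R + 1 < |x| := by
      by_contra h
      exact hx (abs_le.1 (not_lt.1 h))
    have h2 : min 1 (R + 1 - |x|) ≤ 0 := (min_le_right _ _).trans (by linarith)
    simp [g, β, max_eq_left h2]
  have hgi : Integrable g volume := hgc.integrable_of_hasCompactSupport hgs
  let G : ℝ → ℝ := fun x => ∫ y in (0 : ℝ)..x, g y
  have hG : ∀ x, HasDerivAt G (g x) x := fun x =>
    intervalIntegral.integral_hasDerivAt_right (hgc.intervalIntegrable _ _)
      hgc.stronglyMeasurable.stronglyMeasurableAtFilter hgc.continuousAt
  set B := ∫ y, ‖g y‖ with hB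
  have hGB : ∀ x, |G x| ≤ B := fun x => by
    refine (intervalIntegral.norm_integral_le_integral_norm_uIoc (f := g) (μ := volume)).trans ?_
    exact setIntegral_le_integral hgi.norm (.of_forall fun y => norm_nonneg _)
  have hgb : ∀ x, |g x| ≤ b / c := fun x => by
    rw [abs_div, abs_of_nonneg (hβ0 x)]
    exact div_le_div₀ hb (hβb x) hc (hlc x)
  refine ⟨fun x => Real.exp (-G x), fun x => Real.exp (-G x) * -g x, β, Real.exp (-B),
    Real.exp B * (1 + b / c), Real.exp_pos _, ?_, fun x => (hG x).neg.exp,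
    fun x => Real.exp_le_exp.2 (neg_le_neg ((le_abs_self _).trans (hGB x))), fun x => ?_,
    fun x => ?_, fun x => ?_, hβ0, fun x hx => ?_⟩
  · have : Continuous G := continuous_iff_continuousAt.2 fun x => (hG x).continuousAt
    fun_prop
  · have h1 : Real.exp (-G x) ≤ Real.exp B :=
      Real.exp_le_exp.2 ((neg_le_abs _).trans (hGB x))
    have h2 : 0 ≤ b / c := by positivity
    nlinarith [Real.exp_pos B]
  · have h1 : Real.exp (-G x) ≤ Real.exp B :=
      Real.exp_le_exp.2 ((neg_le_abs _).trans (hGB x))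
    rw [abs_mul, abs_neg, abs_of_pos (Real.exp_pos _)]
    exact mul_le_mul h1 ((hgb x).trans (by linarith)) (abs_nonneg _) (Real.exp_pos _).le
  · simp only [g]
    field_simp [hl0 x]
  · have : min 1 (R + 1 - |x|) = 1 := min_eq_left (by linarith)
    simp [β, this]

end Weight

/-! ### Weighted energy identity for scalar transport. -/

section TransportEnergy

variable {G : Type*} [NormedAddCommGroup G] [InnerProductSpace ℝ G]

theorem integrable_mul_of_bdd {f : ℝ → ℝ} (hf : Integrable f volume) {ρ : ℝ → ℝ}
    (hρ : Continuous ρ) {C : ℝ} (hC : ∀ x, |ρ x| ≤ C) : Integrable (fun x => ρ x * f x) volume :=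
  hf.bdd_mul hρ.aestronglyMeasurable (.of_forall hC)

/-- The weighted `L²` energy identity for the transport operator `∂ₜ + a ∂ₓ`. -/
theorem transport_energy {T : ℝ} (θ : ℝ) {ρ ρ' : ℝ → ℝ} {a ax : ℝ → ℝ → ℝ}
    {Y Yt Yx : ℝ → ℝ → G} {C : ℝ} (hρ : ∀ x, HasDerivAt ρ (ρ' x) x) (hρ'c : Continuous ρ')
    (hρC : ∀ x, |ρ x| ≤ C) (hρ'C : ∀ x, |ρ' x| ≤ C)
    (ha : ∀ t ∈ Icc 0 T, ∀ x, HasDerivAt (a t) (ax t x) x)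
    (haxc : ∀ t ∈ Icc 0 T, Continuous (ax t)) (haC : ∀ t ∈ Icc 0 T, ∀ x, |a t x| ≤ C)
    (haxC : ∀ t ∈ Icc 0 T, ∀ x, |ax t x| ≤ C)
    (hYc : ContinuousOn (Function.uncurry Y) (Icc 0 T ×ˢ univ))
    (hYtc : ContinuousOn (Function.uncurry Yt) (Icc 0 T ×ˢ univ))
    (hYt : ∀ x, ∀ t ∈ Ioo 0 T, HasDerivAt (fun s => Y s x) (Yt t x) t)
    (hYx : ∀ t ∈ Icc 0 T, ∀ x, HasDerivAt (Y t) (Yx t x) x)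
    (hYl : L2Bdd fun t : Icc 0 T => Y t) (hYtl : L2Bdd fun t : Icc 0 T => Yt t)
    (hYxl : L2Bdd fun t : Icc 0 T => Yx t) {t : ℝ} (ht : t ∈ Icc 0 T) :
    IntervalIntegrable (fun τ => Real.exp (θ * τ) * ∫ x,
        ((θ * ρ x + (ρ' x * a τ x + ρ x * ax τ x)) * ‖Y τ x‖ ^ 2
          + 2 * ρ x * inner ℝ (Y τ x) (Yt τ x + a τ x • Yx τ x))) volume 0 t ∧
      Real.exp (θ * t) * (∫ x, ρ x * ‖Y t x‖ ^ 2) - (∫ x, ρ x * ‖Y 0 x‖ ^ 2)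
        = ∫ τ in (0 : ℝ)..t, Real.exp (θ * τ) * ∫ x,
        ((θ * ρ x + (ρ' x * a τ x + ρ x * ax τ x)) * ‖Y τ x‖ ^ 2
          + 2 * ρ x * inner ℝ (Y τ x) (Yt τ x + a τ x • Yx τ x)) := by
  have hρc : Continuous ρ := continuous_iff_continuousAt.2 fun x => (hρ x).continuousAt
  have h0T : (0 : ℝ) ∈ Icc 0 T := ⟨le_rfl, ht.1.trans ht.2⟩
  let Φ : ℝ → ℝ → ℝ := fun τ x => Real.exp (θ * τ)
    * (θ * (ρ x * ‖Y τ x‖ ^ 2) + 2 * (ρ x * inner ℝ (Y τ x) (Yt τ x)))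
  have hIY : ∀ s ∈ Icc 0 T, Integrable (fun x => ‖Y s x‖ ^ 2) volume := fun s hs =>
    (hYl.memLp ⟨s, hs⟩).norm.integrable_sq
  have hIYt : ∀ s ∈ Icc 0 T, Integrable (fun x => inner ℝ (Y s x) (Yt s x)) volume := fun s hs =>
    (hYl.memLp ⟨s, hs⟩).integrable_inner_two (hYtl.memLp ⟨s, hs⟩)
  have hIYx : ∀ s ∈ Icc 0 T, Integrable (fun x => inner ℝ (Y s x) (Yx s x)) volume := fun s hs =>
    (hYl.memLp ⟨s, hs⟩).integrable_inner_two (hYxl.memLp ⟨s, hs⟩)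
  have hΦi : ∀ s ∈ Icc 0 T, Integrable (Φ s) volume := fun s hs =>
    (((integrable_mul_of_bdd (hIY s hs) hρc hρC).const_mul θ).add
      ((integrable_mul_of_bdd (hIYt s hs) hρc hρC).const_mul 2)).const_mul _
  -- the spatial flux integrates to zero
  have hflux : ∀ s ∈ Icc 0 T, ∫ x, Φ s x = Real.exp (θ * s) * ∫ x,
      ((θ * ρ x + (ρ' x * a s x + ρ x * ax s x)) * ‖Y s x‖ ^ 2
        + 2 * ρ x * inner ℝ (Y s x) (Yt s x + a s x • Yx s x)) := fun s hs => by
    have hac : Continuous (a s) := continuous_iff_continuousAt.2 fun x => (ha s hs x).continuousAt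
    have h1 : ∀ x, HasDerivAt (fun x => ρ x * a s x * ‖Y s x‖ ^ 2)
        ((ρ' x * a s x + ρ x * ax s x) * ‖Y s x‖ ^ 2
          + ρ x * a s x * (2 * inner ℝ (Y s x) (Yx s x))) x := fun x =>
      ((hρ x).mul (ha s hs x)).mul (hYx s hs x).norm_sq
    have hC0 : 0 ≤ C := (abs_nonneg _).trans (hρC 0)
    have hbd1 : ∀ x, |ρ x * a s x| ≤ C * C := fun x => by
      rw [abs_mul]; exact mul_le_mul (hρC x) (haC s hs x) (abs_nonneg _) hC0
    have hbd2 : ∀ x, |ρ' x * a s x + ρ x * ax s x| ≤ C * C + C * C := fun x => by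
      refine (abs_add_le _ _).trans ?_
      rw [abs_mul, abs_mul]
      exact add_le_add (mul_le_mul (hρ'C x) (haC s hs x) (abs_nonneg _) hC0)
        (mul_le_mul (hρC x) (haxC s hs x) (abs_nonneg _) hC0)
    have i1 := integrable_mul_of_bdd (hIY s hs) (hρc.mul hac) hbd1
    have i2 := integrable_mul_of_bdd (hIY s hs)
      ((hρ'c.mul hac).add (hρc.mul (haxc s hs))) hbd2
    have i3 := integrable_mul_of_bdd ((hIYx s hs).const_mul 2) (hρc.mul hac) hbd1
    have h2 := integral_eq_zero_of_hasDerivAt_of_integrable h1 (i2.add i3) i1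
    rw [← integral_const_mul]
    have h3 : ∫ x, Φ s x = ∫ x, (Φ s x + Real.exp (θ * s) *
        ((ρ' x * a s x + ρ x * ax s x) * ‖Y s x‖ ^ 2
          + ρ x * a s x * (2 * inner ℝ (Y s x) (Yx s x)))) := by
      have i4 : Integrable (fun x => (ρ' x * a s x + ρ x * ax s x) * ‖Y s x‖ ^ 2
          + ρ x * a s x * (2 * inner ℝ (Y s x) (Yx s x))) volume := i2.add i3
      have h5 := integral_const_mul (μ := volume) (Real.exp (θ * s)) fun x =>
        (ρ' x * a s x + ρ x * ax s x) * ‖Y s x‖ ^ 2 + ρ x * a s x * (2 * inner ℝ (Y s x) (Yx s x))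
      rw [integral_add (hΦi s hs) (i4.const_mul _), h5, h2, mul_zero, add_zero]
    rw [h3]
    congr 1; ext x
    simp only [Φ, inner_add_right, inner_smul_right]
    ring
  -- integrability on the space-time strip
  have hsub : Ioc 0 t ⊆ Icc 0 T := fun s hs => ⟨hs.1.le, hs.2.trans ht.2⟩
  have hΦc : ContinuousOn (Function.uncurry Φ) (Icc 0 T ×ˢ univ) := by
    have e1 : ContinuousOn (fun p : ℝ × ℝ => Real.exp (θ * p.1)) (Icc 0 T ×ˢ univ) :=
      Continuous.continuousOn (by fun_prop)
    have e2 : ContinuousOn (fun p : ℝ × ℝ => ρ p.2) (Icc 0 T ×ˢ univ) :=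
      (hρc.comp continuous_snd).continuousOn
    exact e1.mul ((continuousOn_const.mul (e2.mul (hYc.norm.pow 2))).add
      (continuousOn_const.mul (e2.mul (hYc.inner hYtc))))
  have hmeas : AEStronglyMeasurable (Function.uncurry Φ)
      ((volume.restrict (Ioc 0 t)).prod (volume : Measure ℝ)) := by
    have : (volume.restrict (Ioc 0 t)).prod (volume : Measure ℝ)
        = (volume.prod volume).restrict (Ioc 0 t ×ˢ univ) := by
      rw [← Measure.prod_restrict, Measure.restrict_univ]
    rw [this]
    exact (hΦc.mono (prod_mono hsub le_rfl)).aestronglyMeasurable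
      (measurableSet_Ioc.prod MeasurableSet.univ)
  obtain ⟨B, hB⟩ := hYl.bound
  obtain ⟨B', hB'⟩ := hYtl.bound
  have hΦb : ∀ s ∈ Icc 0 T, ∫ x, ‖Φ s x‖
      ≤ Real.exp (|θ| * T) * (|θ| * (C * B ^ 2) + (C * B ^ 2 + C * B' ^ 2)) := fun s hs => by
    have hC0 : 0 ≤ C := (abs_nonneg _).trans (hρC 0)
    have hIYt2 : Integrable (fun x => ‖Yt s x‖ ^ 2) volume :=
      (hYtl.memLp ⟨s, hs⟩).norm.integrable_sq
    have pt : ∀ x, ‖Φ s x‖ ≤ Real.exp (|θ| * T)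
        * (|θ| * (C * ‖Y s x‖ ^ 2) + (C * ‖Y s x‖ ^ 2 + C * ‖Yt s x‖ ^ 2)) := fun x => by
      simp only [Φ]
      rw [norm_mul, Real.norm_eq_abs, Real.norm_eq_abs, Real.abs_exp]
      have e1 : Real.exp (θ * s) ≤ Real.exp (|θ| * T) := by
        refine Real.exp_le_exp.2 ?_
        have := abs_nonneg θ
        exact (mul_le_mul_of_nonneg_right (le_abs_self θ) hs.1).trans
          (mul_le_mul_of_nonneg_left hs.2 this)
      have e2 : |inner ℝ (Y s x) (Yt s x)| ≤ ‖Y s x‖ * ‖Yt s x‖ := abs_real_inner_le_norm _ _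
      have e3 : 2 * |inner ℝ (Y s x) (Yt s x)| ≤ ‖Y s x‖ ^ 2 + ‖Yt s x‖ ^ 2 := by
        nlinarith [sq_nonneg (‖Y s x‖ - ‖Yt s x‖)]
      refine mul_le_mul e1 ((abs_add_le _ _).trans (add_le_add ?_ ?_)) (abs_nonneg _)
        (Real.exp_pos _).le
      · rw [abs_mul, abs_mul, abs_of_nonneg (sq_nonneg ‖Y s x‖)]
        gcongr
        exact hρC x
      · rw [abs_mul, abs_mul, abs_of_pos (zero_lt_two' ℝ), ← mul_add]
        calc 2 * (|ρ x| * |inner ℝ (Y s x) (Yt s x)|)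
            = |ρ x| * (2 * |inner ℝ (Y s x) (Yt s x)|) := by ring
          _ ≤ C * (‖Y s x‖ ^ 2 + ‖Yt s x‖ ^ 2) :=
            mul_le_mul (hρC x) e3 (by positivity) hC0
    have j1 := (hIY s hs).const_mul C
    have j2 := hIYt2.const_mul C
    have k1 : ∫ x, ‖Y s x‖ ^ 2 ≤ (B : ℝ) ^ 2 := by
      rw [integral_norm_sq_eq (hYl.memLp ⟨s, hs⟩)]
      gcongr
      simpa using ENNReal.toReal_mono ENNReal.coe_ne_top (hB ⟨s, hs⟩)
    have k2 : ∫ x, ‖Yt s x‖ ^ 2 ≤ (B' : ℝ) ^ 2 := by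
      rw [integral_norm_sq_eq (hYtl.memLp ⟨s, hs⟩)]
      gcongr
      simpa using ENNReal.toReal_mono ENNReal.coe_ne_top (hB' ⟨s, hs⟩)
    have j3 : Integrable (fun x => C * ‖Y s x‖ ^ 2 + C * ‖Yt s x‖ ^ 2) volume := j1.add j2
    have j4 : Integrable (fun x => |θ| * (C * ‖Y s x‖ ^ 2)
        + (C * ‖Y s x‖ ^ 2 + C * ‖Yt s x‖ ^ 2)) volume := (j1.const_mul |θ|).add j3
    refine (integral_mono (hΦi s hs).norm (j4.const_mul _) pt).trans ?_
    rw [integral_const_mul, integral_add (j1.const_mul |θ|) j3, integral_add j1 j2,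
      integral_const_mul, integral_const_mul, integral_const_mul]
    gcongr
  have hint : Integrable (Function.uncurry Φ)
      ((volume.restrict (Ioc 0 t)).prod (volume : Measure ℝ)) := by
    rw [integrable_prod_iff hmeas]
    refine ⟨?_, Integrable.of_bound hmeas.norm.integral_prod_right'
      (Real.exp (|θ| * T) * (|θ| * (C * B ^ 2) + (C * B ^ 2 + C * B' ^ 2))) ?_⟩
    · exact (ae_restrict_mem measurableSet_Ioc).mono fun s hs => hΦi s (hsub hs)
    · refine (ae_restrict_mem measurableSet_Ioc).mono fun s hs => ?_
      rw [Real.norm_eq_abs, abs_of_nonneg (integral_nonneg fun x => norm_nonneg _)]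
      exact hΦb s (hsub hs)
  have hcongr : ∀ s ∈ Ioc 0 t, ∫ x, Φ s x = Real.exp (θ * s) * ∫ x,
      ((θ * ρ x + (ρ' x * a s x + ρ x * ax s x)) * ‖Y s x‖ ^ 2
        + 2 * ρ x * inner ℝ (Y s x) (Yt s x + a s x • Yx s x)) := fun s hs => hflux s (hsub hs)
  refine ⟨?_, ?_⟩
  · rw [intervalIntegrable_iff_integrableOn_Ioc_of_le ht.1]
    exact (integrableOn_congr_fun hcongr measurableSet_Ioc).1 hint.integral_prod_left
  -- The fundamental theorem of calculus in time is applied at each fixed `x` and then integrated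
  -- with Fubini; no differentiation under the integral sign is needed.
  · have hpt : ∀ x, Real.exp (θ * t) * (ρ x * ‖Y t x‖ ^ 2) - ρ x * ‖Y 0 x‖ ^ 2
        = ∫ s in Ioc 0 t, Φ s x := fun x => by
      have c1 : ContinuousOn (fun s => Y s x) (Icc 0 t) :=
        hYc.comp (f := fun s => (s, x)) (by fun_prop)
          fun s hs => ⟨⟨hs.1, hs.2.trans ht.2⟩, mem_univ _⟩
      have c2 : ContinuousOn (fun s => Φ s x) (Icc 0 t) :=
        hΦc.comp (f := fun s => (s, x)) (by fun_prop)
          fun s hs => ⟨⟨hs.1, hs.2.trans ht.2⟩, mem_univ _⟩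
      have h1 := intervalIntegral.integral_eq_sub_of_hasDerivAt_of_le ht.1
        (f := fun s => Real.exp (θ * s) * (ρ x * ‖Y s x‖ ^ 2)) (f' := fun s => Φ s x)
        ((Continuous.continuousOn (by fun_prop)).mul (continuousOn_const.mul (c1.norm.pow 2)))
        (fun s hs => by
          have d1 : HasDerivAt (fun s => Real.exp (θ * s)) (Real.exp (θ * s) * θ) s := by
            simpa using ((hasDerivAt_id s).const_mul θ).exp
          have d2 := d1.mul
            (((hYt x s ⟨hs.1, hs.2.trans_le ht.2⟩).norm_sq).const_mul (ρ x))
          refine d2.congr_deriv ?_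
          simp only [Φ]
          ring)
        (c2.intervalIntegrable_of_Icc ht.1)
      rw [intervalIntegral.integral_of_le ht.1] at h1
      simpa using h1.symm
    rw [← integral_const_mul, ← integral_sub
      ((integrable_mul_of_bdd (hIY t ht) hρc hρC).const_mul _)
      (integrable_mul_of_bdd (hIY 0 h0T) hρc hρC), intervalIntegral.integral_of_le ht.1]
    simp_rw [hpt]
    rw [← setIntegral_congr_fun measurableSet_Ioc hcongr]
    exact (integral_integral_swap hint).symm

end TransportEnergy

/-! ### Uniform Lipschitz bounds near compact sets. -/

section NearCompact

/-- A `C¹` function is bounded and Lipschitz, uniformly near a compact set. -/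
theorem exists_lipschitz_near_compact {X Y : Type*} [NormedAddCommGroup X] [NormedSpace ℝ X]
    [NormedAddCommGroup Y] [NormedSpace ℝ Y] {f : X → Y} {O K : Set X} (hO : IsOpen O)
    (hf : ContDiffOn ℝ 1 f O) (hK : IsCompact K) (hKO : K ⊆ O) :
    ∃ C ε : ℝ, 0 < C ∧ 0 < ε ∧ ∀ z ∈ K, ∀ z', ‖z' - z‖ ≤ ε →
      z' ∈ O ∧ ‖f z' - f z‖ ≤ C * ‖z' - z‖ ∧ ‖f z'‖ ≤ C := by
  refine hK.induction_on (p := fun S => ∃ C ε : ℝ, 0 < C ∧ 0 < ε ∧ ∀ z ∈ S, ∀ z', ‖z' - z‖ ≤ ε →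
      z' ∈ O ∧ ‖f z' - f z‖ ≤ C * ‖z' - z‖ ∧ ‖f z'‖ ≤ C) ?_ ?_ ?_ ?_
  · exact ⟨1, 1, one_pos, one_pos, by simp⟩
  · rintro s t hst ⟨C, ε, hC, hε, h⟩
    exact ⟨C, ε, hC, hε, fun z hz => h z (hst hz)⟩
  · rintro s t ⟨C, ε, hC, hε, h⟩ ⟨C', ε', hC', hε', h'⟩
    refine ⟨max C C', min ε ε', lt_max_of_lt_left hC, lt_min hε hε', fun z hz z' hzz' => ?_⟩
    rcases hz with hz | hz
    · obtain ⟨h1, h2, h3⟩ := h z hz z' (hzz'.trans (min_le_left _ _))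
      exact ⟨h1, h2.trans (by gcongr; exact le_max_left _ _), h3.trans (le_max_left _ _)⟩
    · obtain ⟨h1, h2, h3⟩ := h' z hz z' (hzz'.trans (min_le_right _ _))
      exact ⟨h1, h2.trans (by gcongr; exact le_max_right _ _), h3.trans (le_max_right _ _)⟩
  · intro z₀ hz₀
    have hc := hf.contDiffAt (hO.mem_nhds (hKO hz₀))
    obtain ⟨L, t, ht, hL⟩ := hc.exists_lipschitzOnWith
    have hb : ∀ᶠ z in 𝓝 z₀, ‖f z‖ < ‖f z₀‖ + 1 :=
      hc.continuousAt.norm.eventually_lt continuousAt_const (by simp)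
    obtain ⟨r, hr, hball⟩ := Metric.mem_nhds_iff.1
      (inter_mem (inter_mem ht (hO.mem_nhds (hKO hz₀))) hb)
    -- A point within `r/3` of a point of the half ball stays in the ball of radius `r`, where a
    -- single Lipschitz constant and a single bound hold.
    refine ⟨Metric.ball z₀ (r / 2), mem_nhdsWithin_of_mem_nhds (Metric.ball_mem_nhds _ (by positivity)),
      max L (‖f z₀‖ + 1), r / 3, lt_max_of_lt_right (by positivity), by positivity,
      fun z hz z' hzz' => ?_⟩
    have hz1 : z ∈ Metric.ball z₀ r := Metric.ball_subset_ball (by linarith) hz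
    have hz2 : z' ∈ Metric.ball z₀ r := by
      rw [Metric.mem_ball, dist_eq_norm] at hz ⊢
      have := norm_add_le (z' - z) (z - z₀)
      rw [sub_add_sub_cancel] at this
      linarith
    obtain ⟨⟨h1, -⟩, -⟩ := hball hz1
    obtain ⟨⟨h2, h3⟩, h4⟩ := hball hz2
    refine ⟨h3, (hL.norm_sub_le h2 h1).trans (by gcongr; exact le_max_left _ _),
      (le_of_lt h4).trans (le_max_right _ _)⟩

end NearCompact

/-! ### Block diagonalisation by a commutator. -/

section Algebra

/-- Block diagonalisation: the commutator with the normal form removes the off-diagonal blocks. -/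
theorem mul_add_commutator_eq {R κ : Type*} [Ring R] [Algebra ℝ R] [Fintype κ] [DecidableEq κ]
    {a B : R} {lam : κ → ℝ} {P D : κ → R} (hinj : Function.Injective lam)
    (hPP : ∀ j, P j * P j = P j) (hPQ : ∀ j k, j ≠ k → P j * P k = 0) (hsum : ∑ j, P j = 1)
    (hPa : ∀ j, P j * a = lam j • P j)
    (hD : ∀ j, D j = D j * P j + P j * D j) {X : κ → R} (hX : ∀ j, X j = P j * B + lam j • D j)
    {S : R} (hS : S = ∑ m, ∑ k, (lam k - lam m)⁻¹ • (X m * P k)) (j : κ) :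
    P j * (B + a * S - S * a) + lam j • D j = X j * P j := by
  -- The differentiated relation `P² = P` gives `D m * P k = P m * D m * P k` for `m ≠ k`, so the
  -- off-diagonal parts of `X m` map into the range of `P m`.
  have hXP : ∀ m k, m ≠ k → X m * P k = P m * (X m * P k) := fun m k hmk => by
    have h1 : D m * P k = P m * (D m * P k) := by
      conv_lhs => rw [hD m]
      rw [add_mul, mul_assoc, hPQ m k hmk, mul_zero, zero_add, mul_assoc]
    rw [hX, add_mul, mul_add, mul_assoc, ← mul_assoc (P m) (P m), hPP, smul_mul_assoc,
      mul_smul_comm, ← h1]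
  have hPS : P j * S = ∑ k, (lam k - lam j)⁻¹ • (X j * P k) := by
    rw [hS, Finset.mul_sum, Finset.sum_eq_single j]
    · rw [Finset.mul_sum]
      refine Finset.sum_congr rfl fun k _ => ?_
      by_cases hk : j = k
      · subst hk; simp
      · rw [mul_smul_comm, ← hXP j k hk]
    · intro m _ hm
      rw [Finset.mul_sum]
      refine Finset.sum_eq_zero fun k _ => ?_
      by_cases hk : m = k
      · subst hk; simp
      · rw [mul_smul_comm, hXP m k hk, ← mul_assoc, hPQ j m (Ne.symm hm), zero_mul, smul_zero]
    · simp
  -- On the block from `k` to `j` the commutator multiplies by `lam j - lam k`, which against the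
  -- divisor `lam k - lam j` produces exactly `-X j * P k`.
  have h1 : P j * (a * S) - P j * (S * a) = -∑ k, (if k = j then 0 else X j * P k) := by
    rw [← mul_assoc, hPa, smul_mul_assoc, ← mul_assoc, hPS, Finset.smul_sum, Finset.sum_mul,
      ← Finset.sum_sub_distrib, ← Finset.sum_neg_distrib]
    refine Finset.sum_congr rfl fun k _ => ?_
    rw [smul_mul_assoc, mul_assoc, hPa, mul_smul_comm, smul_smul, smul_smul, ← sub_smul]
    split_ifs with hk
    · subst hk; simp
    · rw [← neg_one_smul ℝ]
      congr 1
      have : lam k - lam j ≠ 0 := sub_ne_zero.2 (hinj.ne hk)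
      field_simp
      ring
  have h2 : ∑ k, (if k = j then 0 else X j * P k) = X j - X j * P j := by
    have h3 : X j = ∑ k, X j * P k := by rw [← Finset.mul_sum, hsum, mul_one]
    have h4 : ∑ k, X j * P k = X j * P j + ∑ k, (if k = j then 0 else X j * P k) := by
      rw [← Finset.add_sum_erase _ _ (Finset.mem_univ j)]
      congr 1
      rw [← Finset.add_sum_erase (f := fun k => if k = j then 0 else X j * P k) _
        (Finset.mem_univ j)]
      simp only [if_true, zero_add]
      refine Finset.sum_congr rfl fun k hk => ?_
      rw [if_neg (Finset.ne_of_mem_erase hk)]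
    rw [eq_sub_iff_add_eq, add_comm, ← h4, ← h3]
  calc P j * (B + a * S - S * a) + lam j • D j
      = (P j * B + lam j • D j) + (P j * (a * S) - P j * (S * a)) := by
        rw [mul_sub, mul_add]; abel
    _ = X j * P j := by rw [← hX, h1, h2]; abel

end Algebra

/-! ### The differentiated system, its normal form, and the profile. -/

section System

variable {E : Type*} [NormedAddCommGroup E] [InnerProductSpace ℝ E]

/-- The part of the twice differentiated equation that is linear in the second derivative. -/
noncomputable def linPart (a : E → E →L[ℝ] E) (q : E → E) (u p : E) : E →L[ℝ] E :=
  fderiv ℝ q u - (2 : ℝ) • fderiv ℝ a u p - (fderiv ℝ a u).flip p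

/-- The stationary operator `q(u) - a(u) u_x`. -/
def residual₀ (a : E → E →L[ℝ] E) (q : E → E) (u p : E) : E := q u - a u p

/-- The derivative of the stationary operator, for a second derivative `p₂`. -/
noncomputable def residual₁ (a : E → E →L[ℝ] E) (q : E → E) (u p p₂ : E) : E :=
  fderiv ℝ q u p - fderiv ℝ a u p p - a u p₂

/-- The second derivative of the stationary operator, for derivatives `p₂`, `p₃`. -/
noncomputable def residual₂ (a : E → E →L[ℝ] E) (q : E → E) (u p p₂ p₃ : E) : E :=
  fderiv ℝ (fderiv ℝ q) u p p - fderiv ℝ (fderiv ℝ a) u p p p + linPart a q u p p₂ - a u p₃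

variable {κ : Type*}

/-- The coupling of the `j`-th characteristic field to the others. -/
noncomputable def coupling (a : E → E →L[ℝ] E) (q : E → E) (lam : κ → E → ℝ)
    (P : κ → E → E →L[ℝ] E) (j : κ) (u p : E) : E →L[ℝ] E :=
  P j u * linPart a q u p + lam j u • fderiv ℝ (P j) u p

/-- The operator of the normal form transformation that decouples the characteristic fields. -/
noncomputable def normalForm [Fintype κ] (a : E → E →L[ℝ] E) (q : E → E) (lam : κ → E → ℝ)
    (P : κ → E → E →L[ℝ] E) (u p : E) : E →L[ℝ] E :=
  ∑ m, ∑ k, (lam k u - lam m u)⁻¹ • (coupling a q lam P m u p * P k u)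

/-- The zeroth order operator in the equation of the `j`-th characteristic field, when the normal
form is taken at `(u₀, p₀)`, the state is `(u, p)` and the speed of the frame is `d`. -/
noncomputable def fieldOp [Fintype κ] (a : E → E →L[ℝ] E) (q : E → E) (lam : κ → E → ℝ)
    (P : κ → E → E →L[ℝ] E) (j : κ) (u₀ p₀ u p : E) (d : ℝ) : E →L[ℝ] E :=
  P j u * (linPart a q u p + a u * normalForm a q lam P u₀ p₀ - normalForm a q lam P u₀ p₀ * a u)
    + fderiv ℝ (P j) u (residual₀ a q u p + d • p) + (lam j u - d) • fderiv ℝ (P j) u p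

/-- Smooth coefficients with a smooth spectral resolution on an open set of states. -/
structure SpectralSetting [Fintype κ] [DecidableEq κ] (O : Set E) (a : E → E →L[ℝ] E) (q : E → E)
    (lam : κ → E → ℝ) (P : κ → E → E →L[ℝ] E) : Prop where
  isOpen : IsOpen O
  smooth_a : ContDiffOn ℝ ∞ a O
  smooth_q : ContDiffOn ℝ ∞ q O
  smooth_lam : ∀ j, ContDiffOn ℝ ∞ (lam j) O
  smooth_P : ∀ j, ContDiffOn ℝ ∞ (P j) O
  injective : ∀ u ∈ O, Function.Injective fun j => lam j u
  mul_self : ∀ u ∈ O, ∀ j, P j u * P j u = P j u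
  mul_of_ne : ∀ u ∈ O, ∀ j k, j ≠ k → P j u * P k u = 0
  sum_eq_one : ∀ u ∈ O, ∑ j, P j u = 1
  mul_op : ∀ u ∈ O, ∀ j, P j u * a u = lam j u • P j u

/-- A stationary profile with its first three derivatives. -/
structure ProfileJet (K : Set E) (a : E → E →L[ℝ] E) (q : E → E) (U₀ U₁ U₂ U₃ : ℝ → E)
    (um up : E) (Cp : ℝ) : Prop where
  isCompact : IsCompact K
  mem : ∀ x, U₀ x ∈ K
  mem_minus : um ∈ K
  mem_plus : up ∈ K
  deriv₀ : ∀ x, HasDerivAt U₀ (U₁ x) x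
  deriv₁ : ∀ x, HasDerivAt U₁ (U₂ x) x
  deriv₂ : ∀ x, HasDerivAt U₂ (U₃ x) x
  continuous₃ : Continuous U₃
  bound₁ : ∀ x, ‖U₁ x‖ ≤ Cp
  bound₂ : ∀ x, ‖U₂ x‖ ≤ Cp
  bound₃ : ∀ x, ‖U₃ x‖ ≤ Cp
  memLp₁ : MemLp U₁ 2 volume
  memLp₂ : MemLp U₂ 2 volume
  memLp₃ : MemLp U₃ 2 volume
  tendsto_minus : Tendsto U₀ atBot (𝓝 um)
  tendsto_plus : Tendsto U₀ atTop (𝓝 up)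
  tendsto_deriv_minus : Tendsto U₁ atBot (𝓝 0)
  tendsto_deriv_plus : Tendsto U₁ atTop (𝓝 0)
  stationary : ∀ x, a (U₀ x) (U₁ x) = q (U₀ x)

variable [Fintype κ] [DecidableEq κ] {O K : Set E} {a : E → E →L[ℝ] E} {q : E → E}
  {lam : κ → E → ℝ} {P : κ → E → E →L[ℝ] E} {U₀ U₁ U₂ U₃ : ℝ → E} {um up : E} {Cp : ℝ}

theorem ContDiffOn.hasFDerivAt_of_isOpen {X Y : Type*} [NormedAddCommGroup X] [NormedSpace ℝ X]
    [NormedAddCommGroup Y] [NormedSpace ℝ Y] {f : X → Y} {O : Set X} (hf : ContDiffOn ℝ ∞ f O)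
    (hO : IsOpen O) {u : X} (hu : u ∈ O) : HasFDerivAt f (fderiv ℝ f u) u :=
  ((hf.contDiffAt (hO.mem_nhds hu)).differentiableAt (by simp)).hasFDerivAt

theorem ContDiffOn.fderiv_infty {X Y : Type*} [NormedAddCommGroup X] [NormedSpace ℝ X]
    [NormedAddCommGroup Y] [NormedSpace ℝ Y] {f : X → Y} {O : Set X} (hf : ContDiffOn ℝ ∞ f O)
    (hO : IsOpen O) : ContDiffOn ℝ ∞ (fderiv ℝ f) O :=
  hf.fderiv_of_isOpen hO (by simp)

theorem residual₀_profile (hp : ProfileJet K a q U₀ U₁ U₂ U₃ um up Cp) (x : ℝ) :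
    residual₀ a q (U₀ x) (U₁ x) = 0 := by rw [residual₀, hp.stationary, sub_self]

/-- Differentiate the stationary equation along the profile. Vanishing of the residuals there is
what makes the sources of the perturbation equations at least linear in the perturbation, apart from
terms carrying `d`. -/
theorem residual₁_profile (hs : SpectralSetting O a q lam P)
    (hp : ProfileJet K a q U₀ U₁ U₂ U₃ um up Cp) (hKO : K ⊆ O) (x : ℝ) :
    residual₁ a q (U₀ x) (U₁ x) (U₂ x) = 0 := by
  have hu := hKO (hp.mem x)
  have h1 : HasDerivAt (fun x => q (U₀ x)) (fderiv ℝ q (U₀ x) (U₁ x)) x :=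
    (hs.smooth_q.hasFDerivAt_of_isOpen hs.isOpen hu).comp_hasDerivAt x (hp.deriv₀ x)
  have h2 : HasDerivAt (fun x => a (U₀ x)) (fderiv ℝ a (U₀ x) (U₁ x)) x :=
    (hs.smooth_a.hasFDerivAt_of_isOpen hs.isOpen hu).comp_hasDerivAt x (hp.deriv₀ x)
  have h3 := h2.clm_apply (hp.deriv₁ x)
  simp only [hp.stationary] at h3
  rw [residual₁, h1.unique h3]
  abel

theorem residual₂_profile (hs : SpectralSetting O a q lam P)
    (hp : ProfileJet K a q U₀ U₁ U₂ U₃ um up Cp) (hKO : K ⊆ O) (x : ℝ) :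
    residual₂ a q (U₀ x) (U₁ x) (U₂ x) (U₃ x) = 0 := by
  have hu := hKO (hp.mem x)
  have h1 : HasDerivAt (fun x => fderiv ℝ q (U₀ x)) (fderiv ℝ (fderiv ℝ q) (U₀ x) (U₁ x)) x :=
    ((hs.smooth_q.fderiv_infty hs.isOpen).hasFDerivAt_of_isOpen hs.isOpen hu).comp_hasDerivAt x
      (hp.deriv₀ x)
  have h2 : HasDerivAt (fun x => a (U₀ x)) (fderiv ℝ a (U₀ x) (U₁ x)) x :=
    (hs.smooth_a.hasFDerivAt_of_isOpen hs.isOpen hu).comp_hasDerivAt x (hp.deriv₀ x)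
  have h3 : HasDerivAt (fun x => fderiv ℝ a (U₀ x)) (fderiv ℝ (fderiv ℝ a) (U₀ x) (U₁ x)) x :=
    ((hs.smooth_a.fderiv_infty hs.isOpen).hasFDerivAt_of_isOpen hs.isOpen hu).comp_hasDerivAt x
      (hp.deriv₀ x)
  have h4 := ((h1.clm_apply (hp.deriv₁ x)).sub
    ((h3.clm_apply (hp.deriv₁ x)).clm_apply (hp.deriv₁ x))).sub (h2.clm_apply (hp.deriv₂ x))
  have h5 : HasDerivAt (fun _ : ℝ => (0 : E)) _ x :=
    h4.congr_of_eventuallyEq (.of_forall fun y => (residual₁_profile hs hp hKO y).symm)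
  have h6 := h5.unique (hasDerivAt_const x 0)
  rw [← h6, residual₂, linPart]
  simp only [sub_apply, add_apply, ContinuousLinearMap.flip_apply, two_smul]
  abel

/-- The derivative of the idempotent relation; it says that the derivative of a projection is
off-diagonal. -/
theorem fderiv_projection (hs : SpectralSetting O a q lam P) {u : E} (hu : u ∈ O) (j : κ) (p : E) :
    fderiv ℝ (P j) u p = fderiv ℝ (P j) u p * P j u + P j u * fderiv ℝ (P j) u p := by
  have h1 := (hs.smooth_P j).hasFDerivAt_of_isOpen hs.isOpen hu
  have h2 := (h1.mul' h1).congr_of_eventuallyEq (f₁ := P j) (by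
    filter_upwards [hs.isOpen.mem_nhds hu] with y hy using (hs.mul_self y hy j).symm)
  conv_lhs => rw [h2.fderiv]
  simp [add_comm]

/-- This is the decoupling. Along the profile at zero speed the residual vanishes, and the
commutator with the normal form removes from the `j`-th equation everything that acts on the other
fields. -/
theorem fieldOp_profile (hs : SpectralSetting O a q lam P)
    (hp : ProfileJet K a q U₀ U₁ U₂ U₃ um up Cp) (hKO : K ⊆ O) (j : κ) (x : ℝ) :
    fieldOp a q lam P j (U₀ x) (U₁ x) (U₀ x) (U₁ x) 0
      = coupling a q lam P j (U₀ x) (U₁ x) * P j (U₀ x) := by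
  have hu := hKO (hp.mem x)
  rw [fieldOp, residual₀_profile hp, zero_smul, add_zero, map_zero, add_zero, sub_zero]
  exact mul_add_commutator_eq (lam := fun j => lam j (U₀ x)) (P := fun j => P j (U₀ x))
    (D := fun j => fderiv ℝ (P j) (U₀ x) (U₁ x))
    (X := fun j => coupling a q lam P j (U₀ x) (U₁ x)) (hs.injective _ hu) (hs.mul_self _ hu)
    (hs.mul_of_ne _ hu) (hs.sum_eq_one _ hu) (hs.mul_op _ hu)
    (fun j => fderiv_projection hs hu j _) (fun _ => rfl) rfl j

end System

/-! ### Smooth dependence of the coefficients on the jets. -/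

section Smoothness

variable {E : Type*} [NormedAddCommGroup E] [InnerProductSpace ℝ E] {κ : Type*} [Fintype κ]
  [DecidableEq κ] {O K : Set E} {a : E → E →L[ℝ] E} {q : E → E} {lam : κ → E → ℝ}
  {P : κ → E → E →L[ℝ] E}

theorem ContDiffOn.contDiffAt_comp {X Y Z : Type*} [NormedAddCommGroup X] [NormedSpace ℝ X]
    [NormedAddCommGroup Y] [NormedSpace ℝ Y] [NormedAddCommGroup Z] [NormedSpace ℝ Z] {f : Y → Z}
    {O : Set Y} (hf : ContDiffOn ℝ ∞ f O) (hO : IsOpen O) {g : X → Y} {z : X}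
    (hg : ContDiffAt ℝ ∞ g z) (hz : g z ∈ O) : ContDiffAt ℝ ∞ (fun z => f (g z)) z :=
  (hf.contDiffAt (hO.mem_nhds hz)).comp z hg

variable {X : Type*} [NormedAddCommGroup X] [NormedSpace ℝ X] {u p p₂ p₃ u₀ p₀ : X → E} {z : X}

theorem contDiffAt_linPart (hs : SpectralSetting O a q lam P) (hu : ContDiffAt ℝ ∞ u z)
    (hp : ContDiffAt ℝ ∞ p z) (hz : u z ∈ O) :
    ContDiffAt ℝ ∞ (fun z => linPart a q (u z) (p z)) z := by
  have h1 := (hs.smooth_q.fderiv_infty hs.isOpen).contDiffAt_comp hs.isOpen hu hz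
  have h2 := (hs.smooth_a.fderiv_infty hs.isOpen).contDiffAt_comp hs.isOpen hu hz
  have h3 : ContDiffAt ℝ ∞ (fun z => (fderiv ℝ a (u z)).flip) z :=
    (IsBoundedLinearMap.contDiff ⟨⟨fun _ _ => rfl, fun _ _ => rfl⟩, 1, one_pos, fun f => by
      rw [ContinuousLinearMap.opNorm_flip, one_mul]⟩ :
      ContDiff ℝ ∞ (fun f : E →L[ℝ] E →L[ℝ] E => f.flip)).contDiffAt.comp z h2
  exact (h1.sub ((h2.clm_apply hp).const_smul 2)).sub (h3.clm_apply hp)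

theorem contDiffAt_coupling (hs : SpectralSetting O a q lam P) (hu : ContDiffAt ℝ ∞ u z)
    (hp : ContDiffAt ℝ ∞ p z) (hz : u z ∈ O) (j : κ) :
    ContDiffAt ℝ ∞ (fun z => coupling a q lam P j (u z) (p z)) z := by
  have h1 := (hs.smooth_P j).contDiffAt_comp hs.isOpen hu hz
  have h2 := ((hs.smooth_P j).fderiv_infty hs.isOpen).contDiffAt_comp hs.isOpen hu hz
  have h3 := (hs.smooth_lam j).contDiffAt_comp hs.isOpen hu hz
  exact (h1.mul (contDiffAt_linPart hs hu hp hz)).add (h3.smul (h2.clm_apply hp))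

theorem contDiffAt_normalForm (hs : SpectralSetting O a q lam P) (hu : ContDiffAt ℝ ∞ u z)
    (hp : ContDiffAt ℝ ∞ p z) (hz : u z ∈ O) :
    ContDiffAt ℝ ∞ (fun z => normalForm a q lam P (u z) (p z)) z := by
  refine ContDiffAt.sum fun m _ => ContDiffAt.sum fun k _ => ?_
  -- For equal indices the coefficient is the inverse of the zero function, which Lean sets to zero,
  -- so the term is constant; otherwise simplicity of the spectrum keeps the divisor away from zero.
  by_cases hmk : k = m
  · subst hmk
    simpa using contDiffAt_const
  · refine ContDiffAt.smul (ContDiffAt.inv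
      (((hs.smooth_lam k).contDiffAt_comp hs.isOpen hu hz).sub
        ((hs.smooth_lam m).contDiffAt_comp hs.isOpen hu hz)) ?_) ?_
    · exact sub_ne_zero.2 ((hs.injective _ hz).ne hmk)
    · exact (contDiffAt_coupling hs hu hp hz m).mul
        ((hs.smooth_P k).contDiffAt_comp hs.isOpen hu hz)

theorem contDiffAt_residual₀ (hs : SpectralSetting O a q lam P) (hu : ContDiffAt ℝ ∞ u z)
    (hp : ContDiffAt ℝ ∞ p z) (hz : u z ∈ O) :
    ContDiffAt ℝ ∞ (fun z => residual₀ a q (u z) (p z)) z :=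
  (hs.smooth_q.contDiffAt_comp hs.isOpen hu hz).sub
    ((hs.smooth_a.contDiffAt_comp hs.isOpen hu hz).clm_apply hp)

theorem contDiffAt_residual₁ (hs : SpectralSetting O a q lam P) (hu : ContDiffAt ℝ ∞ u z)
    (hp : ContDiffAt ℝ ∞ p z) (hp₂ : ContDiffAt ℝ ∞ p₂ z) (hz : u z ∈ O) :
    ContDiffAt ℝ ∞ (fun z => residual₁ a q (u z) (p z) (p₂ z)) z := by
  have h1 := (hs.smooth_q.fderiv_infty hs.isOpen).contDiffAt_comp hs.isOpen hu hz
  have h2 := (hs.smooth_a.fderiv_infty hs.isOpen).contDiffAt_comp hs.isOpen hu hz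
  have h3 := hs.smooth_a.contDiffAt_comp hs.isOpen hu hz
  exact ((h1.clm_apply hp).sub ((h2.clm_apply hp).clm_apply hp)).sub (h3.clm_apply hp₂)

theorem contDiffAt_residual₂ (hs : SpectralSetting O a q lam P) (hu : ContDiffAt ℝ ∞ u z)
    (hp : ContDiffAt ℝ ∞ p z) (hp₂ : ContDiffAt ℝ ∞ p₂ z) (hp₃ : ContDiffAt ℝ ∞ p₃ z)
    (hz : u z ∈ O) : ContDiffAt ℝ ∞ (fun z => residual₂ a q (u z) (p z) (p₂ z) (p₃ z)) z := by
  have h1 := ((hs.smooth_q.fderiv_infty hs.isOpen).fderiv_infty hs.isOpen).contDiffAt_comp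
    hs.isOpen hu hz
  have h2 := ((hs.smooth_a.fderiv_infty hs.isOpen).fderiv_infty hs.isOpen).contDiffAt_comp
    hs.isOpen hu hz
  have h3 := hs.smooth_a.contDiffAt_comp hs.isOpen hu hz
  exact ((((h1.clm_apply hp).clm_apply hp).sub (((h2.clm_apply hp).clm_apply hp).clm_apply hp)).add
    ((contDiffAt_linPart hs hu hp hz).clm_apply hp₂)).sub (h3.clm_apply hp₃)

theorem contDiffAt_fieldOp (hs : SpectralSetting O a q lam P) {d : X → ℝ}
    (hu₀ : ContDiffAt ℝ ∞ u₀ z) (hp₀ : ContDiffAt ℝ ∞ p₀ z) (hu : ContDiffAt ℝ ∞ u z)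
    (hp : ContDiffAt ℝ ∞ p z) (hd : ContDiffAt ℝ ∞ d z) (hz₀ : u₀ z ∈ O) (hz : u z ∈ O) (j : κ) :
    ContDiffAt ℝ ∞ (fun z => fieldOp a q lam P j (u₀ z) (p₀ z) (u z) (p z) (d z)) z := by
  have h1 := (hs.smooth_P j).contDiffAt_comp hs.isOpen hu hz
  have h2 := ((hs.smooth_P j).fderiv_infty hs.isOpen).contDiffAt_comp hs.isOpen hu hz
  have h3 := (hs.smooth_lam j).contDiffAt_comp hs.isOpen hu hz
  have h4 := hs.smooth_a.contDiffAt_comp hs.isOpen hu hz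
  have h5 := contDiffAt_normalForm hs hu₀ hp₀ hz₀
  exact ((h1.mul (((contDiffAt_linPart hs hu hp hz).add (h4.mul h5)).sub (h5.mul h4))).add
    (h2.clm_apply ((contDiffAt_residual₀ hs hu hp hz).add (hd.smul hp)))).add
    ((h3.sub hd).smul (h2.clm_apply hp))

end Smoothness

/-! ### Sign of the diagonal blocks along the profile. -/

section Damping

variable {E : Type*} [NormedAddCommGroup E] [InnerProductSpace ℝ E]
  {κ : Type*} [Fintype κ] [DecidableEq κ] {O K : Set E} {a : E → E →L[ℝ] E} {q : E → E}
  {lam : κ → E → ℝ} {P : κ → E → E →L[ℝ] E} {U₀ U₁ U₂ U₃ : ℝ → E} {um up : E} {Cp : ℝ}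

/-- At an end state the derivative of the profile vanishes. All terms with derivatives of `lam j`,
`P j` and `a` then disappear, and the block reduces to `P j * Q * P j = μ • P j`. The rest is
continuity. -/
theorem eventually_diagonal_le (hs : SpectralSetting O a q lam P) {l : Filter ℝ} {ue : E}
    (hue : ue ∈ O) (h₀ : Tendsto U₀ l (𝓝 ue)) (h₁ : Tendsto U₁ l (𝓝 0)) (j : κ) {μ : ℝ}
    (hμ : μ < 0) (hPQ : P j ue * fderiv ℝ q ue * P j ue = μ • P j ue) :
    ∀ᶠ x in l, ∀ z, P j (U₀ x) z = z → fderiv ℝ (lam j) (U₀ x) (U₁ x) * ‖z‖ ^ 2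
      + 2 * inner ℝ z (coupling a q lam P j (U₀ x) (U₁ x) z) ≤ μ * ‖z‖ ^ 2 := by
  have hc : ContDiffAt ℝ ∞ (fun z : E × E => coupling a q lam P j z.1 z.2 * P j z.1
      - μ • P j z.1) (ue, 0) :=
    ((contDiffAt_coupling hs contDiffAt_fst contDiffAt_snd hue j).mul
      ((hs.smooth_P j).contDiffAt_comp hs.isOpen contDiffAt_fst hue)).sub
      (((hs.smooth_P j).contDiffAt_comp hs.isOpen contDiffAt_fst hue).const_smul μ)
  have hc' : ContDiffAt ℝ ∞ (fun z : E × E => fderiv ℝ (lam j) z.1 z.2) (ue, 0) :=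
    (((hs.smooth_lam j).fderiv_infty hs.isOpen).contDiffAt_comp hs.isOpen contDiffAt_fst
      hue).clm_apply contDiffAt_snd
  have t1 := hc.continuousAt.tendsto.comp (h₀.prodMk_nhds h₁)
  have t2 := hc'.continuousAt.tendsto.comp (h₀.prodMk_nhds h₁)
  have e1 : coupling a q lam P j ue 0 * P j ue - μ • P j ue = 0 := by
    rw [coupling, linPart]
    simp [hPQ]
  simp only [e1] at t1
  simp only [map_zero] at t2
  -- The limit contributes `2μ`. Half of `|μ|` is allowed for twice the error of the block and half
  -- for the derivative of the eigenvalue, which leaves `μ`.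
  have n1 := t1.norm.eventually_lt_const (u := -μ / 4) (by simp; linarith)
  have n2 := t2.norm.eventually_lt_const (u := -μ / 2) (by simp; linarith)
  filter_upwards [n1, n2] with x hx1 hx2 z hz
  simp only [Function.comp_apply] at hx1 hx2
  set Gx := coupling a q lam P j (U₀ x) (U₁ x) * P j (U₀ x) - μ • P j (U₀ x) with hG
  have e2 : coupling a q lam P j (U₀ x) (U₁ x) z = Gx z + μ • z := by
    rw [hG, sub_apply, mul_apply_eq_comp, smul_apply, hz]
    abel
  rw [e2, inner_add_right, inner_smul_right, real_inner_self_eq_norm_sq]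
  have b1 : inner ℝ z (Gx z) ≤ -μ / 4 * ‖z‖ ^ 2 := by
    refine (real_inner_le_norm _ _).trans ?_
    have := Gx.le_of_opNorm_le hx1.le z
    nlinarith [norm_nonneg z]
  have b2 : fderiv ℝ (lam j) (U₀ x) (U₁ x) ≤ -μ / 2 := (Real.le_norm_self _).trans hx2.le
  nlinarith [sq_nonneg ‖z‖]

theorem ProfileJet.mem_jet (hp : ProfileJet K a q U₀ U₁ U₂ U₃ um up Cp) (x : ℝ) :
    (U₀ x, U₁ x) ∈ K ×ˢ Metric.closedBall (0 : E) Cp :=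
  ⟨hp.mem x, by simpa using hp.bound₁ x⟩

variable [FiniteDimensional ℝ E]

theorem ProfileJet.isCompact_jet (hp : ProfileJet K a q U₀ U₁ U₂ U₃ um up Cp) :
    IsCompact (K ×ˢ Metric.closedBall (0 : E) Cp) :=
  hp.isCompact.prod (isCompact_closedBall 0 Cp)

/-- One number `M` plays three roles: radius of the interval without a sign, bound on that interval,
and reciprocal of the damping rate outside it. Enlarging `M` weakens the inequality, so the finitely
many fields can share it. -/
theorem exists_diagonal_bound (hs : SpectralSetting O a q lam P)
    (hp : ProfileJet K a q U₀ U₁ U₂ U₃ um up Cp) (hKO : K ⊆ O)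
    (hm : ∀ j, ∃ μ : ℝ, μ < 0 ∧ P j um * fderiv ℝ q um * P j um = μ • P j um)
    (hpl : ∀ j, ∃ μ : ℝ, μ < 0 ∧ P j up * fderiv ℝ q up * P j up = μ • P j up) :
    ∃ M : ℝ, 0 < M ∧ ∀ j x z, P j (U₀ x) z = z → fderiv ℝ (lam j) (U₀ x) (U₁ x) * ‖z‖ ^ 2
      + 2 * inner ℝ z (coupling a q lam P j (U₀ x) (U₁ x) z)
        ≤ (if |x| ≤ M then M else -M⁻¹) * ‖z‖ ^ 2 := by
  have key : ∀ j, ∃ M : ℝ, 0 < M ∧ ∀ x z, P j (U₀ x) z = z →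
      fderiv ℝ (lam j) (U₀ x) (U₁ x) * ‖z‖ ^ 2
      + 2 * inner ℝ z (coupling a q lam P j (U₀ x) (U₁ x) z)
        ≤ (if |x| ≤ M then M else -M⁻¹) * ‖z‖ ^ 2 := fun j => by
    obtain ⟨μ, hμ, hμQ⟩ := hm j
    obtain ⟨ν, hν, hνQ⟩ := hpl j
    obtain ⟨R₁, hR₁⟩ := eventually_atBot.1 (eventually_diagonal_le hs (hKO hp.mem_minus)
      hp.tendsto_minus hp.tendsto_deriv_minus j hμ hμQ)
    obtain ⟨R₂, hR₂⟩ := eventually_atTop.1 (eventually_diagonal_le hs (hKO hp.mem_plus)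
      hp.tendsto_plus hp.tendsto_deriv_plus j hν hνQ)
    have hO2 : IsOpen (O ×ˢ (univ : Set E)) := hs.isOpen.prod isOpen_univ
    have hsub : K ×ˢ Metric.closedBall (0 : E) Cp ⊆ O ×ˢ univ := prod_mono hKO (subset_univ _)
    obtain ⟨C₁, ε₁, hC₁, hε₁, hb₁⟩ := exists_lipschitz_near_compact hO2
      (f := fun z : E × E => coupling a q lam P j z.1 z.2)
      (fun z hz => ((contDiffAt_coupling hs contDiffAt_fst contDiffAt_snd hz.1 j).of_le
        (by simp)).contDiffWithinAt) hp.isCompact_jet hsub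
    obtain ⟨C₂, ε₂, hC₂, hε₂, hb₂⟩ := exists_lipschitz_near_compact hO2
      (f := fun z : E × E => fderiv ℝ (lam j) z.1 z.2)
      (fun z hz => (((((hs.smooth_lam j).fderiv_infty hs.isOpen).contDiffAt_comp hs.isOpen
        contDiffAt_fst hz.1).clm_apply contDiffAt_snd).of_le
        (by simp)).contDiffWithinAt) hp.isCompact_jet hsub
    have hμ' : 0 < -μ⁻¹ := by simpa using hμ
    have hν' : 0 < -ν⁻¹ := by simpa using hν
    -- The summands dominate the two radii, the bound `C₂ + 2 C₁` of the form on the interval, and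
    -- the reciprocals of the rates `|μ|`, `|ν|` at the two ends.
    refine ⟨|R₁| + |R₂| + 1 + (C₂ + 2 * C₁) + -μ⁻¹ + -ν⁻¹, by positivity, fun x z hz => ?_⟩
    set M := |R₁| + |R₂| + 1 + (C₂ + 2 * C₁) + -μ⁻¹ + -ν⁻¹ with hM
    have hMpos : 0 < M := by positivity
    split_ifs with hx
    · obtain ⟨-, -, h3⟩ := hb₁ _ (hp.mem_jet x) (U₀ x, U₁ x) (by simpa using hε₁.le)
      obtain ⟨-, -, h4⟩ := hb₂ _ (hp.mem_jet x) (U₀ x, U₁ x) (by simpa using hε₂.le)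
      have b1 : inner ℝ z (coupling a q lam P j (U₀ x) (U₁ x) z) ≤ C₁ * ‖z‖ ^ 2 := by
        refine (real_inner_le_norm _ _).trans ?_
        have := ContinuousLinearMap.le_of_opNorm_le _ h3 z
        nlinarith [norm_nonneg z]
      have b2 : fderiv ℝ (lam j) (U₀ x) (U₁ x) ≤ C₂ := (Real.le_norm_self _).trans h4
      have b3 : C₂ + 2 * C₁ ≤ M := by
        rw [hM]; have := abs_nonneg R₁; have := abs_nonneg R₂; linarith
      nlinarith [sq_nonneg ‖z‖]
    · rw [not_le] at hx
      have hfin : ∀ {s : ℝ}, s < 0 → -s⁻¹ ≤ M → s ≤ -M⁻¹ := fun {s} h1 h2 => by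
        have h3 : M⁻¹ ≤ (-s⁻¹)⁻¹ := inv_anti₀ (by simpa using h1) h2
        rw [inv_neg, inv_inv] at h3
        linarith
      have a1 := abs_nonneg R₁
      have a2 := abs_nonneg R₂
      rcases lt_abs.1 hx with h | h
      · refine (hR₂ x ?_ z hz).trans ?_
        · have := le_abs_self R₂; linarith
        · gcongr
          exact hfin hν (by linarith)
      · refine (hR₁ x ?_ z hz).trans ?_
        · have := neg_abs_le R₁; linarith
        · gcongr
          exact hfin hμ (by linarith)
  choose M hM hMb using key
  refine ⟨1 + ∑ j, M j, by have := Finset.sum_nonneg fun j (_ : j ∈ Finset.univ) => (hM j).le; linarith,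
    fun j x z hz => (hMb j x z hz).trans ?_⟩
  have hle : M j ≤ 1 + ∑ j, M j := by
    have := Finset.single_le_sum (fun j _ => (hM j).le) (Finset.mem_univ j)
    linarith
  have hpos : 0 < 1 + ∑ j, M j := (hM j).trans_le hle
  refine mul_le_mul_of_nonneg_right ?_ (sq_nonneg _)
  split_ifs with h1 h2 h2
  · exact hle
  · exact absurd (h1.trans hle) h2
  · have := inv_pos.2 (hM j); linarith
  · exact neg_le_neg (inv_anti₀ (hM j) hle)

end Damping

/-! ### Bounds and Lipschitz estimates near the profile. -/

section JetBounds

variable {E : Type*} [NormedAddCommGroup E] [InnerProductSpace ℝ E]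
  {κ : Type*} [Fintype κ] [DecidableEq κ] {O K : Set E} {a : E → E →L[ℝ] E} {q : E → E}
  {lam : κ → E → ℝ} {P : κ → E → E →L[ℝ] E} {U₀ U₁ U₂ U₃ : ℝ → E} {um up : E} {Cp : ℝ}

/-- The normal form along the profile. -/
noncomputable def profileForm (a : E → E →L[ℝ] E) (q : E → E) (lam : κ → E → ℝ)
    (P : κ → E → E →L[ℝ] E) (U₀ U₁ : ℝ → E) (x : ℝ) : E →L[ℝ] E :=
  normalForm a q lam P (U₀ x) (U₁ x)

/-- The derivative of the normal form along the profile. -/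
noncomputable def profileFormDeriv (a : E → E →L[ℝ] E) (q : E → E) (lam : κ → E → ℝ)
    (P : κ → E → E →L[ℝ] E) (U₀ U₁ U₂ : ℝ → E) (x : ℝ) : E →L[ℝ] E :=
  fderiv ℝ (fun z : E × E => normalForm a q lam P z.1 z.2) (U₀ x, U₁ x) (U₁ x, U₂ x)

theorem contDiffOn_normalForm (hs : SpectralSetting O a q lam P) :
    ContDiffOn ℝ ∞ (fun z : E × E => normalForm a q lam P z.1 z.2) (O ×ˢ univ) := fun _ hz =>
  (contDiffAt_normalForm hs contDiffAt_fst contDiffAt_snd hz.1).contDiffWithinAt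

theorem hasDerivAt_profileForm (hs : SpectralSetting O a q lam P)
    (hp : ProfileJet K a q U₀ U₁ U₂ U₃ um up Cp) (hKO : K ⊆ O) (x : ℝ) :
    HasDerivAt (profileForm a q lam P U₀ U₁) (profileFormDeriv a q lam P U₀ U₁ U₂ x) x :=
  have key : ∀ G : E × E → E →L[ℝ] E, ContDiffOn ℝ ∞ G (O ×ˢ univ) →
      HasDerivAt (fun y => G (U₀ y, U₁ y)) (fderiv ℝ G (U₀ x, U₁ x) (U₁ x, U₂ x)) x := fun _ hG =>
    HasFDerivAt.comp_hasDerivAt (f := fun y => (U₀ y, U₁ y)) x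
      (hG.hasFDerivAt_of_isOpen (hs.isOpen.prod isOpen_univ) ⟨hKO (hp.mem x), mem_univ _⟩)
      ((hp.deriv₀ x).prodMk (hp.deriv₁ x))
  key _ (contDiffOn_normalForm hs)

theorem continuous_profileFormDeriv (hs : SpectralSetting O a q lam P)
    (hp : ProfileJet K a q U₀ U₁ U₂ U₃ um up Cp) (hKO : K ⊆ O) :
    Continuous (profileFormDeriv a q lam P U₀ U₁ U₂) := by
  have hO2 : IsOpen (O ×ˢ (univ : Set E)) := hs.isOpen.prod isOpen_univ
  have c0 : Continuous U₀ := continuous_iff_continuousAt.2 fun x => (hp.deriv₀ x).continuousAt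
  have c1 : Continuous U₁ := continuous_iff_continuousAt.2 fun x => (hp.deriv₁ x).continuousAt
  have c2 : Continuous U₂ := continuous_iff_continuousAt.2 fun x => (hp.deriv₂ x).continuousAt
  have h : Continuous fun x =>
      fderiv ℝ (fun z : E × E => normalForm a q lam P z.1 z.2) (U₀ x, U₁ x) :=
    ((contDiffOn_normalForm hs).fderiv_infty hO2).continuousOn.comp_continuous
      (c0.prodMk c1) (fun x => ⟨hKO (hp.mem x), mem_univ _⟩)
  exact h.clm_apply (c1.prodMk c2)

/-- The smallness and boundedness of the coefficients near the profile. -/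
structure NearProfile (O : Set E) (a : E → E →L[ℝ] E) (q : E → E) (lam : κ → E → ℝ)
    (P : κ → E → E →L[ℝ] E) (U₀ U₁ U₂ U₃ : ℝ → E) (C : ℝ) (x : ℝ) (U v : E) (d : ℝ) : Prop where
  mem : U₀ x + U ∈ O
  proj_sub : ∀ j, ‖P j (U₀ x + U) - P j (U₀ x)‖ ≤ C * (‖U‖ + ‖v‖ + |d|)
  proj_le : ∀ j, ‖P j (U₀ x + U)‖ ≤ C
  proj_le' : ∀ j, ‖P j (U₀ x)‖ ≤ C
  lam_sub : ∀ j, |lam j (U₀ x + U) - lam j (U₀ x)| ≤ C * (‖U‖ + ‖v‖ + |d|)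
  lam_le : ∀ j, |lam j (U₀ x + U)| ≤ C
  lam_le' : ∀ j, |lam j (U₀ x)| ≤ C
  dlam_sub : ∀ j, |fderiv ℝ (lam j) (U₀ x + U) (U₁ x + v) - fderiv ℝ (lam j) (U₀ x) (U₁ x)|
    ≤ C * (‖U‖ + ‖v‖ + |d|)
  dlam_le : ∀ j, |fderiv ℝ (lam j) (U₀ x + U) (U₁ x + v)| ≤ C
  dlam_le' : ∀ j, |fderiv ℝ (lam j) (U₀ x) (U₁ x)| ≤ C
  op_sub : ∀ j, ‖fieldOp a q lam P j (U₀ x) (U₁ x) (U₀ x + U) (U₁ x + v) d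
    - fieldOp a q lam P j (U₀ x) (U₁ x) (U₀ x) (U₁ x) 0‖ ≤ C * (‖U‖ + ‖v‖ + |d|)
  op_le' : ∀ j, ‖fieldOp a q lam P j (U₀ x) (U₁ x) (U₀ x) (U₁ x) 0‖ ≤ C
  res₀_le : ‖residual₀ a q (U₀ x + U) (U₁ x + v)‖ ≤ C * (‖U‖ + ‖v‖)
  res₁_le : ‖residual₁ a q (U₀ x + U) (U₁ x + v) (U₂ x)‖ ≤ C * (‖U‖ + ‖v‖)
  res₂_le : ‖residual₂ a q (U₀ x + U) (U₁ x + v) (U₂ x) (U₃ x)‖ ≤ C * (‖U‖ + ‖v‖)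
  lin_le : ‖linPart a q (U₀ x + U) (U₁ x + v)‖ ≤ C
  a_le : ‖a (U₀ x + U)‖ ≤ C
  form_le : ‖profileForm a q lam P U₀ U₁ x‖ ≤ C
  formDeriv_le : ‖profileFormDeriv a q lam P U₀ U₁ U₂ x‖ ≤ C

variable [FiniteDimensional ℝ E]

/-- Smooth functions of the jets of the profile and of a perturbed state are bounded and Lipschitz
in the perturbation. -/
theorem eventually_jet_lipschitz (hO : IsOpen O)
    (hp : ProfileJet K a q U₀ U₁ U₂ U₃ um up Cp) (hKO : K ⊆ O) {Y : Type*} [NormedAddCommGroup Y]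
    [NormedSpace ℝ Y] (F : E → E → E → E → E → E → ℝ → Y)
    (hF : ∀ z : E × E × E × E × E × E × ℝ, z.1 ∈ O → z.2.2.2.2.1 ∈ O → ContDiffAt ℝ ∞
      (fun z : E × E × E × E × E × E × ℝ =>
        F z.1 z.2.1 z.2.2.1 z.2.2.2.1 z.2.2.2.2.1 z.2.2.2.2.2.1 z.2.2.2.2.2.2) z) :
    ∀ᶠ C in (atTop : Filter ℝ), ∀ᶠ ε in 𝓝[>] (0 : ℝ), ∀ (x : ℝ) (U v : E) (d : ℝ), ‖U‖ ≤ ε →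
      ‖v‖ ≤ ε → |d| ≤ ε → U₀ x + U ∈ O ∧
      ‖F (U₀ x) (U₁ x) (U₂ x) (U₃ x) (U₀ x + U) (U₁ x + v) d
        - F (U₀ x) (U₁ x) (U₂ x) (U₃ x) (U₀ x) (U₁ x) 0‖ ≤ C * (‖U‖ + ‖v‖ + |d|) ∧
      ‖F (U₀ x) (U₁ x) (U₂ x) (U₃ x) (U₀ x + U) (U₁ x + v) d‖ ≤ C := by
  let B := Metric.closedBall (0 : E) Cp
  have hB : IsCompact B := isCompact_closedBall 0 Cp
  let Op : Set (E × E × E × E × E × E × ℝ) := {z | z.1 ∈ O ∧ z.2.2.2.2.1 ∈ O}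
  have hOp : IsOpen Op := (hO.preimage (by fun_prop : Continuous fun z : E × E × E × E × E × E × ℝ =>
    z.1)).inter (hO.preimage (by fun_prop : Continuous fun z : E × E × E × E × E × E × ℝ =>
      z.2.2.2.2.1))
  obtain ⟨C₀, ε₀, hC₀, hε₀, h⟩ := exists_lipschitz_near_compact hOp
    (f := fun z : E × E × E × E × E × E × ℝ =>
        F z.1 z.2.1 z.2.2.1 z.2.2.2.1 z.2.2.2.2.1 z.2.2.2.2.2.1 z.2.2.2.2.2.2)
    (fun z hz => ((hF z hz.1 hz.2).of_le (by simp)).contDiffWithinAt)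
    (hp.isCompact.prod (hB.prod (hB.prod (hB.prod (hp.isCompact.prod (hB.prod
      (isCompact_singleton (x := (0 : ℝ)))))))))
    (fun z hz => ⟨hKO hz.1, hKO hz.2.2.2.2.1⟩)
  filter_upwards [eventually_ge_atTop C₀] with C hC
  filter_upwards [Ioc_mem_nhdsGT hε₀] with ε hε x U v d hU hv hd
  have e1 : ((U₀ x, U₁ x, U₂ x, U₃ x, U₀ x + U, U₁ x + v, d) : E × E × E × E × E × E × ℝ)
      - (U₀ x, U₁ x, U₂ x, U₃ x, U₀ x, U₁ x, 0) = (0, 0, 0, 0, U, v, d) := by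
    simp
  have e2 : ‖((0, 0, 0, 0, U, v, d) : E × E × E × E × E × E × ℝ)‖ ≤ ‖U‖ + ‖v‖ + |d| := by
    have := norm_nonneg U
    have := norm_nonneg v
    have := abs_nonneg d
    simp only [Prod.norm_def, norm_zero, Real.norm_eq_abs]
    refine max_le (by positivity) (max_le (by positivity) (max_le (by positivity)
      (max_le (by positivity) (max_le (by linarith) (max_le (by linarith) (by linarith))))))
  have e3 : ‖((0, 0, 0, 0, U, v, d) : E × E × E × E × E × E × ℝ)‖ ≤ ε₀ := by
    simp only [Prod.norm_def, norm_zero, Real.norm_eq_abs]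
    have := hε.2
    refine max_le hε₀.le (max_le hε₀.le (max_le hε₀.le
      (max_le hε₀.le (max_le (by linarith) (max_le (by linarith) (by linarith))))))
  have hm : ∀ {w : E}, ‖w‖ ≤ Cp → w ∈ B := fun hw => by simpa [B] using hw
  obtain ⟨h1, h2, h3⟩ := h (U₀ x, U₁ x, U₂ x, U₃ x, U₀ x, U₁ x, 0)
    ⟨hp.mem x, hm (hp.bound₁ x), hm (hp.bound₂ x), hm (hp.bound₃ x), hp.mem x, hm (hp.bound₁ x),
      rfl⟩ (U₀ x, U₁ x, U₂ x, U₃ x, U₀ x + U, U₁ x + v, d) (by rw [e1]; exact e3)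
  rw [e1] at h2
  refine ⟨h1.2, h2.trans ?_, h3.trans hC⟩
  exact mul_le_mul hC e2 (norm_nonneg _) (hC₀.le.trans hC)

/-- Each bound holds for all large `C` and then for all small `ε`, so the list is an intersection of
eventual statements. For the residuals the Lipschitz estimate is used at speed zero, where the
reference value vanishes; their bounds therefore do not involve `d`. -/
theorem eventually_nearProfile (hs : SpectralSetting O a q lam P)
    (hp : ProfileJet K a q U₀ U₁ U₂ U₃ um up Cp) (hKO : K ⊆ O) :
    ∀ᶠ C in (atTop : Filter ℝ), ∀ᶠ ε in 𝓝[>] (0 : ℝ), ∀ (x : ℝ) (U v : E) (d : ℝ), ‖U‖ ≤ ε →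
      ‖v‖ ≤ ε → |d| ≤ ε → NearProfile O a q lam P U₀ U₁ U₂ U₃ C x U v d := by
  have L := fun {Y : Type _} [NormedAddCommGroup Y] [NormedSpace ℝ Y]
    (F : E → E → E → E → E → E → ℝ → Y) hF => eventually_jet_lipschitz hs.isOpen hp hKO F hF
  have L' := fun (F : E → E → E → E → E → E → ℝ → ℝ) hF =>
    eventually_jet_lipschitz hs.isOpen hp hKO F hF
  have hu : ∀ z : E × E × E × E × E × E × ℝ, ContDiffAt ℝ ∞
      (fun z : E × E × E × E × E × E × ℝ => z.2.2.2.2.1) z := fun z => by fun_prop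
  have hpp : ∀ z : E × E × E × E × E × E × ℝ, ContDiffAt ℝ ∞
      (fun z : E × E × E × E × E × E × ℝ => z.2.2.2.2.2.1) z := fun z => by fun_prop
  have hd : ∀ z : E × E × E × E × E × E × ℝ, ContDiffAt ℝ ∞
      (fun z : E × E × E × E × E × E × ℝ => z.2.2.2.2.2.2) z := fun z => by fun_prop
  have hu₀ : ∀ z : E × E × E × E × E × E × ℝ, ContDiffAt ℝ ∞
      (fun z : E × E × E × E × E × E × ℝ => z.1) z := fun z => by fun_prop
  have hp₀ : ∀ z : E × E × E × E × E × E × ℝ, ContDiffAt ℝ ∞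
      (fun z : E × E × E × E × E × E × ℝ => z.2.1) z := fun z => by fun_prop
  have hp₂ : ∀ z : E × E × E × E × E × E × ℝ, ContDiffAt ℝ ∞
      (fun z : E × E × E × E × E × E × ℝ => z.2.2.1) z := fun z => by fun_prop
  have hp₃ : ∀ z : E × E × E × E × E × E × ℝ, ContDiffAt ℝ ∞
      (fun z : E × E × E × E × E × E × ℝ => z.2.2.2.1) z := fun z => by fun_prop
  have b1 := eventually_all.2 fun j => L (fun _ _ _ _ u _ _ => P j u) fun z _ h =>
    (hs.smooth_P j).contDiffAt_comp hs.isOpen (hu z) h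
  have b2 := eventually_all.2 fun j => L' (fun _ _ _ _ u _ _ => lam j u) fun z _ h =>
    (hs.smooth_lam j).contDiffAt_comp hs.isOpen (hu z) h
  have b3 := eventually_all.2 fun j => L' (fun _ _ _ _ u p _ => fderiv ℝ (lam j) u p) fun z _ h =>
    (((hs.smooth_lam j).fderiv_infty hs.isOpen).contDiffAt_comp hs.isOpen (hu z) h).clm_apply (hpp z)
  have b4 := eventually_all.2 fun j => L (fun u₀ p₀ _ _ u p d => fieldOp a q lam P j u₀ p₀ u p d)
    fun z h₀ h => contDiffAt_fieldOp hs (hu₀ z) (hp₀ z) (hu z) (hpp z) (hd z) h₀ h j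
  have b5 := eventually_jet_lipschitz hs.isOpen hp hKO (fun _ _ _ _ u p _ => residual₀ a q u p)
    fun z _ h => contDiffAt_residual₀ hs (hu z) (hpp z) h
  have b6 := eventually_jet_lipschitz hs.isOpen hp hKO
    (fun _ _ p₂ _ u p _ => residual₁ a q u p p₂)
    fun z _ h => contDiffAt_residual₁ hs (hu z) (hpp z) (hp₂ z) h
  have b7 := eventually_jet_lipschitz hs.isOpen hp hKO
    (fun _ _ p₂ p₃ u p _ => residual₂ a q u p p₂ p₃)
    fun z _ h => contDiffAt_residual₂ hs (hu z) (hpp z) (hp₂ z) (hp₃ z) h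
  have b8 := L (fun _ _ _ _ u p _ => linPart a q u p)
    fun z _ h => contDiffAt_linPart hs (hu z) (hpp z) h
  have b9 := L (fun _ _ _ _ u _ _ => a u)
    fun z _ h => hs.smooth_a.contDiffAt_comp hs.isOpen (hu z) h
  have b10 := L (fun u₀ p₀ _ _ _ _ _ => normalForm a q lam P u₀ p₀)
    fun z h _ => contDiffAt_normalForm hs (hu₀ z) (hp₀ z) h
  have hO2 : IsOpen (O ×ˢ (univ : Set E)) := hs.isOpen.prod isOpen_univ
  have b11 := L (fun u₀ p₀ p₂ _ _ _ _ =>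
      fderiv ℝ (fun z : E × E => normalForm a q lam P z.1 z.2) (u₀, p₀) (p₀, p₂))
    fun z h _ => (((contDiffOn_normalForm hs).fderiv_infty hO2).contDiffAt_comp hO2
      ((hu₀ z).prodMk (hp₀ z)) ⟨h, mem_univ _⟩).clm_apply ((hp₀ z).prodMk (hp₂ z))
  filter_upwards [b1, b2, b3, b4, b5, b6, b7, b8, b9, b10, b11]
    with C c1 c2 c3 c4 c5 c6 c7 c8 c9 c10 c11
  filter_upwards [eventually_all.2 c1, eventually_all.2 c2, eventually_all.2 c3,
    eventually_all.2 c4, c5, c6, c7, c8, c9, c10, c11, self_mem_nhdsWithin] with ε c1 c2 c3 c4 c5 c6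
      c7 c8 c9 c10 c11 hε x U v d hU hv hd
  have hε0 : (0 : ℝ) ≤ ε := (mem_Ioi.1 hε).le
  have z1 : ‖(0 : E)‖ ≤ ε := by simpa using hε0
  have z2 : |(0 : ℝ)| ≤ ε := by simpa using hε0
  refine ⟨(c9 x U v d hU hv hd).1, fun j => (c1 j x U v d hU hv hd).2.1,
    fun j => (c1 j x U v d hU hv hd).2.2, fun j => by simpa using (c1 j x 0 0 0 z1 z1 z2).2.2,
    fun j => (c2 j x U v d hU hv hd).2.1, fun j => (c2 j x U v d hU hv hd).2.2,
    fun j => by simpa using (c2 j x 0 0 0 z1 z1 z2).2.2,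
    fun j => (c3 j x U v d hU hv hd).2.1, fun j => (c3 j x U v d hU hv hd).2.2,
    fun j => by simpa using (c3 j x 0 0 0 z1 z1 z2).2.2,
    fun j => (c4 j x U v d hU hv hd).2.1,
    fun j => by simpa using (c4 j x 0 0 0 z1 z1 z2).2.2, ?_, ?_, ?_, (c8 x U v d hU hv hd).2.2,
    (c9 x U v d hU hv hd).2.2, (c10 x U v d hU hv hd).2.2, (c11 x U v d hU hv hd).2.2⟩
  · have := (c5 x U v 0 hU hv z2).2.1
    rwa [residual₀_profile hp, sub_zero, abs_zero, add_zero] at this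
  · have := (c6 x U v 0 hU hv z2).2.1
    rwa [residual₁_profile hs hp hKO, sub_zero, abs_zero, add_zero] at this
  · have := (c7 x U v 0 hU hv z2).2.1
    rwa [residual₂_profile hs hp hKO, sub_zero, abs_zero, add_zero] at this

end JetBounds

/-! ### The damping inequality for the energy density. -/

section Damping

variable {E : Type*} [NormedAddCommGroup E] [InnerProductSpace ℝ E]
  {κ : Type*} [Fintype κ] [DecidableEq κ] {O K : Set E} {a : E → E →L[ℝ] E} {q : E → E}
  {lam : κ → E → ℝ} {P : κ → E → E →L[ℝ] E} {U₀ U₁ U₂ U₃ : ℝ → E} {um up : E} {Cp : ℝ}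

/-- Perturbation of the energy density of one characteristic field. -/
theorem field_density_le {C η θ ρ ρ' l l₀ μ μ₀ d : ℝ} {y Y Y₀ g : E} {F F₀ : E →L[ℝ] E}
    (hC : 1 ≤ C) (hθ : |θ| ≤ C) (hρ : |ρ| ≤ C) (hρ' : |ρ'| ≤ C) (hl : |l - l₀| ≤ C * η)
    (hl₀ : |l₀| ≤ C) (hμ : |μ - μ₀| ≤ C * η) (hμ₀ : |μ₀| ≤ C) (hd : |d| ≤ η)
    (hY : ‖Y‖ ≤ C * ‖y‖) (hY₀ : ‖Y₀‖ ≤ C * ‖y‖) (hYY : ‖Y - Y₀‖ ≤ C * η * ‖y‖)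
    (hF : ‖F - F₀‖ ≤ C * η) (hF₀ : ‖F₀‖ ≤ C) :
    (θ * ρ + (ρ' * (l - d) + ρ * μ)) * ‖Y‖ ^ 2 + 2 * ρ * inner ℝ Y (F y + g)
      ≤ ((θ * ρ + (ρ' * l₀ + ρ * μ₀)) * ‖Y₀‖ ^ 2 + 2 * ρ * inner ℝ Y₀ (F₀ y))
        + 13 * C ^ 4 * η * ‖y‖ ^ 2 + 2 * C ^ 2 * ‖y‖ * ‖g‖ := by
  have hC0 : 0 ≤ C := zero_le_one.trans hC
  have hη : 0 ≤ η := (abs_nonneg d).trans hd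
  have hn := norm_nonneg y
  set k := θ * ρ + (ρ' * (l - d) + ρ * μ) with hk
  set k₀ := θ * ρ + (ρ' * l₀ + ρ * μ₀) with hk₀
  have hCη : η ≤ C * η := le_mul_of_one_le_left hη hC
  have b1 : |k - k₀| ≤ 3 * C ^ 2 * η := by
    have e : k - k₀ = ρ' * ((l - l₀) - d) + ρ * (μ - μ₀) := by rw [hk, hk₀]; ring
    rw [e]
    calc |ρ' * ((l - l₀) - d) + ρ * (μ - μ₀)| ≤ |ρ'| * (|l - l₀| + |d|) + |ρ| * |μ - μ₀| := by
          refine (abs_add_le _ _).trans ?_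
          rw [abs_mul, abs_mul]
          gcongr
          exact abs_sub _ _
      _ ≤ C * (C * η + C * η) + C * (C * η) := by gcongr; exact hd.trans hCη
      _ = 3 * C ^ 2 * η := by ring
  have b2 : |k₀| ≤ 3 * C ^ 2 := by
    calc |k₀| ≤ |θ| * |ρ| + (|ρ'| * |l₀| + |ρ| * |μ₀|) := by
          rw [hk₀, ← abs_mul, ← abs_mul, ← abs_mul]
          exact (abs_add_le _ _).trans (by gcongr; exact abs_add_le _ _)
      _ ≤ C * C + (C * C + C * C) := by gcongr
      _ = 3 * C ^ 2 := by ring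
  have b3 : k * ‖Y‖ ^ 2 - k₀ * ‖Y₀‖ ^ 2 ≤ 9 * C ^ 4 * η * ‖y‖ ^ 2 := by
    have e : k * ‖Y‖ ^ 2 - k₀ * ‖Y₀‖ ^ 2
        = (k - k₀) * ‖Y‖ ^ 2 + k₀ * ((‖Y‖ - ‖Y₀‖) * (‖Y‖ + ‖Y₀‖)) := by ring
    rw [e]
    calc (k - k₀) * ‖Y‖ ^ 2 + k₀ * ((‖Y‖ - ‖Y₀‖) * (‖Y‖ + ‖Y₀‖))
        ≤ |k - k₀| * ‖Y‖ ^ 2 + |k₀| * (‖Y - Y₀‖ * (‖Y‖ + ‖Y₀‖)) := by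
          refine add_le_add (by gcongr; exact le_abs_self _) ?_
          refine (le_abs_self _).trans ?_
          rw [abs_mul, abs_mul, abs_of_nonneg (by positivity : 0 ≤ ‖Y‖ + ‖Y₀‖)]
          gcongr
          exact abs_norm_sub_norm_le _ _
      _ ≤ 3 * C ^ 2 * η * (C * ‖y‖) ^ 2
          + 3 * C ^ 2 * (C * η * ‖y‖ * (C * ‖y‖ + C * ‖y‖)) := by gcongr
      _ = 9 * C ^ 4 * η * ‖y‖ ^ 2 := by ring
  have b4 : |inner ℝ Y (F y + g) - inner ℝ Y₀ (F₀ y)| ≤ 2 * C ^ 2 * η * ‖y‖ ^ 2 + C * ‖y‖ * ‖g‖ := by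
    have e : inner ℝ Y (F y + g) - inner ℝ Y₀ (F₀ y)
        = inner ℝ (Y - Y₀) (F₀ y) + inner ℝ Y ((F - F₀) y) + inner ℝ Y g := by
      rw [sub_apply, inner_sub_left, inner_sub_right, inner_add_right]
      ring
    rw [e]
    calc |inner ℝ (Y - Y₀) (F₀ y) + inner ℝ Y ((F - F₀) y) + inner ℝ Y g|
        ≤ ‖Y - Y₀‖ * ‖F₀ y‖ + ‖Y‖ * ‖(F - F₀) y‖ + ‖Y‖ * ‖g‖ := by
          refine (abs_add_three _ _ _).trans ?_
          gcongr <;> exact abs_real_inner_le_norm _ _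
      _ ≤ C * η * ‖y‖ * (C * ‖y‖) + C * ‖y‖ * (C * η * ‖y‖) + C * ‖y‖ * ‖g‖ := by
          gcongr
          · exact F₀.le_of_opNorm_le hF₀ y
          · exact (F - F₀).le_of_opNorm_le hF y
      _ = 2 * C ^ 2 * η * ‖y‖ ^ 2 + C * ‖y‖ * ‖g‖ := by ring
  have b5 : ρ * (inner ℝ Y (F y + g) - inner ℝ Y₀ (F₀ y))
      ≤ C * (2 * C ^ 2 * η * ‖y‖ ^ 2 + C * ‖y‖ * ‖g‖) := by
    refine (le_abs_self _).trans ?_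
    rw [abs_mul]
    gcongr
  -- The factor 13 is 9 from the quadratic term plus 4 from the operator terms, the latter of order
  -- `C³` and raised to `C⁴` by `1 ≤ C`.
  have b6 : 4 * C ^ 3 * η * ‖y‖ ^ 2 ≤ 4 * C ^ 4 * η * ‖y‖ ^ 2 := by
    gcongr ?_ * η * ‖y‖ ^ 2
    gcongr 4 * ?_
    exact pow_le_pow_right₀ hC (by norm_num)
  linarith [b3, b5, b6]

theorem NearProfile.mono {C C' x d : ℝ} {U v : E}
    (h : NearProfile O a q lam P U₀ U₁ U₂ U₃ C x U v d) (hC : C ≤ C') :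
    NearProfile O a q lam P U₀ U₁ U₂ U₃ C' x U v d := by
  have h1 : C * (‖U‖ + ‖v‖ + |d|) ≤ C' * (‖U‖ + ‖v‖ + |d|) := by gcongr
  have h2 : C * (‖U‖ + ‖v‖) ≤ C' * (‖U‖ + ‖v‖) := by gcongr
  exact ⟨h.mem, fun j => (h.proj_sub j).trans h1, fun j => (h.proj_le j).trans hC,
    fun j => (h.proj_le' j).trans hC, fun j => (h.lam_sub j).trans h1,
    fun j => (h.lam_le j).trans hC, fun j => (h.lam_le' j).trans hC,
    fun j => (h.dlam_sub j).trans h1, fun j => (h.dlam_le j).trans hC,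
    fun j => (h.dlam_le' j).trans hC, fun j => (h.op_sub j).trans h1,
    fun j => (h.op_le' j).trans hC, h.res₀_le.trans h2, h.res₁_le.trans h2, h.res₂_le.trans h2,
    h.lin_le.trans hC, h.a_le.trans hC, h.form_le.trans hC, h.formDeriv_le.trans hC⟩

/-- The right-hand side of the equation of the `j`-th characteristic field. -/
noncomputable def fieldSource (a : E → E →L[ℝ] E) (q : E → E) (lam : κ → E → ℝ)
    (P : κ → E → E →L[ℝ] E) (S S' : E →L[ℝ] E) (j : κ) (p₂ p₃ u p v w : E) (d : ℝ) : E :=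
  P j u (residual₂ a q u p p₂ p₃ + d • p₃ + linPart a q u p w
      + S (residual₁ a q u p p₂ + d • p₂ - (a u w - d • w))
      + (a u (S' v + S w) - d • (S' v + S w)))
    + fderiv ℝ (P j) u (residual₀ a q u p + d • p) (w + S v)
    + (lam j u - d) • fderiv ℝ (P j) u p (w + S v)

/-- Replace `w` by `y - S v` with `y = w + S v`. The terms linear in `y` collect into `fieldOp`;
what remains involves only `v`, the residuals and the speed, and contains no second derivative of
the perturbation. -/
theorem fieldSource_eq (u₀ p₀ : E) (S' : E →L[ℝ] E) (j : κ) (p₂ p₃ u p v w : E) (d : ℝ) :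
    fieldSource a q lam P (normalForm a q lam P u₀ p₀) S' j p₂ p₃ u p v w d
      = fieldOp a q lam P j u₀ p₀ u p d (w + normalForm a q lam P u₀ p₀ v)
        + P j u (residual₂ a q u p p₂ p₃ + d • p₃
          + normalForm a q lam P u₀ p₀ (residual₁ a q u p p₂ + d • p₂)
          + (a u (S' v) - d • S' v)
          - (linPart a q u p (normalForm a q lam P u₀ p₀ v)
            + a u (normalForm a q lam P u₀ p₀ (normalForm a q lam P u₀ p₀ v))
            - normalForm a q lam P u₀ p₀ (a u (normalForm a q lam P u₀ p₀ v)))) := by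
  rw [fieldSource, fieldOp]
  generalize normalForm a q lam P u₀ p₀ = S
  simp only [map_add, map_sub, map_smul, add_apply, sub_apply, smul_apply,
    mul_apply_eq_comp, sub_smul, smul_add]
  abel

-- Along the profile, the weight supplies the damping missing on the bounded interval and the
-- diagonal blocks supply it outside, so each field is damped at a uniform rate. Moving to the
-- perturbed state costs a small multiple of `‖y‖²` (`field_density_le`). The source pairs with `y`
-- and is split by Young's inequality. The speed appears on the right only multiplied by derivatives
-- of the profile, which keeps the bound integrable in `x`.
set_option maxHeartbeats 1600000 in
theorem exists_damping [FiniteDimensional ℝ E] (hs : SpectralSetting O a q lam P)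
    (hp : ProfileJet K a q U₀ U₁ U₂ U₃ um up Cp) (hKO : K ⊆ O) {c₀ : ℝ} (hc₀ : 0 < c₀)
    (hlam : ∀ j x, c₀ ≤ |lam j (U₀ x)|)
    (hm : ∀ j, ∃ μ : ℝ, μ < 0 ∧ P j um * fderiv ℝ q um * P j um = μ • P j um)
    (hpl : ∀ j, ∃ μ : ℝ, μ < 0 ∧ P j up * fderiv ℝ q up * P j up = μ • P j up) :
    ∃ (θ : ℝ) (ρ ρ' : κ → ℝ → ℝ) (m c C ε : ℝ), 0 < θ ∧ 0 < m ∧ 0 < c ∧ 0 < C ∧ 0 < ε ∧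
      (∀ j, Continuous (ρ' j)) ∧ (∀ j x, HasDerivAt (ρ j) (ρ' j x) x) ∧ (∀ j x, m ≤ ρ j x) ∧
      (∀ j x, |ρ j x| ≤ C) ∧ (∀ j x, |ρ' j x| ≤ C) ∧
      ∀ (x : ℝ) (U v w : E) (d : ℝ), ‖U‖ ≤ ε → ‖v‖ ≤ ε → |d| ≤ ε →
        NearProfile O a q lam P U₀ U₁ U₂ U₃ C x U v d ∧
        ∑ j, ((θ * ρ j x + (ρ' j x * (lam j (U₀ x + U) - d)
            + ρ j x * fderiv ℝ (lam j) (U₀ x + U) (U₁ x + v)))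
            * ‖P j (U₀ x + U) (w + profileForm a q lam P U₀ U₁ x v)‖ ^ 2
          + 2 * ρ j x * inner ℝ (P j (U₀ x + U) (w + profileForm a q lam P U₀ U₁ x v))
            (fieldSource a q lam P (profileForm a q lam P U₀ U₁ x)
              (profileFormDeriv a q lam P U₀ U₁ U₂ x) j (U₂ x) (U₃ x) (U₀ x + U) (U₁ x + v) v w d))
        ≤ -c * ‖w + profileForm a q lam P U₀ U₁ x v‖ ^ 2
          + C * (‖U‖ ^ 2 + ‖v‖ ^ 2 + d ^ 2 * (‖U₂ x‖ + ‖U₃ x‖) ^ 2) := by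
  obtain ⟨M, hM, hMb⟩ := exists_diagonal_bound hs hp hKO hm hpl
  have hlc : ∀ j, Continuous fun x => lam j (U₀ x) := fun j =>
    (hs.smooth_lam j).continuousOn.comp_continuous
      (continuous_iff_continuousAt.2 fun x => (hp.deriv₀ x).continuousAt) fun x => hKO (hp.mem x)
  choose ρ ρ' β m M' hmpos hρ'c hρ hmρ hρM hρ'M hβ hβ0 hβb using fun j =>
    -- Strength `M + M⁻¹` cancels the possible growth `M` on `|x| ≤ M` and leaves damping `M⁻¹`, the
    -- same rate as outside.
    exists_weight (hlc j) hc₀ (hlam j) M (b := M + M⁻¹) (by positivity)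
  set k := (Fintype.card κ : ℝ) with hk
  have hk0 : 0 ≤ k := by positivity
  obtain ⟨m₀, hm₀, hm₀'⟩ : ∃ m₀ : ℝ, 0 < m₀ ∧ ∀ j, m₀ ≤ m j := by
    have : ∀ᶠ m₀ in 𝓝[>] (0 : ℝ), ∀ j, m₀ ≤ m j := eventually_all.2 fun j => by
      filter_upwards [Ioc_mem_nhdsGT (hmpos j)] with y hy using hy.2
    obtain ⟨y, h1, h2⟩ := (this.and self_mem_nhdsWithin).exists
    exact ⟨y, h2, h1⟩
  -- Half of the damping rate `M⁻¹` is spent on the exponential factor, the other half remains.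
  set θ := M⁻¹ / 2 with hθ
  have hθ0 : 0 < θ := by positivity
  obtain ⟨C, hCn, hC1, hCθ, hCM⟩ := ((eventually_nearProfile hs hp hKO).and
    ((eventually_ge_atTop (1 : ℝ)).and ((eventually_ge_atTop θ).and
      (eventually_all.2 fun j => eventually_ge_atTop (M' j))))).exists
  have hC0 : 0 < C := one_pos.trans_le hC1
  -- The factor `k + 1` comes from recovering `‖y‖²` out of its `k` components by Cauchy–Schwarz;
  -- the added 1 avoids division by zero when there are no fields.
  set c₁ := m₀ * θ / (k + 1) with hc₁
  have hc₁0 : 0 < c₁ := by positivity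
  -- The errors total `13 k C⁴ η ‖y‖²` with `η ≤ 3ε`. This choice keeps them below a quarter of the
  -- damping `c₁`; Young's inequality for the source takes another quarter.
  obtain ⟨ε, hεn, hε, hε1⟩ := (hCn.and ((eventually_mem_nhdsWithin (a := (0 : ℝ)) (s := Ioi 0)).and
    (eventually_mem_set.2 (Ioc_mem_nhdsGT (lt_min one_pos
      (by positivity : 0 < c₁ / 4 / (39 * k * C ^ 4 + 1))))))).exists
  have hε0 : 0 < ε := hε
  set C₂ := (18 * k * C ^ 6) ^ 2 / c₁ * 3 with hC₂
  have hC₂0 : 0 ≤ C₂ := by positivity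
  refine ⟨θ, ρ, ρ', m₀, c₁ / 2, C + C₂, ε, hθ0, hm₀, by positivity, by positivity, hε0, hρ'c, hρ,
    fun j x => (hm₀' j).trans (hmρ j x), fun j x => ?_, fun j x => ?_, ?_⟩
  · rw [abs_of_pos ((hmpos j).trans_le (hmρ j x))]
    linarith [hρM j x, hCM j]
  · linarith [hρ'M j x, hCM j]
  intro x U v w d hU hv hd
  have hn := hεn x U v d hU hv hd
  refine ⟨hn.mono (by linarith), ?_⟩
  set S := profileForm a q lam P U₀ U₁ x with hS
  set S' := profileFormDeriv a q lam P U₀ U₁ U₂ x with hS'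
  set y := w + S v with hy
  set η := ‖U‖ + ‖v‖ + |d| with hη
  -- `η` measures the change of the coefficients and only needs to be small; `s` measures the source
  -- and has to be square integrable in `x`, so here `d` carries the decay of the profile.
  set s := ‖U‖ + ‖v‖ + |d| * (‖U₂ x‖ + ‖U₃ x‖) with hsdef
  have hη0 : 0 ≤ η := by positivity
  have hs0 : 0 ≤ s := by positivity
  have hη3 : η ≤ 3 * ε := by linarith
  have hd1 : |d| ≤ C := hd.trans (hε1.2.trans ((min_le_left _ _).trans hC1))
  have hC01 : 0 ≤ C := hC0.le
  set u := U₀ x + U with hu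
  set p := U₁ x + v with hpdef
  set g : κ → E := fun j => P j u (residual₂ a q u p (U₂ x) (U₃ x) + d • U₃ x
      + S (residual₁ a q u p (U₂ x) + d • U₂ x) + (a u (S' v) - d • S' v)
      - (linPart a q u p (S v) + a u (S (S v)) - S (a u (S v)))) with hg
  have hgs : ∀ j, ‖g j‖ ≤ 9 * C ^ 4 * s := fun j => by
    have e1 : ∀ z, ‖S z‖ ≤ C * ‖z‖ := fun z => S.le_of_opNorm_le hn.form_le z
    have e2 : ∀ z, ‖S' z‖ ≤ C * ‖z‖ := fun z => S'.le_of_opNorm_le hn.formDeriv_le z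
    have e3 : ∀ z, ‖a u z‖ ≤ C * ‖z‖ := fun z => (a u).le_of_opNorm_le hn.a_le z
    have e4 : ∀ z, ‖linPart a q u p z‖ ≤ C * ‖z‖ := fun z =>
      (linPart a q u p).le_of_opNorm_le hn.lin_le z
    have h1 : ‖U‖ + ‖v‖ ≤ s := by rw [hsdef]; linarith [show 0 ≤ |d| * (‖U₂ x‖ + ‖U₃ x‖) by positivity]
    have h2 : |d| * ‖U₂ x‖ ≤ s := by
      have : |d| * ‖U₂ x‖ ≤ |d| * (‖U₂ x‖ + ‖U₃ x‖) := by gcongr; linarith [norm_nonneg (U₃ x)]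
      rw [hsdef]; linarith [norm_nonneg U, norm_nonneg v]
    have h3 : |d| * ‖U₃ x‖ ≤ s := by
      have : |d| * ‖U₃ x‖ ≤ |d| * (‖U₂ x‖ + ‖U₃ x‖) := by gcongr; linarith [norm_nonneg (U₂ x)]
      rw [hsdef]; linarith [norm_nonneg U, norm_nonneg v]
    have h4 : ‖v‖ ≤ s := by linarith [norm_nonneg U]
    have f1 : ‖residual₂ a q u p (U₂ x) (U₃ x) + d • U₃ x‖ ≤ C * s + s := by
      refine (norm_add_le _ _).trans (add_le_add (hn.res₂_le.trans (by gcongr)) ?_)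
      rwa [norm_smul, Real.norm_eq_abs]
    have f2 : ‖S (residual₁ a q u p (U₂ x) + d • U₂ x)‖ ≤ C * (C * s + s) := by
      refine (e1 _).trans (mul_le_mul_of_nonneg_left ?_ hC01)
      refine (norm_add_le _ _).trans (add_le_add (hn.res₁_le.trans (by gcongr)) ?_)
      rwa [norm_smul, Real.norm_eq_abs]
    have f3 : ‖a u (S' v) - d • S' v‖ ≤ C * (C * s) + C * (C * s) := by
      refine (norm_sub_le _ _).trans (add_le_add ((e3 _).trans ?_) ?_)
      · gcongr
        exact (e2 v).trans (by gcongr)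
      · rw [norm_smul, Real.norm_eq_abs]
        gcongr
        exact (e2 v).trans (by gcongr)
    have hSv : ‖S v‖ ≤ C * s := (e1 v).trans (by gcongr)
    have f4 : ‖linPart a q u p (S v) + a u (S (S v)) - S (a u (S v))‖
        ≤ C * (C * s) + C * (C * (C * s)) + C * (C * (C * s)) := by
      refine (norm_sub_le _ _).trans (add_le_add ((norm_add_le _ _).trans (add_le_add
        ((e4 _).trans (by gcongr)) ((e3 _).trans ?_))) ((e1 _).trans ?_))
      · gcongr
        exact (e1 _).trans (by gcongr)
      · gcongr
        exact (e3 _).trans (by gcongr)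
    have f5 := norm_sub_le (residual₂ a q u p (U₂ x) (U₃ x) + d • U₃ x
      + S (residual₁ a q u p (U₂ x) + d • U₂ x) + (a u (S' v) - d • S' v))
      (linPart a q u p (S v) + a u (S (S v)) - S (a u (S v)))
    have f6 := norm_add_le (residual₂ a q u p (U₂ x) (U₃ x) + d • U₃ x
      + S (residual₁ a q u p (U₂ x) + d • U₂ x)) (a u (S' v) - d • S' v)
    have f7 := norm_add_le (residual₂ a q u p (U₂ x) (U₃ x) + d • U₃ x)
      (S (residual₁ a q u p (U₂ x) + d • U₂ x))
    have f8 := (P j u).le_of_opNorm_le (hn.proj_le j) (residual₂ a q u p (U₂ x) (U₃ x) + d • U₃ x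
      + S (residual₁ a q u p (U₂ x) + d • U₂ x) + (a u (S' v) - d • S' v)
      - (linPart a q u p (S v) + a u (S (S v)) - S (a u (S v))))
    have f9 : ‖g j‖ ≤ C * ((C * s + s) + C * (C * s + s) + (C * (C * s) + C * (C * s))
        + (C * (C * s) + C * (C * (C * s)) + C * (C * (C * s)))) := by
      refine f8.trans ?_
      gcongr
      linarith
    have p1 : C ^ 1 ≤ C ^ 4 := pow_le_pow_right₀ hC1 (by norm_num)
    have p2 : C ^ 2 ≤ C ^ 4 := pow_le_pow_right₀ hC1 (by norm_num)
    have p3 : C ^ 3 ≤ C ^ 4 := pow_le_pow_right₀ hC1 (by norm_num)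
    have p1s := mul_le_mul_of_nonneg_right p1 hs0
    have p2s := mul_le_mul_of_nonneg_right p2 hs0
    have p3s := mul_le_mul_of_nonneg_right p3 hs0
    nlinarith
  have hterm : ∀ j, (θ * ρ j x + (ρ' j x * (lam j u - d) + ρ j x * fderiv ℝ (lam j) u p))
        * ‖P j u y‖ ^ 2 + 2 * ρ j x * inner ℝ (P j u y)
          (fieldSource a q lam P S S' j (U₂ x) (U₃ x) u p v w d)
      ≤ -(m₀ * θ) * ‖P j (U₀ x) y‖ ^ 2 + (13 * C ^ 4 * η * ‖y‖ ^ 2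
        + 18 * C ^ 6 * ‖y‖ * s) := fun j => by
    have e : fieldSource a q lam P S S' j (U₂ x) (U₃ x) u p v w d
        = fieldOp a q lam P j (U₀ x) (U₁ x) u p d y + g j :=
      fieldSource_eq (U₀ x) (U₁ x) S' j (U₂ x) (U₃ x) u p v w d
    rw [e]
    have hρ0 : 0 < ρ j x := (hmpos j).trans_le (hmρ j x)
    have h1 := field_density_le (θ := θ) (ρ := ρ j x) (ρ' := ρ' j x) (l := lam j u)
      (l₀ := lam j (U₀ x)) (μ := fderiv ℝ (lam j) u p)
      (μ₀ := fderiv ℝ (lam j) (U₀ x) (U₁ x)) (d := d) (y := y) (Y := P j u y)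
      (Y₀ := P j (U₀ x) y) (g := g j) (F := fieldOp a q lam P j (U₀ x) (U₁ x) u p d)
      (F₀ := fieldOp a q lam P j (U₀ x) (U₁ x) (U₀ x) (U₁ x) 0) hC1
      (by rw [abs_of_pos hθ0]; exact hCθ) (by rw [abs_of_pos hρ0]; exact (hρM j x).trans (hCM j))
      ((hρ'M j x).trans (hCM j)) (hn.lam_sub j) (hn.lam_le' j) (hn.dlam_sub j) (hn.dlam_le' j)
      (by linarith [norm_nonneg U, norm_nonneg v])
      ((P j u).le_of_opNorm_le (hn.proj_le j) y)
      ((P j (U₀ x)).le_of_opNorm_le (hn.proj_le' j) y)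
      (by rw [← sub_apply]; exact (P j u - P j (U₀ x)).le_of_opNorm_le (hn.proj_sub j) y)
      (hn.op_sub j) (hn.op_le' j)
    refine h1.trans ?_
    have hPP : P j (U₀ x) (P j (U₀ x) y) = P j (U₀ x) y := by
      rw [← mul_apply_eq_comp, hs.mul_self _ (hKO (hp.mem x))]
    have h2 := hMb j x _ hPP
    rw [fieldOp_profile hs hp hKO, mul_apply_eq_comp]
    have hw := hβ j x
    have h3 : (if |x| ≤ M then M else -M⁻¹) ≤ β j x - M⁻¹ := by
      split_ifs with h
      · linarith [hβb j x h]
      · linarith [hβ0 j x]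
    set n0 := ‖P j (U₀ x) y‖ ^ 2 with hn0
    have hn00 : 0 ≤ n0 := sq_nonneg _
    have h4 : (θ * ρ j x + (ρ' j x * lam j (U₀ x) + ρ j x * fderiv ℝ (lam j) (U₀ x) (U₁ x))) * n0
        + 2 * ρ j x * inner ℝ (P j (U₀ x) y) (coupling a q lam P j (U₀ x) (U₁ x) (P j (U₀ x) y))
        ≤ -(m₀ * θ) * n0 := by
      have h5 := mul_le_mul_of_nonneg_left (h2.trans (mul_le_mul_of_nonneg_right h3 hn00)) hρ0.le
      have h6 : m₀ * θ * n0 ≤ ρ j x * θ * n0 := by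
        gcongr
        exact (hm₀' j).trans (hmρ j x)
      have h7 : ρ' j x * lam j (U₀ x) = -(β j x * ρ j x) := by rw [mul_comm]; exact hw
      have h8 : M⁻¹ = 2 * θ := by rw [hθ]; ring
      rw [h8] at h5
      rw [h7]
      nlinarith
    have h9 : 2 * C ^ 2 * ‖y‖ * ‖g j‖ ≤ 18 * C ^ 6 * ‖y‖ * s := by
      calc 2 * C ^ 2 * ‖y‖ * ‖g j‖ ≤ 2 * C ^ 2 * ‖y‖ * (9 * C ^ 4 * s) := by gcongr; exact hgs j
        _ = _ := by ring
    linarith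
  refine (Finset.sum_le_sum fun j _ => hterm j).trans ?_
  rw [Finset.sum_add_distrib, ← Finset.mul_sum, Finset.sum_const, nsmul_eq_mul, Finset.card_univ,
    ← hk]
  have hsum : ‖y‖ ^ 2 ≤ (k + 1) * ∑ j, ‖P j (U₀ x) y‖ ^ 2 := by
    have e : y = ∑ j, P j (U₀ x) y := by
      rw [← sum_apply, hs.sum_eq_one _ (hKO (hp.mem x)), one_apply_eq_self]
    have h1 : ‖y‖ ^ 2 ≤ (∑ j, ‖P j (U₀ x) y‖) ^ 2 := by
      conv_lhs => rw [e]
      gcongr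
      exact norm_sum_le _ _
    have h2 : (∑ j, ‖P j (U₀ x) y‖) ^ 2 ≤ k * ∑ j, ‖P j (U₀ x) y‖ ^ 2 := by
      have := sq_sum_le_card_mul_sum_sq (s := Finset.univ) (f := fun j => ‖P j (U₀ x) y‖)
      rwa [Finset.card_univ] at this
    have h3 : 0 ≤ ∑ j, ‖P j (U₀ x) y‖ ^ 2 := Finset.sum_nonneg fun _ _ => sq_nonneg _
    linarith
  have hA : -(m₀ * θ) * ∑ j, ‖P j (U₀ x) y‖ ^ 2 ≤ -c₁ * ‖y‖ ^ 2 := by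
    have h1 : c₁ * ‖y‖ ^ 2 ≤ c₁ * ((k + 1) * ∑ j, ‖P j (U₀ x) y‖ ^ 2) := by gcongr
    have h2 : c₁ * (k + 1) = m₀ * θ := by rw [hc₁]; field_simp
    rw [← mul_assoc, h2] at h1
    linarith
  have hB : k * (13 * C ^ 4 * η * ‖y‖ ^ 2) ≤ c₁ / 4 * ‖y‖ ^ 2 := by
    have h1 : (39 * k * C ^ 4 + 1) * ε ≤ c₁ / 4 := by
      have := hε1.2.trans (min_le_right _ _)
      rwa [le_div_iff₀ (by positivity), mul_comm] at this
    have h2 : k * (13 * C ^ 4 * η) ≤ k * (13 * C ^ 4 * (3 * ε)) := by gcongr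
    have h3 : k * (13 * C ^ 4 * η) ≤ c₁ / 4 := by nlinarith
    calc k * (13 * C ^ 4 * η * ‖y‖ ^ 2) = k * (13 * C ^ 4 * η) * ‖y‖ ^ 2 := by ring
      _ ≤ _ := by gcongr
  have hD : k * (18 * C ^ 6 * ‖y‖ * s) ≤ c₁ / 4 * ‖y‖ ^ 2 + (18 * k * C ^ 6) ^ 2 / c₁ * s ^ 2 := by
    have h1 : 0 ≤ (c₁ / 2 * ‖y‖ - (18 * k * C ^ 6) * s) ^ 2 / c₁ := by positivity
    have h2 : (c₁ / 2 * ‖y‖ - (18 * k * C ^ 6) * s) ^ 2 / c₁ = c₁ / 4 * ‖y‖ ^ 2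
        + (18 * k * C ^ 6) ^ 2 / c₁ * s ^ 2 - k * (18 * C ^ 6 * ‖y‖ * s) := by
      field_simp
      ring
    linarith
  have hs2 : s ^ 2 ≤ 3 * (‖U‖ ^ 2 + ‖v‖ ^ 2 + d ^ 2 * (‖U₂ x‖ + ‖U₃ x‖) ^ 2) := by
    rw [← sq_abs d, ← mul_pow, hsdef]
    generalize |d| * (‖U₂ x‖ + ‖U₃ x‖) = t
    nlinarith [sq_nonneg (‖U‖ - ‖v‖), sq_nonneg (‖U‖ - t), sq_nonneg (‖v‖ - t)]
  set Z := ‖U‖ ^ 2 + ‖v‖ ^ 2 + d ^ 2 * (‖U₂ x‖ + ‖U₃ x‖) ^ 2 with hZ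
  have hZ0 : 0 ≤ Z := by positivity
  have hF : (18 * k * C ^ 6) ^ 2 / c₁ * s ^ 2 ≤ C₂ * Z := by
    rw [hC₂, mul_assoc _ 3 Z]
    exact mul_le_mul_of_nonneg_left hs2 (by positivity)
  have hCZ : 0 ≤ C * Z := by positivity
  rw [mul_add]
  linarith

end Damping

theorem aestronglyMeasurable_of_continuous {G : Type*} [NormedAddCommGroup G] {f : ℝ → G}
    (hf : Continuous f) : AEStronglyMeasurable f volume := hf.aestronglyMeasurable

/-! ### Difference quotients and their limits in `L²`. -/

section DifferenceQuotient

variable {F F' : Type*} [NormedAddCommGroup F] [NormedSpace ℝ F] [NormedAddCommGroup F']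
  [NormedSpace ℝ F']

/-- The difference quotient with step `h`. -/
noncomputable def diffQuot (h : ℝ) (f : ℝ → F) (x : ℝ) : F := h⁻¹ • (f (x + h) - f x)

/-- The sequence of steps along which difference quotients are taken. -/
noncomputable def step (n : ℕ) : ℝ := 1 / ((n : ℝ) + 1)

theorem step_ne (n : ℕ) : step n ≠ 0 := (Nat.one_div_pos_of_nat (α := ℝ)).ne'

theorem tendsto_step : Tendsto step atTop (𝓝 0) := tendsto_one_div_add_atTop_nhds_zero_nat

/-- The exact discrete Leibniz rule; the argument of the differenced operator is evaluated at the
shifted point. -/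
theorem diffQuot_clm (h : ℝ) (A : ℝ → F →L[ℝ] F') (f : ℝ → F) (x : ℝ) :
    diffQuot h (fun y => A y (f y)) x
      = A x (diffQuot h f x) + diffQuot h A x (f (x + h)) := by
  simp only [diffQuot, map_smul, map_sub, smul_apply, sub_apply, ← smul_add]
  congr 1
  abel

theorem diffQuot_add (h : ℝ) (f g : ℝ → F) (x : ℝ) :
    diffQuot h (fun y => f y + g y) x = diffQuot h f x + diffQuot h g x := by
  rw [diffQuot, diffQuot, diffQuot, ← smul_add]
  congr 1
  abel

theorem diffQuot_sub (h : ℝ) (f g : ℝ → F) (x : ℝ) :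
    diffQuot h (fun y => f y - g y) x = diffQuot h f x - diffQuot h g x := by
  rw [diffQuot, diffQuot, diffQuot, ← smul_sub]
  congr 1
  abel

theorem diffQuot_smul (h c : ℝ) (f : ℝ → F) (x : ℝ) :
    diffQuot h (fun y => c • f y) x = c • diffQuot h f x := by
  rw [diffQuot, diffQuot, ← smul_sub, smul_comm]

theorem diffQuot_comp_add (h s : ℝ) (f : ℝ → F) (x : ℝ) :
    diffQuot h (fun y => f (y + s)) x = diffQuot h f (x + s) := by
  rw [diffQuot, diffQuot, add_right_comm]

theorem continuous_diffQuot {f : ℝ → F} (hf : Continuous f) (h : ℝ) :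
    Continuous (diffQuot h f) := by
  unfold diffQuot
  fun_prop

theorem hasDerivAt_diffQuot {f f' : ℝ → F} (hf : ∀ x, HasDerivAt f (f' x) x) (h x : ℝ) :
    HasDerivAt (diffQuot h f) (diffQuot h f' x) x :=
  (((hf (x + h)).comp_add_const x h).sub (hf x)).const_smul h⁻¹

theorem diffQuot_eq_average {f g : ℝ → F} (hfg : ∀ a b, f b - f a = ∫ x in a..b, g x) {h : ℝ}
    (hh : h ≠ 0) (x : ℝ) : diffQuot h f x = ∫ s in (0 : ℝ)..1, g (x + h * s) := by
  rw [diffQuot, hfg, intervalIntegral.integral_comp_add_mul _ hh]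
  simp

theorem norm_diffQuot_le {f f' : ℝ → F} (hf : ∀ x, HasDerivAt f (f' x) x) {C : ℝ}
    (hC : ∀ x, ‖f' x‖ ≤ C) {h : ℝ} (hh : h ≠ 0) (x : ℝ) : ‖diffQuot h f x‖ ≤ C := by
  have h1 := convex_univ.norm_image_sub_le_of_norm_hasDerivWithin_le (s := univ)
    (fun y _ => (hf y).hasDerivWithinAt) (fun y _ => hC y) (mem_univ x) (mem_univ (x + h))
  rw [add_sub_cancel_left] at h1
  rw [diffQuot, norm_smul, norm_inv, inv_mul_le_iff₀ (norm_pos_iff.2 hh), mul_comm]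
  exact h1

theorem tendsto_diffQuot {f : ℝ → F} {f' : F} {x : ℝ} (hf : HasDerivAt f f' x) :
    Tendsto (fun n => diffQuot (step n) f x) atTop (𝓝 f') := by
  have h1 := hasDerivAt_iff_tendsto_slope_zero.1 hf
  exact h1.comp (tendsto_nhdsWithin_iff.2 ⟨tendsto_step, .of_forall fun n => step_ne n⟩)

theorem sub_eq_integral_of_hasDerivAt [CompleteSpace F] {f f' : ℝ → F}
    (hf : ∀ x, HasDerivAt f (f' x) x) (hc : Continuous f') (a b : ℝ) :
    f b - f a = ∫ x in a..b, f' x :=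
  (intervalIntegral.integral_eq_sub_of_hasDerivAt (fun x _ => hf x)
    (hc.intervalIntegrable a b)).symm

variable {ι : Type*}

/-- A difference quotient is the average of the derivative over the step, so convergence of the
derivatives passes to it. A weak derivative suffices, and the function may itself depend on `n`,
which allows iterated quotients. -/
theorem L2Conv.quotient [CompleteSpace F] {f f' : ℕ → ι → ℝ → F} {g : ι → ℝ → F}
    (H : L2Conv f' g) (hc : ∀ n i, Continuous (f n i)) (hf' : ∀ n i, StronglyMeasurable (f' n i))
    (hff : ∀ n i a b, f n i b - f n i a = ∫ x in a..b, f' n i x) :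
    L2Conv (fun n i x => diffQuot (step n) (f n i) x) g :=
  H.average hf' (fun n i => (continuous_diffQuot (hc n i) _).aestronglyMeasurable) step_ne
    tendsto_step fun n i x => diffQuot_eq_average (hff n i) (step_ne n) x

theorem L2Conv.quotient_of_hasDerivAt [CompleteSpace F] {f f' : ℕ → ι → ℝ → F} {g : ι → ℝ → F}
    (H : L2Conv f' g) (hf : ∀ n i x, HasDerivAt (f n i) (f' n i x) x)
    (hc : ∀ n i, Continuous (f' n i)) :
    L2Conv (fun n i x => diffQuot (step n) (f n i) x) g :=
  H.quotient (fun n i => continuous_iff_continuousAt.2 fun x => (hf n i x).continuousAt)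
    (fun n i => (hc n i).stronglyMeasurable)
    fun n i a b => sub_eq_integral_of_hasDerivAt (hf n i) (hc n i) a b

end DifferenceQuotient

/-! ### Quotients of smooth functions of the solution. -/

section JetFamily

variable {ι E : Type*} [NormedAddCommGroup E] [InnerProductSpace ℝ E]

/-- A family of functions with values in a compact subset of `O`, with bounded square integrable
first derivatives and square integrable second weak derivatives. -/
structure JetFamily (O K : Set E) (W W₁ W₂ : ι → ℝ → E) (B : ℝ) : Prop where
  isOpen : IsOpen O
  isCompact : IsCompact K
  subset : K ⊆ O
  mem : ∀ i x, W i x ∈ K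
  deriv : ∀ i x, HasDerivAt (W i) (W₁ i x) x
  continuous₁ : ∀ i, Continuous (W₁ i)
  bound : ∀ i x, ‖W₁ i x‖ ≤ B
  l2Bdd₁ : L2Bdd W₁
  l2Bdd₂ : L2Bdd W₂
  stronglyMeasurable : ∀ i, StronglyMeasurable (W₂ i)
  weak : ∀ i a b, W₁ i b - W₁ i a = ∫ x in a..b, W₂ i x

variable {O K : Set E} {W W₁ W₂ : ι → ℝ → E} {B : ℝ} {F : Type*} [NormedAddCommGroup F]
  [NormedSpace ℝ F]

namespace JetFamily

theorem continuous (h : JetFamily O K W W₁ W₂ B) (i : ι) : Continuous (W i) :=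
  continuous_iff_continuousAt.2 fun x => (h.deriv i x).continuousAt

theorem continuous_comp (h : JetFamily O K W W₁ W₂ B) {Φ : E → F} (hΦ : ContDiffOn ℝ ∞ Φ O)
    (i : ι) : Continuous fun x => Φ (W i x) :=
  hΦ.continuousOn.comp_continuous (h.continuous i) fun x => h.subset (h.mem i x)

theorem exists_bound (h : JetFamily O K W W₁ W₂ B) {Φ : E → F} (hΦ : ContDiffOn ℝ ∞ Φ O) :
    ∃ C, 0 ≤ C ∧ ∀ i x, ‖Φ (W i x)‖ ≤ C := by
  obtain ⟨C, hC⟩ := h.isCompact.exists_bound_of_continuousOn (hΦ.continuousOn.mono h.subset)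
  exact ⟨max C 0, le_max_right _ _, fun i x => (hC _ (h.mem i x)).trans (le_max_left _ _)⟩

theorem hasDerivAt_comp (h : JetFamily O K W W₁ W₂ B) {Φ : E → F} (hΦ : ContDiffOn ℝ ∞ Φ O)
    (i : ι) (x : ℝ) : HasDerivAt (fun x => Φ (W i x)) (fderiv ℝ Φ (W i x) (W₁ i x)) x :=
  (hΦ.hasFDerivAt_of_isOpen h.isOpen (h.subset (h.mem i x))).comp_hasDerivAt x (h.deriv i x)

theorem continuous_deriv_comp (h : JetFamily O K W W₁ W₂ B) {Φ : E → F}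
    (hΦ : ContDiffOn ℝ ∞ Φ O) (i : ι) : Continuous fun x => fderiv ℝ Φ (W i x) (W₁ i x) :=
  (h.continuous_comp (hΦ.fderiv_infty h.isOpen) i).clm_apply (h.continuous₁ i)

theorem norm_deriv_comp_le (h : JetFamily O K W W₁ W₂ B) {Φ : E → F}
    (hΦ : ContDiffOn ℝ ∞ Φ O) : ∃ C, ∀ i x, ‖fderiv ℝ Φ (W i x) (W₁ i x)‖ ≤ C := by
  obtain ⟨C, hC0, hC⟩ := h.exists_bound (hΦ.fderiv_infty h.isOpen)
  refine ⟨C * B, fun i x => ?_⟩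
  exact (ContinuousLinearMap.le_of_opNorm_le _ (hC i x) _).trans (by gcongr; exact h.bound i x)

theorem l2Conv_diffQuot_comp [CompleteSpace F] (h : JetFamily O K W W₁ W₂ B) {Φ : E → F}
    (hΦ : ContDiffOn ℝ ∞ Φ O) :
    L2Conv (fun n i x => diffQuot (step n) (fun y => Φ (W i y)) x)
      fun i x => fderiv ℝ Φ (W i x) (W₁ i x) := by
  obtain ⟨C, -, hC⟩ := h.exists_bound (hΦ.fderiv_infty h.isOpen)
  exact (h.l2Bdd₁.const.clm_const (fun i =>
    (h.continuous_comp (hΦ.fderiv_infty h.isOpen) i).aestronglyMeasurable) C hC).quotient_of_hasDerivAt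
    (fun _ i x => h.hasDerivAt_comp hΦ i x) fun _ i => h.continuous_deriv_comp hΦ i

variable [CompleteSpace E]

theorem l2Conv_diffQuot₁ (h : JetFamily O K W W₁ W₂ B) :
    L2Conv (fun n i x => diffQuot (step n) (W₁ i) x) W₂ :=
  h.l2Bdd₂.const.quotient (fun _ i => h.continuous₁ i) (fun _ i => h.stronglyMeasurable i)
    fun _ i => h.weak i

/-- Here the operators converge only in `L²`, whereas the vectors are bounded and continuous. The
roles in the multiplier lemma are exchanged: evaluation at the vector becomes the multiplier. -/
theorem l2Conv_eval (h : JetFamily O K W W₁ W₂ B) {A : ℕ → ι → ℝ → E →L[ℝ] F}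
    {L : ι → ℝ → E →L[ℝ] F} (hA : L2Conv A L) {s : ℕ → ℝ} (hs : Tendsto s atTop (𝓝 0)) :
    L2Conv (fun n i x => A n i x (W₁ i (x + s n))) fun i x => L i x (W₁ i x) :=
  hA.clm (M := fun n i x => ContinuousLinearMap.apply ℝ F (W₁ i (x + s n)))
    (L := fun i x => ContinuousLinearMap.apply ℝ F (W₁ i x))
    (fun n i => by
      have hc : Continuous fun x => ContinuousLinearMap.apply ℝ F (W₁ i (x + s n)) :=
        (ContinuousLinearMap.apply ℝ F).continuous.comp
          ((h.continuous₁ i).comp (continuous_add_const _))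
      exact aestronglyMeasurable_of_continuous hc) B
    (fun n i x => by
      refine (ContinuousLinearMap.opNorm_le_bound _ ((norm_nonneg _).trans (h.bound i 0))
        fun A => ?_)
      rw [ContinuousLinearMap.apply_apply, mul_comm]
      exact A.le_opNorm_of_le (h.bound i _))
    (fun i x => ((ContinuousLinearMap.apply ℝ F).continuous.tendsto _).comp
      (((h.continuous₁ i).tendsto x).comp (by
        simpa using hs.const_add x)))

theorem l2Conv_diffQuot_deriv_comp [CompleteSpace F] (h : JetFamily O K W W₁ W₂ B) {Φ : E → F}
    (hΦ : ContDiffOn ℝ ∞ Φ O) :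
    L2Conv (fun n i x => diffQuot (step n) (fun y => fderiv ℝ Φ (W i y) (W₁ i y)) x)
      fun i x => fderiv ℝ Φ (W i x) (W₂ i x)
        + fderiv ℝ (fderiv ℝ Φ) (W i x) (W₁ i x) (W₁ i x) := by
  have hΦ' := hΦ.fderiv_infty h.isOpen
  obtain ⟨C, hC0, hC⟩ := h.exists_bound hΦ'
  have h1 := h.l2Conv_diffQuot₁.clm_const
    (fun i => (h.continuous_comp hΦ' i).aestronglyMeasurable) C hC
  have h2 := h.l2Conv_eval (h.l2Conv_diffQuot_comp hΦ') tendsto_step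
  have h3 := h1.add h2
  convert h3 using 4 with n i x
  exact diffQuot_clm _ _ _ _

theorem l2Conv_diffQuot_diffQuot_comp [CompleteSpace F] (h : JetFamily O K W W₁ W₂ B) {Φ : E → F}
    (hΦ : ContDiffOn ℝ ∞ Φ O) :
    L2Conv (fun n i x => diffQuot (step n) (diffQuot (step n) (fun y => Φ (W i y))) x)
      fun i x => fderiv ℝ Φ (W i x) (W₂ i x)
        + fderiv ℝ (fderiv ℝ Φ) (W i x) (W₁ i x) (W₁ i x) :=
  (h.l2Conv_diffQuot_deriv_comp hΦ).quotient_of_hasDerivAt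
    (fun _ i x => hasDerivAt_diffQuot (h.hasDerivAt_comp hΦ i) _ x)
    fun _ i => continuous_diffQuot (h.continuous_deriv_comp hΦ i) _

end JetFamily

end JetFamily

/-! ### The perturbed solution and its differenced equations. -/

section Perturbed

variable {E : Type*} [NormedAddCommGroup E] [InnerProductSpace ℝ E]

/-- A solution `W` near a profile, in a frame moving with speed `d`; `W₁` and `Wt` are its
derivatives and `w` is the second weak derivative of the perturbation. -/
structure PerturbedSolution (O K : Set E) (a : E → E →L[ℝ] E) (q : E → E) (U₀ U₁ U₂ : ℝ → E)
    (T B : ℝ) (W W₁ Wt w : ℝ → ℝ → E) (d : ℝ → ℝ) : Prop where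
  jet : JetFamily O K (fun t : Icc 0 T => W t) (fun t => W₁ t) (fun t x => w t x + U₂ x) B
  deriv_time : ∀ x, ∀ t ∈ Ioo 0 T, HasDerivAt (fun s => W s x) (Wt t x) t
  continuousOn : ContinuousOn (Function.uncurry W) (Icc 0 T ×ˢ univ)
  continuousOn_time : ContinuousOn (Function.uncurry Wt) (Icc 0 T ×ˢ univ)
  equation : ∀ t ∈ Icc 0 T, ∀ x, Wt t x = residual₀ a q (W t x) (W₁ t x) + d t • W₁ t x
  speed_le : ∀ t ∈ Icc 0 T, |d t| ≤ B
  l2Bdd : L2Bdd fun (t : Icc 0 T) x => W t x - U₀ x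
  l2Bdd₁ : L2Bdd fun (t : Icc 0 T) x => W₁ t x - U₁ x
  l2Bdd₂ : L2Bdd fun t : Icc 0 T => w t
  l2Bdd_time : L2Bdd fun t : Icc 0 T => Wt t

variable {κ : Type*} [Fintype κ] [DecidableEq κ] {O K Kp : Set E} {a : E → E →L[ℝ] E} {q : E → E}
  {lam : κ → E → ℝ} {P : κ → E → E →L[ℝ] E} {U₀ U₁ U₂ U₃ : ℝ → E} {um up : E} {Cp T B : ℝ}
  {W W₁ Wt w : ℝ → ℝ → E} {d : ℝ → ℝ}

theorem ProfileJet.continuous₁ (hp : ProfileJet Kp a q U₀ U₁ U₂ U₃ um up Cp) : Continuous U₁ :=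
  continuous_iff_continuousAt.2 fun x => (hp.deriv₁ x).continuousAt

theorem ProfileJet.continuous₂ (hp : ProfileJet Kp a q U₀ U₁ U₂ U₃ um up Cp) : Continuous U₂ :=
  continuous_iff_continuousAt.2 fun x => (hp.deriv₂ x).continuousAt

theorem L2Bdd.smul {ι G : Type*} [NormedAddCommGroup G] [NormedSpace ℝ G] {f : ι → ℝ → G}
    (hf : L2Bdd f) (c : ℝ) : L2Bdd fun i x => c • f i x :=
  hf.mono (fun i => (hf.memLp i).1.const_smul c) |c| fun i => .of_forall fun x => by
    rw [norm_smul, Real.norm_eq_abs]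

theorem L2Bdd.diffQuot {ι G : Type*} [NormedAddCommGroup G] [NormedSpace ℝ G] {f : ι → ℝ → G}
    (hf : L2Bdd f) (h : ℝ) : L2Bdd fun i => diffQuot h (f i) :=
  ((hf.comp_add h).sub hf).smul h⁻¹

namespace PerturbedSolution

variable (H : PerturbedSolution O K a q U₀ U₁ U₂ T B W W₁ Wt w d)

include H

theorem deriv_sub (hp : ProfileJet Kp a q U₀ U₁ U₂ U₃ um up Cp) (t : Icc (0 : ℝ) T) (x : ℝ) :
    HasDerivAt (fun y => W t y - U₀ y) (W₁ t x - U₁ x) x :=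
  (H.jet.deriv t x).sub (hp.deriv₀ x)

theorem continuous_sub₁ (hp : ProfileJet Kp a q U₀ U₁ U₂ U₃ um up Cp) (t : Icc (0 : ℝ) T) :
    Continuous fun y => W₁ t y - U₁ y :=
  (H.jet.continuous₁ t).sub hp.continuous₁

variable [FiniteDimensional ℝ E]

theorem l2Conv_diffQuot (hp : ProfileJet Kp a q U₀ U₁ U₂ U₃ um up Cp) :
    L2Conv (fun n (t : Icc 0 T) x => diffQuot (step n) (fun y => W t y - U₀ y) x)
      fun t x => W₁ t x - U₁ x :=
  H.l2Bdd₁.const.quotient_of_hasDerivAt (fun _ t x => H.deriv_sub hp t x)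
    fun _ t => H.continuous_sub₁ hp t

theorem l2Conv_diffQuot₁ (hp : ProfileJet Kp a q U₀ U₁ U₂ U₃ um up Cp) :
    L2Conv (fun n (t : Icc 0 T) x => diffQuot (step n) (fun y => W₁ t y - U₁ y) x)
      fun t => w t := by
  have h1 : L2Conv (fun n (_ : Icc 0 T) x => diffQuot (step n) U₁ x) fun _ => U₂ :=
    (L2Bdd.of_memLp hp.memLp₂).const.quotient_of_hasDerivAt (fun _ _ x => hp.deriv₁ x)
      fun _ _ => hp.continuous₂
  have h2 := H.jet.l2Conv_diffQuot₁.sub h1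
  simp only [add_sub_cancel_right, ← diffQuot_sub] at h2
  exact h2

theorem l2Conv_diffQuot_diffQuot (hp : ProfileJet Kp a q U₀ U₁ U₂ U₃ um up Cp) :
    L2Conv (fun n (t : Icc 0 T) x =>
      diffQuot (step n) (diffQuot (step n) (fun y => W t y - U₀ y)) x) fun t => w t :=
  (H.l2Conv_diffQuot₁ hp).quotient_of_hasDerivAt
    (fun _ t x => hasDerivAt_diffQuot (H.deriv_sub hp t) _ x)
    fun _ t => continuous_diffQuot (H.continuous_sub₁ hp t) _

theorem diffQuot_time (t : Icc (0 : ℝ) T) (h x : ℝ) :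
    diffQuot h (Wt t) x = diffQuot h (fun y => q (W t y)) x
      - (a (W t x) (diffQuot h (W₁ t) x) + diffQuot h (fun y => a (W t y)) x (W₁ t (x + h)))
      + d t • diffQuot h (W₁ t) x := by
  have e : Wt t = fun y => (q (W t y) - a (W t y) (W₁ t y)) + d t • W₁ t y :=
    funext fun y => H.equation t t.2 y
  rw [e, diffQuot_add, diffQuot_sub, diffQuot_clm, diffQuot_smul]

/-- The Leibniz rule applied twice, which accounts for the factor 2 and the double shift. The
quotients standing for a third derivative of the perturbation are kept on the left with the time
derivative; everything on the right converges in `L²`. -/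
theorem diffQuot_diffQuot_time (t : Icc (0 : ℝ) T) (h x : ℝ) :
    diffQuot h (diffQuot h (Wt t)) x
        + (a (W t x) (diffQuot h (diffQuot h fun y => W₁ t y - U₁ y) x)
          - d t • diffQuot h (diffQuot h fun y => W₁ t y - U₁ y) x)
      = diffQuot h (diffQuot h fun y => q (W t y)) x
      - (2 : ℝ) • diffQuot h (fun y => a (W t y)) x (diffQuot h (W₁ t) (x + h))
      - diffQuot h (diffQuot h fun y => a (W t y)) x (W₁ t (x + (h + h)))
      - (a (W t x) (diffQuot h (diffQuot h U₁) x) - d t • diffQuot h (diffQuot h U₁) x) := by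
  have e : diffQuot h (Wt t) = fun x => diffQuot h (fun y => q (W t y)) x
      - (a (W t x) (diffQuot h (W₁ t) x) + diffQuot h (fun y => a (W t y)) x (W₁ t (x + h)))
      + d t • diffQuot h (W₁ t) x := funext fun x => H.diffQuot_time t h x
  have e2 : diffQuot h (fun y => W₁ t y - U₁ y) = fun y => diffQuot h (W₁ t) y - diffQuot h U₁ y :=
    funext fun y => diffQuot_sub _ _ _ _
  rw [e, diffQuot_add, diffQuot_sub, diffQuot_add, diffQuot_clm _ (fun y => a (W t y)),
    diffQuot_clm h (fun x => diffQuot h (fun y => a (W t y)) x) (fun x => W₁ t (x + h)),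
    diffQuot_comp_add, diffQuot_smul, e2, diffQuot_sub, add_assoc x h h, map_sub, smul_sub, two_smul]
  abel

theorem l2Conv_diffQuot_time (hs : SpectralSetting O a q lam P) :
    L2Conv (fun n (t : Icc 0 T) x => diffQuot (step n) (Wt t) x)
      fun t x => residual₁ a q (W t x) (W₁ t x) (U₂ x) + d t • U₂ x
        - (a (W t x) (w t x) - d t • w t x) := by
  obtain ⟨C, -, hC⟩ := H.jet.exists_bound hs.smooth_a
  have h1 := H.jet.l2Conv_diffQuot_comp hs.smooth_q
  have h2 := H.jet.l2Conv_diffQuot₁.clm_const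
    (fun t => aestronglyMeasurable_of_continuous (H.jet.continuous_comp hs.smooth_a t)) C hC
  have h3 := H.jet.l2Conv_eval (H.jet.l2Conv_diffQuot_comp hs.smooth_a) tendsto_step
  have h4 := H.jet.l2Conv_diffQuot₁.smul_const (a := fun t _ => d t)
    (fun t => aestronglyMeasurable_const) B fun t _ => H.speed_le t t.2
  have h5 := (h1.sub (h2.add h3)).add h4
  convert h5 using 4 with n t x t x
  · exact H.diffQuot_time t _ x
  · simp only [residual₁, map_add, smul_add]
    abel

theorem l2Conv_diffQuot_diffQuot_time (hs : SpectralSetting O a q lam P)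
    (hp : ProfileJet Kp a q U₀ U₁ U₂ U₃ um up Cp) :
    L2Conv (fun n (t : Icc 0 T) x => diffQuot (step n) (diffQuot (step n) (Wt t)) x
        + (a (W t x) (diffQuot (step n) (diffQuot (step n) fun y => W₁ t y - U₁ y) x)
          - d t • diffQuot (step n) (diffQuot (step n) fun y => W₁ t y - U₁ y) x))
      fun t x => residual₂ a q (W t x) (W₁ t x) (U₂ x) (U₃ x) + d t • U₃ x
        + linPart a q (W t x) (W₁ t x) (w t x) := by
  obtain ⟨C, -, hC⟩ := H.jet.exists_bound hs.smooth_a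
  obtain ⟨C', hC'⟩ := H.jet.norm_deriv_comp_le hs.smooth_a
  have h0 : L2Conv (fun n (_ : Icc 0 T) x => diffQuot (step n) (diffQuot (step n) U₁) x)
      fun _ => U₃ :=
    ((L2Bdd.of_memLp hp.memLp₃).const.quotient_of_hasDerivAt (fun _ _ x => hp.deriv₂ x)
      fun _ _ => hp.continuous₃).quotient_of_hasDerivAt
      (fun _ _ x => hasDerivAt_diffQuot hp.deriv₁ _ x) fun _ _ => continuous_diffQuot hp.continuous₂ _
  have h1 := H.jet.l2Conv_diffQuot_diffQuot_comp hs.smooth_q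
  have h2 := (H.jet.l2Conv_diffQuot₁.comp_add tendsto_step).clm
    (M := fun n (t : Icc 0 T) x => (2 : ℝ) • diffQuot (step n) (fun y => a (W t y)) x)
    (L := fun t x => (2 : ℝ) • fderiv ℝ a (W t x) (W₁ t x))
    (fun n t => (aestronglyMeasurable_of_continuous
      (continuous_diffQuot (H.jet.continuous_comp hs.smooth_a t) _)).const_smul (2 : ℝ)) (2 * C')
    (fun n t x => by
      rw [norm_smul, Real.norm_ofNat]
      gcongr
      exact norm_diffQuot_le (H.jet.hasDerivAt_comp hs.smooth_a t) (hC' t) (step_ne n) x)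
    (fun t x => (tendsto_diffQuot (H.jet.hasDerivAt_comp hs.smooth_a t x)).const_smul _)
  have h3 := H.jet.l2Conv_eval (H.jet.l2Conv_diffQuot_diffQuot_comp hs.smooth_a)
    (s := fun n => step n + step n) (by simpa using tendsto_step.add tendsto_step)
  have h4 := h0.clm_const
    (fun t => aestronglyMeasurable_of_continuous (H.jet.continuous_comp hs.smooth_a t)) C hC
  have h5 := h0.smul_const (a := fun t _ => d t)
    (fun t => aestronglyMeasurable_const) B fun t _ => H.speed_le t t.2
  have h6 := ((h1.sub h2).sub h3).sub (h4.sub h5)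
  convert h6 using 4 with n t x t x
  · rw [H.diffQuot_diffQuot_time, smul_apply]
  · simp only [residual₂, linPart, map_add, add_apply, sub_apply, smul_apply,
      ContinuousLinearMap.flip_apply]
    abel

end PerturbedSolution

end Perturbed

/-! ### Passage to the limit in the energy identity. -/

section EnergyLimit

variable {G : Type*} [NormedAddCommGroup G] [InnerProductSpace ℝ G]

/-- Energy identities pass to the limit under convergence in `L²`. -/
theorem energy_limit {T θ C : ℝ} {Y Z : ℕ → ℝ → ℝ → G} {Y₀ Z₀ : ℝ → ℝ → G} {k : ℝ → ℝ → ℝ}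
    {ρ : ℝ → ℝ} (hY : L2Conv (fun n (t : Icc 0 T) => Y n t) fun t => Y₀ t)
    (hZ : L2Conv (fun n (t : Icc 0 T) => Z n t) fun t => Z₀ t)
    (hk : ∀ t ∈ Icc 0 T, Continuous (k t)) (hkC : ∀ t ∈ Icc 0 T, ∀ x, |k t x| ≤ C)
    (hρ : Continuous ρ) (hρC : ∀ x, |ρ x| ≤ C) {t : ℝ} (ht : t ∈ Icc 0 T)
    (hi : ∀ n, IntervalIntegrable (fun τ => Real.exp (θ * τ) * ∫ x,
      (k τ x * ‖Y n τ x‖ ^ 2 + 2 * ρ x * inner ℝ (Y n τ x) (Z n τ x))) volume 0 t)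
    (he : ∀ n, Real.exp (θ * t) * (∫ x, ρ x * ‖Y n t x‖ ^ 2) - (∫ x, ρ x * ‖Y n 0 x‖ ^ 2)
      = ∫ τ in (0 : ℝ)..t, Real.exp (θ * τ) * ∫ x,
        (k τ x * ‖Y n τ x‖ ^ 2 + 2 * ρ x * inner ℝ (Y n τ x) (Z n τ x))) :
    (∀ τ ∈ Icc 0 T, Integrable (fun x =>
      k τ x * ‖Y₀ τ x‖ ^ 2 + 2 * ρ x * inner ℝ (Y₀ τ x) (Z₀ τ x)) volume) ∧
    IntervalIntegrable (fun τ => Real.exp (θ * τ) * ∫ x,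
      (k τ x * ‖Y₀ τ x‖ ^ 2 + 2 * ρ x * inner ℝ (Y₀ τ x) (Z₀ τ x))) volume 0 t ∧
    Real.exp (θ * t) * (∫ x, ρ x * ‖Y₀ t x‖ ^ 2) - (∫ x, ρ x * ‖Y₀ 0 x‖ ^ 2)
      = ∫ τ in (0 : ℝ)..t, Real.exp (θ * τ) * ∫ x,
        (k τ x * ‖Y₀ τ x‖ ^ 2 + 2 * ρ x * inner ℝ (Y₀ τ x) (Z₀ τ x)) := by
  have h0T : (0 : ℝ) ∈ Icc 0 T := ⟨le_rfl, ht.1.trans ht.2⟩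
  have c1 := hY.smul_const (a := fun t : Icc 0 T => k t)
    (fun s => (hk s s.2).aestronglyMeasurable) C fun s => hkC s s.2
  have c2 := hY.smul_const (a := fun (_ : Icc 0 T) x => 2 * ρ x)
    (fun _ => (hρ.const_mul 2).aestronglyMeasurable) (2 * C) fun _ x => by
      rw [abs_mul, abs_two]
      gcongr
      exact hρC x
  have c3 := hY.smul_const (a := fun (_ : Icc 0 T) => ρ)
    (fun _ => hρ.aestronglyMeasurable) C fun _ => hρC
  -- These bounds are uniform in the index and in time. Convergence is only known at each time, so
  -- they provide the dominating function for the time integral.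
  obtain ⟨C₁, hC₁⟩ := c1.bound_integral_inner hY
  obtain ⟨C₂, hC₂⟩ := c2.bound_integral_inner hZ
  have split : ∀ (y z : Icc 0 T → ℝ → G), L2Bdd y → L2Bdd z → ∀ s : Icc 0 T,
      Integrable (fun x => k s x * ‖y s x‖ ^ 2 + 2 * ρ x * inner ℝ (y s x) (z s x)) volume ∧
      ∫ x, (k s x * ‖y s x‖ ^ 2 + 2 * ρ x * inner ℝ (y s x) (z s x))
        = (∫ x, inner ℝ (k s x • y s x) (y s x)) + ∫ x, inner ℝ ((2 * ρ x) • y s x) (z s x) := by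
    intro y z hy hz s
    have m1 : MemLp (fun x => k s x • y s x) 2 volume :=
      (hy.clm (M := fun s x => k s x • ContinuousLinearMap.id ℝ G)
        (fun s => ((hk s s.2).smul continuous_const).aestronglyMeasurable) C (fun s x => by
          rw [norm_smul, Real.norm_eq_abs]
          calc |k s x| * ‖ContinuousLinearMap.id ℝ G‖ ≤ |k s x| * 1 := by
                gcongr; exact ContinuousLinearMap.norm_id_le
            _ ≤ C := by rw [mul_one]; exact hkC s s.2 x)).memLp s
    have m2 : MemLp (fun x => (2 * ρ x) • y s x) 2 volume :=
      (hy.clm (M := fun s x => (2 * ρ x) • ContinuousLinearMap.id ℝ G)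
        (fun s => ((hρ.const_mul 2).smul continuous_const).aestronglyMeasurable) (2 * C)
        (fun s x => by
          rw [norm_smul, Real.norm_eq_abs, abs_mul, abs_two]
          calc 2 * |ρ x| * ‖ContinuousLinearMap.id ℝ G‖ ≤ 2 * |ρ x| * 1 := by
                gcongr; exact ContinuousLinearMap.norm_id_le
            _ ≤ 2 * C := by rw [mul_one]; gcongr; exact hρC x)).memLp s
    have i1 := m1.integrable_inner_two (hy.memLp s)
    have i2 := m2.integrable_inner_two (hz.memLp s)
    rw [← integral_add i1 i2]
    have i3 : Integrable (fun x => inner ℝ (k s x • y s x) (y s x)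
      + inner ℝ ((2 * ρ x) • y s x) (z s x)) volume := i1.add i2
    simp only [real_inner_smul_left, real_inner_self_eq_norm_sq] at i3 ⊢
    exact ⟨i3, trivial⟩
  have lim : ∀ s : Icc 0 T, Tendsto (fun n => ∫ x, (k s x * ‖Y n s x‖ ^ 2
      + 2 * ρ x * inner ℝ (Y n s x) (Z n s x))) atTop (𝓝 (∫ x, (k s x * ‖Y₀ s x‖ ^ 2
      + 2 * ρ x * inner ℝ (Y₀ s x) (Z₀ s x)))) := fun s => by
    rw [(split _ _ hY.bdd_lim hZ.bdd_lim s).2]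
    refine ((c1.tendsto_integral_inner hY s).add (c2.tendsto_integral_inner hZ s)).congr fun n => ?_
    exact (split _ _ (hY.bdd n) (hZ.bdd n) s).2.symm
  have limE : ∀ s : Icc 0 T, Tendsto (fun n => ∫ x, ρ x * ‖Y n s x‖ ^ 2) atTop
      (𝓝 (∫ x, ρ x * ‖Y₀ s x‖ ^ 2)) := fun s => by
    simpa only [real_inner_smul_left, real_inner_self_eq_norm_sq] using
      c3.tendsto_integral_inner hY s
  have hsub : ∀ τ ∈ uIoc 0 t, τ ∈ Icc 0 T := fun τ hτ => by
    rw [uIoc_of_le ht.1] at hτ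
    exact ⟨hτ.1.le, hτ.2.trans ht.2⟩
  have bound : ∀ n, ∀ τ ∈ uIoc 0 t, ‖Real.exp (θ * τ) * ∫ x, (k τ x * ‖Y n τ x‖ ^ 2
      + 2 * ρ x * inner ℝ (Y n τ x) (Z n τ x))‖ ≤ Real.exp (θ * τ) * (C₁ + C₂) := by
    intro n τ hτ
    rw [norm_mul, Real.norm_eq_abs, Real.abs_exp, Real.norm_eq_abs]
    gcongr
    rw [(split _ _ (hY.bdd n) (hZ.bdd n) ⟨τ, hsub τ hτ⟩).2]
    exact (abs_add_le _ _).trans (add_le_add (hC₁ n ⟨τ, hsub τ hτ⟩) (hC₂ n ⟨τ, hsub τ hτ⟩))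
  have limτ : ∀ τ ∈ uIoc 0 t, Tendsto (fun n => Real.exp (θ * τ) * ∫ x, (k τ x * ‖Y n τ x‖ ^ 2
      + 2 * ρ x * inner ℝ (Y n τ x) (Z n τ x))) atTop (𝓝 (Real.exp (θ * τ) * ∫ x,
        (k τ x * ‖Y₀ τ x‖ ^ 2 + 2 * ρ x * inner ℝ (Y₀ τ x) (Z₀ τ x)))) := fun τ hτ =>
    (lim ⟨τ, hsub τ hτ⟩).const_mul _
  have hbi : IntervalIntegrable (fun τ => Real.exp (θ * τ) * (C₁ + C₂)) volume 0 t :=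
    Continuous.intervalIntegrable (by fun_prop) _ _
  have hmeas : ∀ n, AEStronglyMeasurable (fun τ => Real.exp (θ * τ) * ∫ x,
      (k τ x * ‖Y n τ x‖ ^ 2 + 2 * ρ x * inner ℝ (Y n τ x) (Z n τ x)))
      (volume.restrict (uIoc 0 t)) := fun n => (intervalIntegrable_iff.1 (hi n)).aestronglyMeasurable
  refine ⟨fun τ hτ => (split _ _ hY.bdd_lim hZ.bdd_lim ⟨τ, hτ⟩).1, ?_, ?_⟩
  · refine hbi.mono_fun (aestronglyMeasurable_of_tendsto_ae atTop hmeas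
      (ae_restrict_of_forall_mem measurableSet_uIoc limτ)) ?_
    refine ae_restrict_of_forall_mem measurableSet_uIoc fun τ hτ => ?_
    exact (le_of_tendsto (limτ τ hτ).norm (.of_forall fun n => bound n τ hτ)).trans
      (Real.le_norm_self _)
  · have l1 := ((limE ⟨t, ht⟩).const_mul (Real.exp (θ * t))).sub (limE ⟨0, h0T⟩)
    refine tendsto_nhds_unique l1 ?_
    have l2 := intervalIntegral.tendsto_integral_filter_of_dominated_convergence
      (l := atTop) (fun τ => Real.exp (θ * τ) * (C₁ + C₂)) (.of_forall hmeas)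
      (.of_forall fun n => .of_forall fun τ hτ => bound n τ hτ) hbi (.of_forall limτ)
    exact l2.congr fun n => (he n).symm

end EnergyLimit

/-! ### Energy identity of a characteristic field. -/

section FieldEnergy

variable {E : Type*} [NormedAddCommGroup E] [InnerProductSpace ℝ E]

theorem ContinuousOn.slice {G : Type*} [TopologicalSpace G] {T : ℝ} {f : ℝ → ℝ → G}
    (hf : ContinuousOn (Function.uncurry f) (Icc 0 T ×ˢ univ)) {t : ℝ} (ht : t ∈ Icc 0 T) :
    Continuous (f t) :=
  hf.comp_continuous (f := fun x => (t, x)) (by fun_prop) fun x => ⟨ht, mem_univ x⟩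

theorem ContinuousOn.diffQuot {G : Type*} [NormedAddCommGroup G] [NormedSpace ℝ G] {T : ℝ}
    {f : ℝ → ℝ → G} (hf : ContinuousOn (Function.uncurry f) (Icc 0 T ×ˢ univ)) (h : ℝ) :
    ContinuousOn (Function.uncurry fun t => diffQuot h (f t)) (Icc 0 T ×ˢ univ) := by
  have h1 : ContinuousOn (fun z : ℝ × ℝ => f z.1 (z.2 + h)) (Icc 0 T ×ˢ univ) :=
    hf.comp (f := fun z : ℝ × ℝ => (z.1, z.2 + h)) (by fun_prop)
      fun z hz => ⟨hz.1, mem_univ _⟩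
  exact (h1.sub hf).const_smul h⁻¹

theorem hasDerivAt_diffQuot_param {G : Type*} [NormedAddCommGroup G] [NormedSpace ℝ G]
    {f f' : ℝ → ℝ → G} {t : ℝ} (hf : ∀ x, HasDerivAt (fun s => f s x) (f' t x) t) (h x : ℝ) :
    HasDerivAt (fun s => diffQuot h (f s) x) (diffQuot h (f' t) x) t :=
  ((hf (x + h)).sub (hf x)).const_smul h⁻¹

variable {κ : Type*} [Fintype κ] [DecidableEq κ] {O K Kp : Set E} {a : E → E →L[ℝ] E} {q : E → E}
  {lam : κ → E → ℝ} {P : κ → E → E →L[ℝ] E} {U₀ U₁ U₂ U₃ : ℝ → E} {um up : E} {Cp T B : ℝ}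
  {W W₁ Wt w : ℝ → ℝ → E} {d : ℝ → ℝ}

theorem PerturbedSolution.norm_time_le (H : PerturbedSolution O K a q U₀ U₁ U₂ T B W W₁ Wt w d)
    (hs : SpectralSetting O a q lam P) : ∃ C, 0 ≤ C ∧ ∀ (t : Icc 0 T) x, ‖Wt t x‖ ≤ C := by
  obtain ⟨C, hC0, hC⟩ := H.jet.exists_bound hs.smooth_a
  obtain ⟨C', hC'0, hC'⟩ := H.jet.exists_bound hs.smooth_q
  refine ⟨C' + C * |B| + |B| * |B|, by positivity, fun t x => ?_⟩
  have hb : ‖W₁ t x‖ ≤ |B| := (H.jet.bound t x).trans (le_abs_self B)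
  rw [H.equation t t.2, residual₀]
  refine (norm_add_le _ _).trans (add_le_add ((norm_sub_le _ _).trans (add_le_add (hC' t x) ?_)) ?_)
  · exact (ContinuousLinearMap.le_of_opNorm_le _ (hC t x) _).trans (by gcongr)
  · rw [norm_smul, Real.norm_eq_abs]
    exact mul_le_mul ((H.speed_le t t.2).trans (le_abs_self B)) hb (norm_nonneg _) (abs_nonneg _)

set_option maxHeartbeats 1600000 in
/-- The energy identity of the `j`-th characteristic field. -/
theorem PerturbedSolution.field_energy [FiniteDimensional ℝ E]
    (H : PerturbedSolution O K a q U₀ U₁ U₂ T B W W₁ Wt w d) (hs : SpectralSetting O a q lam P)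
    (hp : ProfileJet Kp a q U₀ U₁ U₂ U₃ um up Cp) {S S' : ℝ → E →L[ℝ] E}
    (hS : ∀ x, HasDerivAt S (S' x) x) (hS'c : Continuous S') {CS : ℝ} (hSC : ∀ x, ‖S x‖ ≤ CS)
    (hS'C : ∀ x, ‖S' x‖ ≤ CS) {ρ ρ' : ℝ → ℝ} (hρ : ∀ x, HasDerivAt ρ (ρ' x) x)
    (hρ'c : Continuous ρ') {Cρ : ℝ} (hρC : ∀ x, |ρ x| ≤ Cρ) (hρ'C : ∀ x, |ρ' x| ≤ Cρ) (θ : ℝ)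
    (j : κ) {t : ℝ} (ht : t ∈ Icc 0 T) :
    (∀ τ ∈ Icc 0 T, Integrable (fun x =>
      (θ * ρ x + (ρ' x * (lam j (W τ x) - d τ) + ρ x * fderiv ℝ (lam j) (W τ x) (W₁ τ x)))
        * ‖P j (W τ x) (w τ x + S x (W₁ τ x - U₁ x))‖ ^ 2
        + 2 * ρ x * inner ℝ (P j (W τ x) (w τ x + S x (W₁ τ x - U₁ x)))
          (fieldSource a q lam P (S x) (S' x) j (U₂ x) (U₃ x) (W τ x) (W₁ τ x) (W₁ τ x - U₁ x)
            (w τ x) (d τ))) volume) ∧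
    IntervalIntegrable (fun τ => Real.exp (θ * τ) * ∫ x,
      ((θ * ρ x + (ρ' x * (lam j (W τ x) - d τ) + ρ x * fderiv ℝ (lam j) (W τ x) (W₁ τ x)))
        * ‖P j (W τ x) (w τ x + S x (W₁ τ x - U₁ x))‖ ^ 2
        + 2 * ρ x * inner ℝ (P j (W τ x) (w τ x + S x (W₁ τ x - U₁ x)))
          (fieldSource a q lam P (S x) (S' x) j (U₂ x) (U₃ x) (W τ x) (W₁ τ x) (W₁ τ x - U₁ x)
            (w τ x) (d τ)))) volume 0 t ∧
    Real.exp (θ * t) * (∫ x, ρ x * ‖P j (W t x) (w t x + S x (W₁ t x - U₁ x))‖ ^ 2)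
        - (∫ x, ρ x * ‖P j (W 0 x) (w 0 x + S x (W₁ 0 x - U₁ x))‖ ^ 2)
      = ∫ τ in (0 : ℝ)..t, Real.exp (θ * τ) * ∫ x,
      ((θ * ρ x + (ρ' x * (lam j (W τ x) - d τ) + ρ x * fderiv ℝ (lam j) (W τ x) (W₁ τ x)))
        * ‖P j (W τ x) (w τ x + S x (W₁ τ x - U₁ x))‖ ^ 2
        + 2 * ρ x * inner ℝ (P j (W τ x) (w τ x + S x (W₁ τ x - U₁ x)))
          (fieldSource a q lam P (S x) (S' x) j (U₂ x) (U₃ x) (W τ x) (W₁ τ x) (W₁ τ x - U₁ x)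
            (w τ x) (d τ))) := by
  have hSc : Continuous S := continuous_iff_continuousAt.2 fun x => (hS x).continuousAt
  have hρc : Continuous ρ := continuous_iff_continuousAt.2 fun x => (hρ x).continuousAt
  have hPj := hs.smooth_P j
  have hPj' := hPj.fderiv_infty hs.isOpen
  obtain ⟨C₁, hC₁0, hC₁⟩ := H.jet.exists_bound hPj
  obtain ⟨C₂, hC₂0, hC₂⟩ := H.jet.exists_bound hPj'
  obtain ⟨C₃, hC₃0, hC₃⟩ := H.jet.exists_bound (hs.smooth_lam j)
  obtain ⟨C₄, hC₄⟩ := H.jet.norm_deriv_comp_le (hs.smooth_lam j)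
  obtain ⟨C₅, hC₅⟩ := H.jet.norm_deriv_comp_le hPj
  obtain ⟨C₆, hC₆0, hC₆⟩ := H.norm_time_le hs
  obtain ⟨C₇, hC₇0, hC₇⟩ := H.jet.exists_bound hs.smooth_a
  have cont₀ : ∀ s : Icc 0 T, Continuous (W s) := fun s => H.jet.continuous s
  have contP : ∀ s : Icc 0 T, Continuous fun x => P j (W s x) := fun s =>
    H.jet.continuous_comp hPj s
  have contPt : ∀ s : Icc 0 T, Continuous fun x => fderiv ℝ (P j) (W s x) (Wt s x) := fun s =>
    (H.jet.continuous_comp hPj' s).clm_apply (H.continuousOn_time.slice s.2)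
  have boundPt : ∀ (s : Icc 0 T) x, ‖fderiv ℝ (P j) (W s x) (Wt s x)‖ ≤ C₂ * C₆ := fun s x =>
    (ContinuousLinearMap.le_of_opNorm_le _ (hC₂ s x) _).trans (by gcongr; exact hC₆ s x)
  have contPx : ∀ s : Icc 0 T, Continuous fun x => fderiv ℝ (P j) (W s x) (W₁ s x) := fun s =>
    H.jet.continuous_deriv_comp hPj s
  have asm := fun {M : Icc (0 : ℝ) T → ℝ → E →L[ℝ] E} (h : ∀ s, Continuous (M s)) (s : Icc 0 T) =>
    aestronglyMeasurable_of_continuous (h s)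
  -- the regularised unknowns
  let Ζ : ℕ → ℝ → ℝ → E := fun n t x => diffQuot (step n) (fun y => W t y - U₀ y) x
  let Z : ℕ → ℝ → ℝ → E := fun n t x => diffQuot (step n) (Ζ n t) x
  let Ζt : ℕ → ℝ → ℝ → E := fun n t x => diffQuot (step n) (Wt t) x
  let Zt : ℕ → ℝ → ℝ → E := fun n t x => diffQuot (step n) (Ζt n t) x
  let Ζx : ℕ → ℝ → ℝ → E := fun n t x => diffQuot (step n) (fun y => W₁ t y - U₁ y) x
  let Zx : ℕ → ℝ → ℝ → E := fun n t x => diffQuot (step n) (Ζx n t) x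
  let y : ℕ → ℝ → ℝ → E := fun n t x => Z n t x + S x (Ζ n t x)
  let Y : ℕ → ℝ → ℝ → E := fun n t x => P j (W t x) (y n t x)
  let Yt : ℕ → ℝ → ℝ → E := fun n t x => fderiv ℝ (P j) (W t x) (Wt t x) (y n t x)
    + P j (W t x) (Zt n t x + S x (Ζt n t x))
  let Yx : ℕ → ℝ → ℝ → E := fun n t x => fderiv ℝ (P j) (W t x) (W₁ t x) (y n t x)
    + P j (W t x) (Zx n t x + (S' x (Ζ n t x) + S x (Ζx n t x)))
  -- convergence
  have lΖ : L2Conv (fun n (t : Icc 0 T) => Ζ n t) fun t x => W₁ t x - U₁ x := H.l2Conv_diffQuot hp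
  have lZ : L2Conv (fun n (t : Icc 0 T) => Z n t) fun t => w t := H.l2Conv_diffQuot_diffQuot hp
  have lΖx : L2Conv (fun n (t : Icc 0 T) => Ζx n t) fun t => w t := H.l2Conv_diffQuot₁ hp
  have ly : L2Conv (fun n (t : Icc 0 T) => y n t) fun t x => w t x + S x (W₁ t x - U₁ x) :=
    lZ.add (lΖ.clm_const (asm fun _ => hSc) CS fun _ => hSC)
  have lY : L2Conv (fun n (t : Icc 0 T) => Y n t)
      fun t x => P j (W t x) (w t x + S x (W₁ t x - U₁ x)) := ly.clm_const (asm contP) C₁ hC₁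
  have lq : L2Conv (fun n (t : Icc 0 T) x => S' x (Ζ n t x) + S x (Ζx n t x))
      fun t x => S' x (W₁ t x - U₁ x) + S x (w t x) :=
    (lΖ.clm_const (asm fun _ => hS'c) CS fun _ => hS'C).add
      (lΖx.clm_const (asm fun _ => hSc) CS fun _ => hSC)
  -- Neither `Yt` nor `Yx` is known to converge, both containing third-order quotients. In the
  -- combination the relation `P j * a = lam j • P j` turns the scalar speed back into `a - d` under
  -- `P j`, so these quotients appear only through the doubly differenced equation.
  have lZs : L2Conv (fun n (t : Icc 0 T) x => Yt n t x + (lam j (W t x) - d t) • Yx n t x)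
      fun t x => fieldSource a q lam P (S x) (S' x) j (U₂ x) (U₃ x) (W t x) (W₁ t x)
        (W₁ t x - U₁ x) (w t x) (d t) := by
    have l1 := H.l2Conv_diffQuot_diffQuot_time hs hp
    have l2 := (H.l2Conv_diffQuot_time hs).clm_const (asm fun _ => hSc) CS fun _ => hSC
    have l3 := lq.clm_const (asm fun s => H.jet.continuous_comp hs.smooth_a s) C₇ hC₇
    have l4 := lq.smul_const (a := fun t _ => d t)
      (fun t => aestronglyMeasurable_const) B fun t _ => H.speed_le t t.2
    have l5 := ((l1.add l2).add (l3.sub l4)).clm_const (asm contP) C₁ hC₁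
    have l6 := ly.clm_const (asm contPt) _ boundPt
    have l7 := (ly.clm_const (asm contPx) _ hC₅).smul_const
      (a := fun (t : Icc 0 T) x => lam j (W t x) - d t)
      (fun t => ((H.jet.continuous_comp (hs.smooth_lam j) t).sub
        continuous_const).aestronglyMeasurable) (C₃ + B) fun t x =>
        (abs_sub _ _).trans (add_le_add (hC₃ t x) (H.speed_le t t.2))
    have l8 := (l5.add l6).add l7
    convert l8 using 4 with n t x t x
    · have hPa : ∀ z, P j (W t x) (a (W t x) z) = lam j (W t x) • P j (W t x) z := fun z => by
        rw [← mul_apply_eq_comp, hs.mul_op _ (H.jet.subset (H.jet.mem t x)), smul_apply]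
      have e1 : ∀ z, P j (W t x) (a (W t x) z - d t • z)
          = (lam j (W t x) - d t) • P j (W t x) z := fun z => by
        rw [map_sub, hPa, map_smul, sub_smul]
      rw [map_add, map_add, map_add, e1, e1]
      simp only [Yt, Yx, map_add, smul_add]
      abel
    · rw [fieldSource, H.equation t t.2]
  -- For a fixed step the quotients are bounded by their undifferenced functions. The bound may blow
  -- up with `n`: it only serves the identity at level `n`.
  have bYt : ∀ n, L2Bdd fun t : Icc 0 T => Yt n t := fun n => by
    have b1 := (ly.bdd n).clm (asm contPt) _ boundPt
    have b2 : L2Bdd fun t : Icc 0 T => Ζt n t := H.l2Bdd_time.diffQuot _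
    have b3 : L2Bdd fun t : Icc 0 T => Zt n t := b2.diffQuot _
    exact b1.add ((b3.add (b2.clm (asm fun _ => hSc) CS fun _ => hSC)).clm (asm contP) C₁ hC₁)
  have bYx : ∀ n, L2Bdd fun t : Icc 0 T => Yx n t := fun n => by
    have b1 := (ly.bdd n).clm (asm contPx) _ hC₅
    have b3 : L2Bdd fun t : Icc 0 T => Zx n t := (lΖx.bdd n).diffQuot _
    exact b1.add ((b3.add (lq.bdd n)).clm (asm contP) C₁ hC₁)
  -- regularity
  have cP : ContinuousOn (fun z : ℝ × ℝ => P j (W z.1 z.2)) (Icc 0 T ×ˢ univ) :=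
    hPj.continuousOn.comp H.continuousOn fun z hz => H.jet.subset (H.jet.mem ⟨z.1, hz.1⟩ z.2)
  have cP' : ContinuousOn (fun z : ℝ × ℝ => fderiv ℝ (P j) (W z.1 z.2)) (Icc 0 T ×ˢ univ) :=
    hPj'.continuousOn.comp H.continuousOn fun z hz => H.jet.subset (H.jet.mem ⟨z.1, hz.1⟩ z.2)
  have cU₀ : Continuous U₀ := continuous_iff_continuousAt.2 fun x => (hp.deriv₀ x).continuousAt
  have cΖ : ∀ n, ContinuousOn (fun z : ℝ × ℝ => Ζ n z.1 z.2) (Icc 0 T ×ˢ univ) := fun n =>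
    ContinuousOn.diffQuot (f := fun t y => W t y - U₀ y)
      (H.continuousOn.sub (cU₀.comp continuous_snd).continuousOn) _
  have cZ : ∀ n, ContinuousOn (fun z : ℝ × ℝ => Z n z.1 z.2) (Icc 0 T ×ˢ univ) := fun n =>
    ContinuousOn.diffQuot (f := Ζ n) (cΖ n) _
  have cΖt : ∀ n, ContinuousOn (fun z : ℝ × ℝ => Ζt n z.1 z.2) (Icc 0 T ×ˢ univ) := fun n =>
    ContinuousOn.diffQuot H.continuousOn_time _
  have cZt : ∀ n, ContinuousOn (fun z : ℝ × ℝ => Zt n z.1 z.2) (Icc 0 T ×ˢ univ) := fun n =>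
    ContinuousOn.diffQuot (f := Ζt n) (cΖt n) _
  have cS : ContinuousOn (fun z : ℝ × ℝ => S z.2) (Icc 0 T ×ˢ univ) :=
    (hSc.comp continuous_snd).continuousOn
  have cy : ∀ n, ContinuousOn (fun z : ℝ × ℝ => y n z.1 z.2) (Icc 0 T ×ˢ univ) := fun n =>
    (cZ n).add (cS.clm_apply (cΖ n))
  have cY : ∀ n, ContinuousOn (Function.uncurry (Y n)) (Icc 0 T ×ˢ univ) := fun n =>
    cP.clm_apply (cy n)
  have cYt : ∀ n, ContinuousOn (Function.uncurry (Yt n)) (Icc 0 T ×ˢ univ) := fun n =>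
    ((cP'.clm_apply H.continuousOn_time).clm_apply (cy n)).add
      (cP.clm_apply ((cZt n).add (cS.clm_apply (cΖt n))))
  have dYt : ∀ n x, ∀ s ∈ Ioo 0 T, HasDerivAt (fun s => Y n s x) (Yt n s x) s := fun n x s hs' => by
    have hu : W s x ∈ O := H.jet.subset (H.jet.mem ⟨s, Ioo_subset_Icc_self hs'⟩ x)
    have d0 : ∀ x, HasDerivAt (fun s => W s x - U₀ x) (Wt s x) s := fun x =>
      (H.deriv_time x s hs').sub_const _
    have d1 : ∀ x, HasDerivAt (fun s => Ζ n s x) (Ζt n s x) s := fun x =>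
      hasDerivAt_diffQuot_param (f := fun t y => W t y - U₀ y) d0 _ x
    have d2 : HasDerivAt (fun s => Z n s x) (Zt n s x) s := hasDerivAt_diffQuot_param d1 _ x
    exact ((hPj.hasFDerivAt_of_isOpen hs.isOpen hu).comp_hasDerivAt s
      (H.deriv_time x s hs')).clm_apply (d2.add ((S x).hasFDerivAt.comp_hasDerivAt s (d1 x)))
  have dYx : ∀ n, ∀ s ∈ Icc 0 T, ∀ x, HasDerivAt (Y n s) (Yx n s x) x := fun n s hs' x => by
    have d1 : ∀ x, HasDerivAt (Ζ n s) (Ζx n s x) x :=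
      hasDerivAt_diffQuot (H.deriv_sub hp ⟨s, hs'⟩) _
    have d2 : HasDerivAt (Z n s) (Zx n s x) x := hasDerivAt_diffQuot d1 _ x
    exact (H.jet.hasDerivAt_comp hPj ⟨s, hs'⟩ x).clm_apply (d2.add ((hS x).clm_apply (d1 x)))
  -- the energy identity
  set CC := max Cρ (max (C₃ + B) C₄) with hCC
  have e := fun n => transport_energy θ (ρ := ρ) (ρ' := ρ') (a := fun t x => lam j (W t x) - d t)
    (ax := fun t x => fderiv ℝ (lam j) (W t x) (W₁ t x)) (Y := Y n) (Yt := Yt n) (Yx := Yx n)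
    (C := CC) (T := T) hρ hρ'c (fun x => (hρC x).trans (le_max_left _ _))
    (fun x => (hρ'C x).trans (le_max_left _ _))
    (fun s hs' x => (H.jet.hasDerivAt_comp (hs.smooth_lam j) ⟨s, hs'⟩ x).sub_const _)
    (fun s hs' => H.jet.continuous_deriv_comp (hs.smooth_lam j) ⟨s, hs'⟩)
    (fun s hs' x => ((abs_sub _ _).trans (add_le_add (hC₃ ⟨s, hs'⟩ x)
      (H.speed_le s hs'))).trans ((le_max_left _ _).trans (le_max_right _ _)))
    (fun s hs' x => (hC₄ ⟨s, hs'⟩ x).trans ((le_max_right _ _).trans (le_max_right _ _)))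
    (cY n) (cYt n) (dYt n) (dYx n) (lY.bdd n) (bYt n) (bYx n) ht
  have hCC0 : 0 ≤ CC := (abs_nonneg _).trans ((hρC 0).trans (le_max_left _ _))
  refine energy_limit (C := |θ| * CC + (CC * CC + CC * CC) + CC) lY lZs (fun s hs' => ?_)
    (fun s hs' x => ?_) hρc (fun x => ?_) ht (fun n => (e n).1) (fun n => (e n).2)
  · have h1 := H.jet.continuous_comp (hs.smooth_lam j) ⟨s, hs'⟩
    have h2 := H.jet.continuous_deriv_comp (hs.smooth_lam j) ⟨s, hs'⟩
    exact (hρc.const_mul θ).add ((hρ'c.mul (h1.sub continuous_const)).add (hρc.mul h2))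
  · have h1 : |lam j (W s x) - d s| ≤ CC := ((abs_sub _ _).trans (add_le_add (hC₃ ⟨s, hs'⟩ x)
      (H.speed_le s hs'))).trans ((le_max_left _ _).trans (le_max_right _ _))
    have h2 : |fderiv ℝ (lam j) (W s x) (W₁ s x)| ≤ CC :=
      (hC₄ ⟨s, hs'⟩ x).trans ((le_max_right _ _).trans (le_max_right _ _))
    have h3 : |ρ x| ≤ CC := (hρC x).trans (le_max_left _ _)
    have h4 : |ρ' x| ≤ CC := (hρ'C x).trans (le_max_left _ _)
    refine (abs_add_le _ _).trans ?_
    refine le_trans (add_le_add (le_of_eq (abs_mul _ _)) ((abs_add_le _ _).trans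
      (add_le_add (le_of_eq (abs_mul _ _)) (le_of_eq (abs_mul _ _))))) ?_
    have h5 : |θ| * |ρ x| ≤ |θ| * CC := by gcongr
    have h6 : |ρ' x| * |lam j (W s x) - d s| ≤ CC * CC := by gcongr
    have h7 : |ρ x| * |fderiv ℝ (lam j) (W s x) (W₁ s x)| ≤ CC * CC := by gcongr
    linarith
  · have : 0 ≤ |θ| * CC + (CC * CC + CC * CC) := by positivity
    linarith [(hρC x).trans (le_max_left Cρ (max (C₃ + B) C₄))]

end FieldEnergy

/-! ### The undifferentiated energy and interpolation. -/

section BaseEnergy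

variable {E : Type*} [NormedAddCommGroup E] [InnerProductSpace ℝ E] [FiniteDimensional ℝ E]
  {κ : Type*} [Fintype κ] [DecidableEq κ] {O K Kp : Set E} {a : E → E →L[ℝ] E} {q : E → E}
  {lam : κ → E → ℝ} {P : κ → E → E →L[ℝ] E} {U₀ U₁ U₂ U₃ : ℝ → E} {um up : E} {Cp T B : ℝ}
  {W W₁ Wt w : ℝ → ℝ → E} {d : ℝ → ℝ}

/-- Integration by parts for the perturbation. -/
theorem PerturbedSolution.integral_norm_sq_deriv
    (H : PerturbedSolution O K a q U₀ U₁ U₂ T B W W₁ Wt w d)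
    (hp : ProfileJet Kp a q U₀ U₁ U₂ U₃ um up Cp) (t : Icc (0 : ℝ) T) :
    ∫ x, ‖W₁ t x - U₁ x‖ ^ 2 = -∫ x, inner ℝ (w t x) (W t x - U₀ x) := by
  have l1 := H.l2Bdd₁.const.tendsto_integral_inner (H.l2Conv_diffQuot hp) t
  have l2 := (H.l2Conv_diffQuot₁ hp).tendsto_integral_inner
    (H.l2Bdd.const.comp_add tendsto_step) t
  have m0 := H.l2Bdd.memLp t
  have m1 := H.l2Bdd₁.memLp t
  -- Summation by parts: the two integrands add up to the difference quotient of the product, whose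
  -- integral vanishes by translation invariance.
  have h0 : ∀ n, (∫ x, inner ℝ (W₁ t x - U₁ x) (diffQuot (step n) (fun y => W t y - U₀ y) x))
      = -∫ x, inner ℝ (diffQuot (step n) (fun y => W₁ t y - U₁ y) x)
        (W t (x + step n) - U₀ (x + step n)) := fun n => by
    have m2 := ((H.l2Conv_diffQuot hp).memLp n t)
    have m3 := ((H.l2Conv_diffQuot₁ hp).memLp n t)
    have m4 := (H.l2Bdd.comp_add (step n)).memLp t
    have i1 := m1.integrable_inner_two m2
    have i2 := m3.integrable_inner_two m4
    have i3 := m1.integrable_inner_two m0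
    rw [eq_neg_iff_add_eq_zero, ← integral_add i1 i2]
    have e : ∀ x, inner ℝ (W₁ t x - U₁ x) (diffQuot (step n) (fun y => W t y - U₀ y) x)
        + inner ℝ (diffQuot (step n) (fun y => W₁ t y - U₁ y) x)
          (W t (x + step n) - U₀ (x + step n))
        = (step n)⁻¹ * (inner ℝ (W₁ t (x + step n) - U₁ (x + step n))
            (W t (x + step n) - U₀ (x + step n)) - inner ℝ (W₁ t x - U₁ x) (W t x - U₀ x)) :=
      fun x => by
        simp only [diffQuot, real_inner_smul_right, real_inner_smul_left]
        generalize W₁ t x - U₁ x = v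
        generalize W t x - U₀ x = z
        rw [inner_sub_right v, inner_sub_left _ v]
        ring
    simp only [e]
    rw [integral_const_mul, integral_sub (i3.comp_add_right (step n)) i3,
      integral_add_right_eq_self (fun x => inner ℝ (W₁ t x - U₁ x) (W t x - U₀ x)), sub_self,
      mul_zero]
  simp only [real_inner_self_eq_norm_sq] at l1
  exact tendsto_nhds_unique l1 (l2.neg.congr fun n => (h0 n).symm)

theorem PerturbedSolution.integral_norm_sq_deriv_sq_le
    (H : PerturbedSolution O K a q U₀ U₁ U₂ T B W W₁ Wt w d)
    (hp : ProfileJet Kp a q U₀ U₁ U₂ U₃ um up Cp) (t : Icc (0 : ℝ) T) :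
    (∫ x, ‖W₁ t x - U₁ x‖ ^ 2) ^ 2 ≤ (∫ x, ‖W t x - U₀ x‖ ^ 2) * ∫ x, ‖w t x‖ ^ 2 := by
  rw [H.integral_norm_sq_deriv hp, neg_sq, ← sq_abs, integral_norm_sq_eq (H.l2Bdd.memLp t),
    integral_norm_sq_eq (H.l2Bdd₂.memLp t), ← mul_pow]
  have := abs_integral_inner_le (H.l2Bdd₂.memLp t) (H.l2Bdd.memLp t)
  gcongr
  rwa [mul_comm]

/-- The transport identity with zero speed and unit weight. No spatial structure is needed at this
level, since `Wt` is already controlled by `U`, `v` and the shift. -/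
theorem PerturbedSolution.base_energy (H : PerturbedSolution O K a q U₀ U₁ U₂ T B W W₁ Wt w d)
    (hp : ProfileJet Kp a q U₀ U₁ U₂ U₃ um up Cp) (θ : ℝ) {t : ℝ} (ht : t ∈ Icc 0 T) :
    IntervalIntegrable (fun τ => Real.exp (θ * τ) * ∫ x,
      (θ * ‖W τ x - U₀ x‖ ^ 2 + 2 * inner ℝ (W τ x - U₀ x) (Wt τ x))) volume 0 t ∧
    Real.exp (θ * t) * (∫ x, ‖W t x - U₀ x‖ ^ 2) - (∫ x, ‖W 0 x - U₀ x‖ ^ 2)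
      = ∫ τ in (0 : ℝ)..t, Real.exp (θ * τ) * ∫ x,
      (θ * ‖W τ x - U₀ x‖ ^ 2 + 2 * inner ℝ (W τ x - U₀ x) (Wt τ x)) := by
  have cU₀ : Continuous U₀ := continuous_iff_continuousAt.2 fun x => (hp.deriv₀ x).continuousAt
  have h := transport_energy θ (ρ := fun _ => 1) (ρ' := fun _ => 0) (a := fun _ _ => 0)
    (ax := fun _ _ => 0) (Y := fun t x => W t x - U₀ x) (Yt := Wt)
    (Yx := fun t x => W₁ t x - U₁ x) (C := 1) (T := T) (fun x => hasDerivAt_const x 1)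
    continuous_const (by simp) (by simp) (fun _ _ x => hasDerivAt_const x 0)
    (fun _ _ => continuous_const) (by simp) (by simp)
    (H.continuousOn.sub (cU₀.comp continuous_snd).continuousOn) H.continuousOn_time
    (fun x s hs => (H.deriv_time x s hs).sub_const _)
    (fun s hs x => H.deriv_sub hp ⟨s, hs⟩ x) H.l2Bdd H.l2Bdd_time H.l2Bdd₁ ht
  simpa only [mul_one, one_mul, zero_mul, mul_zero, add_zero, zero_smul] using h

/-- No damping is claimed for `U`, so every term goes to the right. The equation bounds `Wt` by
`C‖U‖ + 2C‖v‖ + |d| ‖U₁‖`, and Young's inequality together with the square of a three-term sum gives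
the coefficients. -/
theorem PerturbedSolution.base_density_le
    (H : PerturbedSolution O K a q U₀ U₁ U₂ T B W W₁ Wt w d)
    (hp : ProfileJet Kp a q U₀ U₁ U₂ U₃ um up Cp) {θ C : ℝ} (t : Icc (0 : ℝ) T)
    (hr : ∀ x, ‖residual₀ a q (W t x) (W₁ t x)‖ ≤ C * (‖W t x - U₀ x‖ + ‖W₁ t x - U₁ x‖))
    (hd : |d t| ≤ C) :
    ∫ x, (θ * ‖W t x - U₀ x‖ ^ 2 + 2 * inner ℝ (W t x - U₀ x) (Wt t x))
      ≤ (θ + 1 + 3 * C ^ 2) * (∫ x, ‖W t x - U₀ x‖ ^ 2)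
        + 12 * C ^ 2 * (∫ x, ‖W₁ t x - U₁ x‖ ^ 2) + d t ^ 2 * (3 * ∫ x, ‖U₁ x‖ ^ 2) := by
  have m0 := H.l2Bdd.memLp t
  have i0 : Integrable (fun x => ‖W t x - U₀ x‖ ^ 2) volume := m0.norm.integrable_sq
  have i1 : Integrable (fun x => ‖W₁ t x - U₁ x‖ ^ 2) volume :=
    (H.l2Bdd₁.memLp t).norm.integrable_sq
  have i2 : Integrable (fun x => ‖U₁ x‖ ^ 2) volume := hp.memLp₁.norm.integrable_sq
  have i3 := m0.integrable_inner_two (H.l2Bdd_time.memLp t)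
  have i4 : Integrable (fun x => (θ + 1 + 3 * C ^ 2) * ‖W t x - U₀ x‖ ^ 2
      + 12 * C ^ 2 * ‖W₁ t x - U₁ x‖ ^ 2 + d t ^ 2 * (3 * ‖U₁ x‖ ^ 2)) volume :=
    ((i0.const_mul _).add (i1.const_mul _)).add ((i2.const_mul _).const_mul _)
  have i5 : Integrable (fun x => (θ + 1 + 3 * C ^ 2) * ‖W t x - U₀ x‖ ^ 2
      + 12 * C ^ 2 * ‖W₁ t x - U₁ x‖ ^ 2) volume := (i0.const_mul _).add (i1.const_mul _)
  rw [← integral_const_mul, ← integral_const_mul, ← integral_const_mul, ← integral_const_mul,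
    ← integral_add (i0.const_mul _) (i1.const_mul _), ← integral_add i5
      ((i2.const_mul _).const_mul _)]
  refine integral_mono ((i0.const_mul _).add (i3.const_mul _)) i4 fun x => ?_
  simp only
  have h1 : ‖Wt t x‖ ≤ C * ‖W t x - U₀ x‖ + 2 * C * ‖W₁ t x - U₁ x‖ + |d t| * ‖U₁ x‖ := by
    rw [H.equation t t.2]
    refine (norm_add_le _ _).trans ((add_le_add_left (hr x) _).trans ?_)
    have h2 : ‖W₁ t x‖ ≤ ‖W₁ t x - U₁ x‖ + ‖U₁ x‖ := by
      simpa using norm_add_le (W₁ t x - U₁ x) (U₁ x)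
    rw [norm_smul, Real.norm_eq_abs]
    have h3 : |d t| * ‖W₁ t x‖ ≤ |d t| * (‖W₁ t x - U₁ x‖ + ‖U₁ x‖) := by gcongr
    have h4 : |d t| * ‖W₁ t x - U₁ x‖ ≤ C * ‖W₁ t x - U₁ x‖ := by gcongr
    linarith
  have h2 : 2 * inner ℝ (W t x - U₀ x) (Wt t x) ≤ ‖W t x - U₀ x‖ ^ 2 + ‖Wt t x‖ ^ 2 := by
    have := real_inner_le_norm (W t x - U₀ x) (Wt t x)
    nlinarith [sq_nonneg (‖W t x - U₀ x‖ - ‖Wt t x‖)]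
  have h3 : ‖Wt t x‖ ^ 2 ≤ 3 * ((C * ‖W t x - U₀ x‖) ^ 2 + (2 * C * ‖W₁ t x - U₁ x‖) ^ 2
      + (|d t| * ‖U₁ x‖) ^ 2) := by
    refine (pow_le_pow_left₀ (norm_nonneg _) h1 2).trans ?_
    generalize C * ‖W t x - U₀ x‖ = p
    generalize 2 * C * ‖W₁ t x - U₁ x‖ = r
    generalize |d t| * ‖U₁ x‖ = s
    nlinarith [sq_nonneg (p - r), sq_nonneg (p - s), sq_nonneg (r - s)]
  rw [mul_pow |d t|, sq_abs] at h3
  linarith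

/-- An interpolation inequality between numbers. -/
theorem interpolation_le {X V Z Y C η : ℝ} (hX : 0 ≤ X) (hV : 0 ≤ V) (hZ : 0 ≤ Z) (hη : 0 < η)
    (h : V ^ 2 ≤ X * Z) (hZY : Z ≤ 2 * Y + 2 * C ^ 2 * V) (hCη : 4 * C ^ 2 * η ≤ 1) :
    V ≤ 4 * η * Y + X / (2 * η) := by
  have h1 : V ≤ η * Z + X / (4 * η) := by
    refine abs_le_of_sq_le_sq' ?_ (by positivity) |>.2
    refine h.trans ?_
    have : (η * Z + X / (4 * η)) ^ 2 = X * Z + (η * Z - X / (4 * η)) ^ 2 := by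
      field_simp
      ring
    rw [this]
    linarith [sq_nonneg (η * Z - X / (4 * η))]
  have h2 : X / (2 * η) = 2 * (X / (4 * η)) := by field_simp; ring
  have h3 : η * Z ≤ η * (2 * Y + 2 * C ^ 2 * V) := by gcongr
  have h4 : 4 * C ^ 2 * η * V ≤ 1 * V := by gcongr
  rw [h2]
  linarith

end BaseEnergy

/-! ### The closed Sobolev estimate. -/

section Estimate

variable {E : Type*} [NormedAddCommGroup E] [InnerProductSpace ℝ E]

/-- The energy production density of the `j`-th characteristic field, for the rate `θ`, the weight
`r` and its derivative `r'`. -/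
noncomputable def fieldDensity {κ : Type*} (a : E → E →L[ℝ] E) (q : E → E) (lam : κ → E → ℝ)
    (P : κ → E → E →L[ℝ] E) (S S' : E →L[ℝ] E) (θ r r' : ℝ) (j : κ) (p₂ p₃ u p v w : E)
    (d : ℝ) : ℝ :=
  (θ * r + (r' * (lam j u - d) + r * fderiv ℝ (lam j) u p)) * ‖P j u (w + S v)‖ ^ 2
    + 2 * r * inner ℝ (P j u (w + S v)) (fieldSource a q lam P S S' j p₂ p₃ u p v w d)

variable [FiniteDimensional ℝ E]
  {κ : Type*} [Fintype κ] [DecidableEq κ] {O K Kp : Set E} {a : E → E →L[ℝ] E} {q : E → E}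
  {lam : κ → E → ℝ} {P : κ → E → E →L[ℝ] E} {U₀ U₁ U₂ U₃ : ℝ → E} {um up : E} {Cp T B : ℝ}
  {W W₁ Wt w : ℝ → ℝ → E} {d : ℝ → ℝ}

-- The energy is the weighted sum over the fields plus `‖U‖²`. It is comparable to the full `H²`
-- norm, because `v` is interpolated between `U` and `y`. Its production is at most a multiple of
-- `‖U‖² + d²`, because the damping of `y` absorbs `v`.
set_option maxHeartbeats 2000000 in
theorem exists_sobolev_estimate (hs : SpectralSetting O a q lam P)
    (hp : ProfileJet Kp a q U₀ U₁ U₂ U₃ um up Cp) (hKO : Kp ⊆ O) {c₀ : ℝ} (hc₀ : 0 < c₀)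
    (hlam : ∀ j x, c₀ ≤ |lam j (U₀ x)|)
    (hm : ∀ j, ∃ μ : ℝ, μ < 0 ∧ P j um * fderiv ℝ q um * P j um = μ • P j um)
    (hpl : ∀ j, ∃ μ : ℝ, μ < 0 ∧ P j up * fderiv ℝ q up * P j up = μ • P j up) :
    ∃ C θ ε : ℝ, 0 < C ∧ 0 < θ ∧ 0 < ε ∧ ∀ (T B : ℝ) (K : Set E) (W W₁ Wt w : ℝ → ℝ → E)
      (d : ℝ → ℝ), PerturbedSolution O K a q U₀ U₁ U₂ T B W W₁ Wt w d →
      (∀ t ∈ Icc 0 T, ∀ x, ‖W t x - U₀ x‖ ≤ ε) → (∀ t ∈ Icc 0 T, ∀ x, ‖W₁ t x - U₁ x‖ ≤ ε) →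
      (∀ t ∈ Icc 0 T, |d t| ≤ ε) →
      ContinuousOn (fun t => ∫ x, ‖W t x - U₀ x‖ ^ 2) (Icc 0 T) → ContinuousOn d (Icc 0 T) →
      ∀ t ∈ Icc 0 T, (∫ x, ‖W t x - U₀ x‖ ^ 2) + (∫ x, ‖W₁ t x - U₁ x‖ ^ 2) + (∫ x, ‖w t x‖ ^ 2)
        ≤ C * Real.exp (-θ * t) * ((∫ x, ‖W 0 x - U₀ x‖ ^ 2) + (∫ x, ‖W₁ 0 x - U₁ x‖ ^ 2)
            + ∫ x, ‖w 0 x‖ ^ 2)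
          + C * ∫ s in (0 : ℝ)..t, Real.exp (-θ * (t - s))
            * ((∫ x, ‖W s x - U₀ x‖ ^ 2) + |d s| ^ 2) := by
  obtain ⟨θ, ρ, ρ', m, c, CD, ε, hθ, hm0, hc, hCD, hε, hρ'c, hρ, hmρ, hρC, hρ'C, hdamp⟩ :=
    exists_damping hs hp hKO hc₀ hlam hm hpl
  set S := profileForm a q lam P U₀ U₁ with hSdef
  set S' := profileFormDeriv a q lam P U₀ U₁ U₂ with hS'def
  have hS : ∀ x, HasDerivAt S (S' x) x := hasDerivAt_profileForm hs hp hKO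
  have hS'c : Continuous S' := continuous_profileFormDeriv hs hp hKO
  have hSc : Continuous S := continuous_iff_continuousAt.2 fun x => (hS x).continuousAt
  have near₀ := fun x => (hdamp x 0 0 0 0 (by simpa using hε.le) (by simpa using hε.le)
    (by simpa using hε.le)).1
  have hSC : ∀ x, ‖S x‖ ≤ CD := fun x => (near₀ x).form_le
  have hS'C : ∀ x, ‖S' x‖ ≤ CD := fun x => (near₀ x).formDeriv_le
  set k := (Fintype.card κ : ℝ) with hk
  have hk0 : 0 ≤ k := by positivity
  set L := ∫ x, (‖U₂ x‖ + ‖U₃ x‖) ^ 2 with hL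
  have hL0 : 0 ≤ L := integral_nonneg fun x => sq_nonneg _
  set L₁ := ∫ x, ‖U₁ x‖ ^ 2 with hL₁
  have hL₁0 : 0 ≤ L₁ := integral_nonneg fun x => sq_nonneg _
  set C₁ := CD + CD * L + (θ + 1 + 3 * CD ^ 2) + 12 * CD ^ 2 + 3 * L₁ with hC₁
  have hC₁0 : 0 < C₁ := by positivity
  -- Small enough for two purposes: `4 CD² η ≤ 1` closes the interpolation when `w` is replaced by
  -- `y`, and `4 C₁ η ≤ c` lets the damping absorb the `v` terms.
  set η := 1 / (4 * CD ^ 2 + 4 * C₁ / c) with hη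
  have hη0 : 0 < η := by positivity
  have hden : 0 < 4 * CD ^ 2 + 4 * C₁ / c := by positivity
  have hη1 : 4 * CD ^ 2 * η ≤ 1 := by
    rw [hη, mul_one_div, div_le_one hden]
    have : 0 ≤ 4 * C₁ / c := by positivity
    linarith
  have hη2 : C₁ * (4 * η) ≤ c := by
    have h1 : 4 * C₁ / c * η ≤ 1 := by
      rw [hη, mul_one_div, div_le_one hden]
      have : 0 ≤ 4 * CD ^ 2 := by positivity
      linarith
    rw [div_mul_eq_mul_div, div_le_one hc] at h1
    linarith
  set C₂ := C₁ + C₁ / (2 * η) with hC₂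
  have hC₂0 : 0 < C₂ := by positivity
  -- `C₃` bounds the `H²` norm by the energy and `C₄` the energy by the `H²` norm; `C₂` is the
  -- constant in the production bound.
  set C₃ := (1 + (1 + 2 * CD ^ 2) / (2 * η)) + (2 + (1 + 2 * CD ^ 2) * (4 * η)) * ((k + 1) / m)
    with hC₃
  have hC₃0 : 0 < C₃ := by positivity
  set C₄ := 1 + 2 * k * CD ^ 3 + 2 * k * CD ^ 5 with hC₄
  have hC₄0 : 0 < C₄ := by positivity
  -- The bound by `CD` provides `|d| ≤ CD`, which the undifferentiated energy requires.
  refine ⟨C₃ * (C₄ + C₂), θ, min ε CD, by positivity, hθ, lt_min hε hCD, ?_⟩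
  intro T B K W W₁ Wt w d H hU hv hd hXc hdc t ht
  have h0T : (0 : ℝ) ∈ Icc 0 T := ⟨le_rfl, ht.1.trans ht.2⟩
  have near : ∀ τ ∈ Icc 0 T, ∀ x, NearProfile O a q lam P U₀ U₁ U₂ U₃ CD x (W τ x - U₀ x)
      (W₁ τ x - U₁ x) (d τ) ∧ ∑ j, fieldDensity a q lam P (S x) (S' x) θ (ρ j x) (ρ' j x) j (U₂ x)
        (U₃ x) (W τ x) (W₁ τ x) (W₁ τ x - U₁ x) (w τ x) (d τ)
      ≤ -c * ‖w τ x + S x (W₁ τ x - U₁ x)‖ ^ 2 + CD * (‖W τ x - U₀ x‖ ^ 2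
        + ‖W₁ τ x - U₁ x‖ ^ 2 + d τ ^ 2 * (‖U₂ x‖ + ‖U₃ x‖) ^ 2) := fun τ hτ x => by
    have h := hdamp x (W τ x - U₀ x) (W₁ τ x - U₁ x) (w τ x) (d τ)
      ((hU τ hτ x).trans (min_le_left _ _)) ((hv τ hτ x).trans (min_le_left _ _))
      ((hd τ hτ).trans (min_le_left _ _))
    simp only [add_sub_cancel] at h
    exact h
  obtain ⟨X, hX⟩ : ∃ X : ℝ → ℝ, ∀ τ, X τ = ∫ x, ‖W τ x - U₀ x‖ ^ 2 := ⟨_, fun _ => rfl⟩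
  obtain ⟨V, hV⟩ : ∃ V : ℝ → ℝ, ∀ τ, V τ = ∫ x, ‖W₁ τ x - U₁ x‖ ^ 2 := ⟨_, fun _ => rfl⟩
  obtain ⟨Z, hZ⟩ : ∃ Z : ℝ → ℝ, ∀ τ, Z τ = ∫ x, ‖w τ x‖ ^ 2 := ⟨_, fun _ => rfl⟩
  obtain ⟨Y, hY⟩ : ∃ Y : ℝ → ℝ, ∀ τ, Y τ = ∫ x, ‖w τ x + S x (W₁ τ x - U₁ x)‖ ^ 2 :=
    ⟨_, fun _ => rfl⟩
  obtain ⟨F, hF⟩ : ∃ F : κ → ℝ → ℝ, ∀ j τ, F j τ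
      = ∫ x, ρ j x * ‖P j (W τ x) (w τ x + S x (W₁ τ x - U₁ x))‖ ^ 2 := ⟨_, fun _ _ => rfl⟩
  obtain ⟨D, hD⟩ : ∃ D : κ → ℝ → ℝ, ∀ j τ, D j τ
      = ∫ x, fieldDensity a q lam P (S x) (S' x) θ (ρ j x) (ρ' j x) j (U₂ x)
        (U₃ x) (W τ x) (W₁ τ x) (W₁ τ x - U₁ x) (w τ x) (d τ) := ⟨_, fun _ _ => rfl⟩
  obtain ⟨D₀, hD₀⟩ : ∃ D₀ : ℝ → ℝ, ∀ τ, D₀ τ = ∫ x, (θ * ‖W τ x - U₀ x‖ ^ 2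
      + 2 * inner ℝ (W τ x - U₀ x) (Wt τ x)) := ⟨_, fun _ => rfl⟩
  -- integrability
  have mU : ∀ τ ∈ Icc 0 T, MemLp (fun x => W τ x - U₀ x) 2 volume := fun τ hτ => H.l2Bdd.memLp ⟨τ, hτ⟩
  have mv : ∀ τ ∈ Icc 0 T, MemLp (fun x => W₁ τ x - U₁ x) 2 volume := fun τ hτ =>
    H.l2Bdd₁.memLp ⟨τ, hτ⟩
  have mw : ∀ τ ∈ Icc 0 T, MemLp (w τ) 2 volume := fun τ hτ => H.l2Bdd₂.memLp ⟨τ, hτ⟩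
  have by0 : L2Bdd fun (τ : Icc 0 T) x => w τ x + S x (W₁ τ x - U₁ x) :=
    H.l2Bdd₂.add (H.l2Bdd₁.clm (fun _ => aestronglyMeasurable_of_continuous hSc) CD fun _ => hSC)
  have my : ∀ τ ∈ Icc 0 T, MemLp (fun x => w τ x + S x (W₁ τ x - U₁ x)) 2 volume := fun τ hτ =>
    by0.memLp ⟨τ, hτ⟩
  have iU : ∀ τ ∈ Icc 0 T, Integrable (fun x => ‖W τ x - U₀ x‖ ^ 2) volume := fun τ hτ =>
    (mU τ hτ).norm.integrable_sq
  have iv : ∀ τ ∈ Icc 0 T, Integrable (fun x => ‖W₁ τ x - U₁ x‖ ^ 2) volume := fun τ hτ =>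
    (mv τ hτ).norm.integrable_sq
  have iw : ∀ τ ∈ Icc 0 T, Integrable (fun x => ‖w τ x‖ ^ 2) volume := fun τ hτ =>
    (mw τ hτ).norm.integrable_sq
  have iy : ∀ τ ∈ Icc 0 T, Integrable (fun x => ‖w τ x + S x (W₁ τ x - U₁ x)‖ ^ 2) volume :=
    fun τ hτ => (my τ hτ).norm.integrable_sq
  have iL : Integrable (fun x => (‖U₂ x‖ + ‖U₃ x‖) ^ 2) volume :=
    (hp.memLp₂.norm.add hp.memLp₃.norm).integrable_sq
  have iF : ∀ j, ∀ τ ∈ Icc 0 T, Integrable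
      (fun x => ρ j x * ‖P j (W τ x) (w τ x + S x (W₁ τ x - U₁ x))‖ ^ 2) volume := fun j τ hτ => by
    obtain ⟨CP, -, hCP⟩ := H.jet.exists_bound (hs.smooth_P j)
    have h1 := (by0.clm (fun s => aestronglyMeasurable_of_continuous
      (H.jet.continuous_comp (hs.smooth_P j) s)) CP hCP).memLp ⟨τ, hτ⟩
    exact integrable_mul_of_bdd h1.norm.integrable_sq
      (continuous_iff_continuousAt.2 fun x => (hρ j x).continuousAt) (hρC j)
  have hX0 : ∀ τ, 0 ≤ X τ := fun τ => by rw [hX]; exact integral_nonneg fun x => sq_nonneg _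
  have hV0 : ∀ τ, 0 ≤ V τ := fun τ => by rw [hV]; exact integral_nonneg fun x => sq_nonneg _
  have hZ0 : ∀ τ, 0 ≤ Z τ := fun τ => by rw [hZ]; exact integral_nonneg fun x => sq_nonneg _
  have hY0 : ∀ τ, 0 ≤ Y τ := fun τ => by rw [hY]; exact integral_nonneg fun x => sq_nonneg _
  -- comparison of the norms
  have hZY : ∀ τ ∈ Icc 0 T, Z τ ≤ 2 * Y τ + 2 * CD ^ 2 * V τ := fun τ hτ => by
    rw [hZ, hY, hV, ← integral_const_mul, ← integral_const_mul,
      ← integral_add ((iy τ hτ).const_mul _) ((iv τ hτ).const_mul _)]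
    refine integral_mono (iw τ hτ) (((iy τ hτ).const_mul _).add ((iv τ hτ).const_mul _)) fun x => ?_
    simp only
    have h1 : ‖w τ x‖ ≤ ‖w τ x + S x (W₁ τ x - U₁ x)‖ + CD * ‖W₁ τ x - U₁ x‖ := by
      have h2 := norm_sub_le (w τ x + S x (W₁ τ x - U₁ x)) (S x (W₁ τ x - U₁ x))
      rw [add_sub_cancel_right] at h2
      linarith [(S x).le_of_opNorm_le (hSC x) (W₁ τ x - U₁ x)]
    have h3 := pow_le_pow_left₀ (norm_nonneg _) h1 2
    nlinarith [sq_nonneg (‖w τ x + S x (W₁ τ x - U₁ x)‖ - CD * ‖W₁ τ x - U₁ x‖)]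
  have hYZ : ∀ τ ∈ Icc 0 T, Y τ ≤ 2 * Z τ + 2 * CD ^ 2 * V τ := fun τ hτ => by
    rw [hZ, hY, hV, ← integral_const_mul, ← integral_const_mul,
      ← integral_add ((iw τ hτ).const_mul _) ((iv τ hτ).const_mul _)]
    refine integral_mono (iy τ hτ) (((iw τ hτ).const_mul _).add ((iv τ hτ).const_mul _)) fun x => ?_
    simp only
    have h1 : ‖w τ x + S x (W₁ τ x - U₁ x)‖ ≤ ‖w τ x‖ + CD * ‖W₁ τ x - U₁ x‖ :=
      (norm_add_le _ _).trans (by gcongr; exact (S x).le_of_opNorm_le (hSC x) (W₁ τ x - U₁ x))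
    have h3 := pow_le_pow_left₀ (norm_nonneg _) h1 2
    nlinarith [sq_nonneg (‖w τ x‖ - CD * ‖W₁ τ x - U₁ x‖)]
  have hVY : ∀ τ ∈ Icc 0 T, V τ ≤ 4 * η * Y τ + X τ / (2 * η) := fun τ hτ => by
    refine interpolation_le (hX0 τ) (hV0 τ) (hZ0 τ) hη0 ?_ (hZY τ hτ) hη1
    rw [hX, hV, hZ]
    exact H.integral_norm_sq_deriv_sq_le hp ⟨τ, hτ⟩
  have hFY : ∀ τ ∈ Icc 0 T, m * Y τ ≤ (k + 1) * ∑ j, F j τ := fun τ hτ => by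
    simp only [hF, hY]
    rw [← integral_finsetSum _ fun j _ => iF j τ hτ, ← integral_const_mul, ← integral_const_mul]
    refine integral_mono ((iy τ hτ).const_mul _)
      ((integrable_finsetSum _ fun j _ => iF j τ hτ).const_mul _) fun x => ?_
    simp only
    set z := w τ x + S x (W₁ τ x - U₁ x)
    have hu : W τ x ∈ O := H.jet.subset (H.jet.mem ⟨τ, hτ⟩ x)
    have e : z = ∑ j, P j (W τ x) z := by
      rw [← sum_apply, hs.sum_eq_one _ hu, one_apply_eq_self]
    have h1 : ‖z‖ ^ 2 ≤ (∑ j, ‖P j (W τ x) z‖) ^ 2 := by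
      conv_lhs => rw [e]
      gcongr
      exact norm_sum_le _ _
    have h2 : (∑ j, ‖P j (W τ x) z‖) ^ 2 ≤ k * ∑ j, ‖P j (W τ x) z‖ ^ 2 := by
      have := sq_sum_le_card_mul_sum_sq (s := Finset.univ) (f := fun j => ‖P j (W τ x) z‖)
      rwa [Finset.card_univ] at this
    have h3 : m * ∑ j, ‖P j (W τ x) z‖ ^ 2 ≤ ∑ j, ρ j x * ‖P j (W τ x) z‖ ^ 2 := by
      rw [Finset.mul_sum]
      exact Finset.sum_le_sum fun j _ => by gcongr; exact hmρ j x
    have h4 : 0 ≤ ∑ j, ‖P j (W τ x) z‖ ^ 2 := Finset.sum_nonneg fun _ _ => sq_nonneg _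
    calc m * ‖z‖ ^ 2 ≤ m * (k * ∑ j, ‖P j (W τ x) z‖ ^ 2) := by gcongr; exact h1.trans h2
      _ ≤ (k + 1) * (m * ∑ j, ‖P j (W τ x) z‖ ^ 2) := by
        have : 0 ≤ m * ∑ j, ‖P j (W τ x) z‖ ^ 2 := by positivity
        linarith
      _ ≤ _ := by gcongr
  have hF0 : ∀ τ ∈ Icc 0 T, 0 ≤ ∑ j, F j τ := fun τ hτ => by
    have h1 := (mul_nonneg hm0.le (hY0 τ)).trans (hFY τ hτ)
    exact nonneg_of_mul_nonneg_right h1 (by positivity)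
  have hFle : ∀ τ ∈ Icc 0 T, ∑ j, F j τ ≤ k * CD ^ 3 * Y τ := fun τ hτ => by
    have h1 : ∀ j ∈ Finset.univ, F j τ ≤ CD ^ 3 * Y τ := fun j _ => by
      rw [hF, hY, ← integral_const_mul]
      refine integral_mono (iF j τ hτ) ((iy τ hτ).const_mul _) fun x => ?_
      simp only
      have h2 := (near τ hτ x).1.proj_le j
      rw [add_sub_cancel] at h2
      have h3 := (P j (W τ x)).le_of_opNorm_le h2 (w τ x + S x (W₁ τ x - U₁ x))
      calc ρ j x * ‖P j (W τ x) (w τ x + S x (W₁ τ x - U₁ x))‖ ^ 2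
          ≤ CD * (CD * ‖w τ x + S x (W₁ τ x - U₁ x)‖) ^ 2 := by
            gcongr
            exact (le_abs_self _).trans (hρC j x)
        _ = _ := by ring
    refine (Finset.sum_le_sum h1).trans (le_of_eq ?_)
    rw [Finset.sum_const, nsmul_eq_mul, Finset.card_univ, mul_assoc]
  -- the energy identities
  have en := fun j => H.field_energy hs hp hS hS'c hSC hS'C (hρ j) (hρ'c j) (hρC j) (hρ'C j) θ j ht
  have iD : ∀ j, ∀ τ ∈ Icc 0 T, Integrable (fun x => fieldDensity a q lam P (S x) (S' x) θ (ρ j x)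
      (ρ' j x) j (U₂ x) (U₃ x) (W τ x) (W₁ τ x) (W₁ τ x - U₁ x) (w τ x) (d τ)) volume :=
    fun j => (en j).1
  have iiD : ∀ j, IntervalIntegrable (fun τ => Real.exp (θ * τ) * D j τ) volume 0 t := fun j => by
    simp only [hD]
    exact (en j).2.1
  have eD : ∀ j, Real.exp (θ * t) * F j t - F j 0 = ∫ τ in (0 : ℝ)..t, Real.exp (θ * τ) * D j τ :=
    fun j => by
      simp only [hD, hF]
      exact (en j).2.2
  have en₀ := H.base_energy hp θ ht
  simp only [← hX, ← hD₀] at en₀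
  -- All `v` terms are bounded by `C₁ V`, and interpolation trades this for at most the damping `c
  -- Y` plus a multiple of `X`, so `Y` and `V` cancel from the balance.
  have hprod : ∀ τ ∈ Icc 0 T, ∑ j, D j τ + D₀ τ ≤ C₂ * (X τ + |d τ| ^ 2) := fun τ hτ => by
    have h1 : ∑ j, D j τ ≤ -c * Y τ + CD * (X τ + V τ + d τ ^ 2 * L) := by
      simp only [hD]
      have i1 := (iU τ hτ).add (iv τ hτ)
      have i2 : Integrable (fun x => ‖W τ x - U₀ x‖ ^ 2 + ‖W₁ τ x - U₁ x‖ ^ 2) volume := i1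
      have i3 : Integrable (fun x => ‖W τ x - U₀ x‖ ^ 2 + ‖W₁ τ x - U₁ x‖ ^ 2
        + d τ ^ 2 * (‖U₂ x‖ + ‖U₃ x‖) ^ 2) volume := i2.add (iL.const_mul _)
      rw [← integral_finsetSum _ fun j _ => iD j τ hτ, hX, hV, hY, hL, ← integral_const_mul,
        ← integral_const_mul, ← integral_add (iU τ hτ) (iv τ hτ),
        ← integral_add i2 (iL.const_mul _), ← integral_const_mul,
        ← integral_add ((iy τ hτ).const_mul _) (i3.const_mul _)]
      exact integral_mono (integrable_finsetSum _ fun j _ => iD j τ hτ)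
        (((iy τ hτ).const_mul _).add (i3.const_mul _)) fun x => (near τ hτ x).2
    have h2 : D₀ τ ≤ (θ + 1 + 3 * CD ^ 2) * X τ + 12 * CD ^ 2 * V τ + d τ ^ 2 * (3 * L₁) := by
      rw [hD₀, hX, hV]
      refine H.base_density_le hp (t := ⟨τ, hτ⟩) (fun x => ?_) ((hd τ hτ).trans (min_le_right _ _))
      have h3 := (near τ hτ x).1.res₀_le
      rwa [add_sub_cancel, add_sub_cancel] at h3
    have h3 : C₁ * V τ ≤ c * Y τ + C₁ / (2 * η) * X τ := by
      calc C₁ * V τ ≤ C₁ * (4 * η * Y τ + X τ / (2 * η)) := by gcongr; exact hVY τ hτ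
        _ = C₁ * (4 * η) * Y τ + C₁ / (2 * η) * X τ := by ring
        _ ≤ _ := by gcongr; exact hY0 τ
    have h4 : (CD + 12 * CD ^ 2) * V τ ≤ C₁ * V τ := by
      gcongr
      · exact hV0 τ
      · rw [hC₁]
        have : 0 ≤ CD * L + (θ + 1 + 3 * CD ^ 2) + 3 * L₁ := by positivity
        linarith
    have h5 : (CD + (θ + 1 + 3 * CD ^ 2)) * X τ ≤ C₁ * X τ := by
      gcongr
      · exact hX0 τ
      · rw [hC₁]
        have : 0 ≤ CD * L + 12 * CD ^ 2 + 3 * L₁ := by positivity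
        linarith
    have h6 : (CD * L + 3 * L₁) * d τ ^ 2 ≤ C₂ * d τ ^ 2 := by
      gcongr
      rw [hC₂, hC₁]
      have : 0 ≤ CD + (θ + 1 + 3 * CD ^ 2) + 12 * CD ^ 2 := by positivity
      have : 0 ≤ C₁ / (2 * η) := by positivity
      linarith
    rw [sq_abs, mul_add]
    have h7 : C₂ * X τ = C₁ * X τ + C₁ / (2 * η) * X τ := by rw [hC₂, add_mul]
    linarith
  have hXc' : ContinuousOn X (Icc 0 T) := hXc.congr fun τ _ => hX τ
  have hfc : ContinuousOn (fun τ => X τ + |d τ| ^ 2) (Icc 0 T) := hXc'.add (hdc.abs.pow 2)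
  have hsub : uIcc 0 t ⊆ Icc 0 T := by
    rw [uIcc_of_le ht.1]
    exact Icc_subset_Icc_right ht.2
  have iR : IntervalIntegrable (fun τ => Real.exp (θ * τ) * (C₂ * (X τ + |d τ| ^ 2))) volume 0 t :=
    ContinuousOn.intervalIntegrable ((Continuous.continuousOn (by fun_prop)).mul
      ((hfc.mono hsub).const_smul C₂))
  have hineq : Real.exp (θ * t) * (∑ j, F j t + X t) - (∑ j, F j 0 + X 0)
      ≤ ∫ τ in (0 : ℝ)..t, Real.exp (θ * τ) * (C₂ * (X τ + |d τ| ^ 2)) := by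
    have e1 : Real.exp (θ * t) * (∑ j, F j t + X t) - (∑ j, F j 0 + X 0)
        = ∑ j, (Real.exp (θ * t) * F j t - F j 0) + (Real.exp (θ * t) * X t - X 0) := by
      rw [Finset.sum_sub_distrib, ← Finset.mul_sum]
      ring
    have i4 : IntervalIntegrable (fun τ => ∑ j, Real.exp (θ * τ) * D j τ) volume 0 t := by
      have := IntervalIntegrable.sum Finset.univ fun j _ => iiD j
      have e : (fun τ => ∑ j, Real.exp (θ * τ) * D j τ)
          = ∑ j, fun τ => Real.exp (θ * τ) * D j τ := by
        funext τ
        rw [Finset.sum_apply]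
      rw [e]
      exact this
    rw [e1, en₀.2]
    simp only [eD]
    rw [← intervalIntegral.integral_finsetSum fun j _ => iiD j,
      ← intervalIntegral.integral_add i4 en₀.1]
    refine intervalIntegral.integral_mono_on ht.1 (i4.add en₀.1) iR fun τ hτ => ?_
    rw [← Finset.mul_sum, ← mul_add]
    gcongr
    exact hprod τ ⟨hτ.1, hτ.2.trans ht.2⟩
  -- conclusion
  simp only [← hX, ← hV, ← hZ]
  set I := ∫ s in (0 : ℝ)..t, Real.exp (-θ * (t - s)) * (X s + |d s| ^ 2) with hI
  have hI0 : 0 ≤ I := intervalIntegral.integral_nonneg ht.1 fun s _ => by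
    have := hX0 s
    positivity
  have hconv : Real.exp (-θ * t) * ∫ τ in (0 : ℝ)..t, Real.exp (θ * τ) * (C₂ * (X τ + |d τ| ^ 2))
      = C₂ * I := by
    rw [hI, ← intervalIntegral.integral_const_mul, ← intervalIntegral.integral_const_mul]
    refine intervalIntegral.integral_congr fun s _ => ?_
    show Real.exp (-θ * t) * (Real.exp (θ * s) * (C₂ * (X s + |d s| ^ 2)))
      = C₂ * (Real.exp (-θ * (t - s)) * (X s + |d s| ^ 2))
    rw [show -θ * (t - s) = -θ * t + θ * s by ring, Real.exp_add]
    ring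
  have hexp : Real.exp (-θ * t) * Real.exp (θ * t) = 1 := by
    rw [← Real.exp_add]
    simp
  have hE : ∑ j, F j t + X t ≤ Real.exp (-θ * t) * (∑ j, F j 0 + X 0) + C₂ * I := by
    have h1 := mul_le_mul_of_nonneg_left hineq (Real.exp_pos (-θ * t)).le
    rw [hconv, mul_sub, ← mul_assoc, hexp, one_mul] at h1
    linarith
  have hE0 : ∑ j, F j 0 + X 0 ≤ C₄ * (X 0 + V 0 + Z 0) := by
    have h1 := hFle 0 h0T
    have h2 : k * CD ^ 3 * Y 0 ≤ k * CD ^ 3 * (2 * Z 0 + 2 * CD ^ 2 * V 0) := by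
      gcongr
      exact hYZ 0 h0T
    have h3 : C₄ * (X 0 + V 0 + Z 0) - (X 0 + k * CD ^ 3 * (2 * Z 0 + 2 * CD ^ 2 * V 0))
        = (2 * k * CD ^ 3 + 2 * k * CD ^ 5) * X 0 + (1 + 2 * k * CD ^ 3) * V 0
          + (1 + 2 * k * CD ^ 5) * Z 0 := by
      rw [hC₄]; ring
    have h4 : 0 ≤ (2 * k * CD ^ 3 + 2 * k * CD ^ 5) * X 0 := mul_nonneg (by positivity) (hX0 0)
    have h5 : 0 ≤ (1 + 2 * k * CD ^ 3) * V 0 := mul_nonneg (by positivity) (hV0 0)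
    have h6 : 0 ≤ (1 + 2 * k * CD ^ 5) * Z 0 := mul_nonneg (by positivity) (hZ0 0)
    linarith
  have hlow : X t + V t + Z t ≤ C₃ * (∑ j, F j t + X t) := by
    have hY1 : Y t ≤ (k + 1) / m * (∑ j, F j t + X t) := by
      have h1 := hFY t ht
      rw [div_mul_eq_mul_div, le_div_iff₀ hm0, mul_comm]
      refine h1.trans ?_
      gcongr
      linarith [hX0 t]
    have h2 := hVY t ht
    have h3 := hZY t ht
    have h4 : (1 + 2 * CD ^ 2) * V t ≤ (1 + 2 * CD ^ 2) * (4 * η * Y t + X t / (2 * η)) := by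
      gcongr
    have h5 : (2 + (1 + 2 * CD ^ 2) * (4 * η)) * Y t
        ≤ (2 + (1 + 2 * CD ^ 2) * (4 * η)) * ((k + 1) / m * (∑ j, F j t + X t)) := by
      gcongr
    have h6 : (1 + (1 + 2 * CD ^ 2) / (2 * η)) * X t
        ≤ (1 + (1 + 2 * CD ^ 2) / (2 * η)) * (∑ j, F j t + X t) := by
      gcongr
      linarith [hF0 t ht]
    have h7 : C₃ * (∑ j, F j t + X t) = (1 + (1 + 2 * CD ^ 2) / (2 * η)) * (∑ j, F j t + X t)
        + (2 + (1 + 2 * CD ^ 2) * (4 * η)) * ((k + 1) / m * (∑ j, F j t + X t)) := by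
      rw [hC₃]; ring
    have h8 : (1 + 2 * CD ^ 2) * (4 * η * Y t + X t / (2 * η))
        = (1 + 2 * CD ^ 2) * (4 * η) * Y t + (1 + 2 * CD ^ 2) / (2 * η) * X t := by ring
    linarith
  have hN0 : 0 ≤ X 0 + V 0 + Z 0 := by linarith [hX0 0, hV0 0, hZ0 0]
  have hfin : C₃ * (∑ j, F j t + X t)
      ≤ C₃ * (Real.exp (-θ * t) * (C₄ * (X 0 + V 0 + Z 0)) + C₂ * I) := by
    refine mul_le_mul_of_nonneg_left (hE.trans ?_) hC₃0.le
    gcongr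
  -- A common constant for the initial and integral terms overshoots the bound by this nonnegative
  -- amount.
  have hrest : 0 ≤ C₃ * (C₂ * (Real.exp (-θ * t) * (X 0 + V 0 + Z 0)) + C₄ * I) := by positivity
  have hsplit : C₃ * (C₄ + C₂) * Real.exp (-θ * t) * (X 0 + V 0 + Z 0) + C₃ * (C₄ + C₂) * I
      = C₃ * (Real.exp (-θ * t) * (C₄ * (X 0 + V 0 + Z 0)) + C₂ * I)
        + C₃ * (C₂ * (Real.exp (-θ * t) * (X 0 + V 0 + Z 0)) + C₄ * I) := by ring
  rw [hsplit]
  linarith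

end Estimate

/-! ### Decay, compactness and spectral data of the profile. -/

section Profile

variable {N : ℕ}

theorem integrable_exp_neg_mul_abs {θ : ℝ} (hθ : 0 < θ) :
    Integrable (fun x : ℝ => Real.exp (-θ * |x|)) volume := by
  rw [← integrableOn_univ, ← Iic_union_Ioi (a := (0 : ℝ))]
  refine IntegrableOn.union ?_ ?_
  · refine (integrableOn_exp_mul_Iic hθ 0).congr_fun (fun x hx => ?_) measurableSet_Iic
    simp only [abs_of_nonpos (mem_Iic.1 hx)]
    ring_nf
  · refine (integrableOn_exp_mul_Ioi (neg_lt_zero.2 hθ) 0).congr_fun (fun x hx => ?_)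
      measurableSet_Ioi
    simp only [abs_of_pos (mem_Ioi.1 hx)]

theorem memLp_two_of_exp_decay {G : Type*} [NormedAddCommGroup G] {f : ℝ → G} (hf : Continuous f)
    {c θ : ℝ} (hθ : 0 < θ) (h : ∀ x, x ≠ 0 → ‖f x‖ ≤ c * Real.exp (-θ * |x|)) :
    MemLp f 2 volume := by
  have hc : Continuous fun x : ℝ => c * Real.exp (-θ * |x|) := by fun_prop
  have h1 : MemLp (fun x : ℝ => c * Real.exp (-θ * |x|)) 2 volume := by
    rw [memLp_two_iff_integrable_sq hc.aestronglyMeasurable]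
    refine ((integrable_exp_neg_mul_abs (θ := 2 * θ) (by positivity)).const_mul (c ^ 2)).congr
      (.of_forall fun x => ?_)
    simp only [mul_pow, ← Real.exp_nat_mul]
    ring_nf
  refine h1.mono hf.aestronglyMeasurable ?_
  have h0 : ∀ᵐ x : ℝ, x ≠ 0 := by simp [ae_iff]
  filter_upwards [h0] with x hx
  exact (h x hx).trans (Real.le_norm_self _)

theorem tendsto_mul_exp_neg_abs {l : Filter ℝ} (hl : Tendsto (fun x : ℝ => |x|) l atTop) {θ : ℝ}
    (hθ : 0 < θ) (c : ℝ) : Tendsto (fun x : ℝ => c * Real.exp (-θ * |x|)) l (𝓝 0) := by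
  have h1 : Tendsto (fun x : ℝ => Real.exp (-(θ * |x|))) l (𝓝 0) :=
    Real.tendsto_exp_neg_atTop_nhds_zero.comp (hl.const_mul_atTop hθ)
  simpa using h1.const_mul c

variable {𝒰 : Set (StateSpace N)} {A : StateSpace N → Matrix (Fin N) (Fin N) ℝ}
  {q : StateSpace N → StateSpace N} {Ubar : ℝ → StateSpace N} {Uminus Uplus : StateSpace N}

theorem iteratedDeriv_succ_sub_const (f : ℝ → StateSpace N) (z : StateSpace N) (k : ℕ) :
    iteratedDeriv (k + 1) (fun y => f y - z) = iteratedDeriv (k + 1) f := by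
  rw [iteratedDeriv_succ', iteratedDeriv_succ']
  congr 1
  funext y
  exact deriv_sub_const z

namespace IsProfile

variable (h : IsProfile 𝒰 A q Ubar Uminus Uplus)

include h

theorem hasDerivAt_iteratedDeriv (k : ℕ) (x : ℝ) :
    HasDerivAt (iteratedDeriv k Ubar) (iteratedDeriv (k + 1) Ubar x) x := by
  rw [iteratedDeriv_succ]
  exact ((h.smooth.differentiable_iteratedDeriv k (by exact_mod_cast WithTop.coe_lt_top _))
    x).hasDerivAt

theorem continuous_iteratedDeriv (k : ℕ) : Continuous (iteratedDeriv k Ubar) :=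
  continuous_iff_continuousAt.2 fun x => (h.hasDerivAt_iteratedDeriv k x).continuousAt

theorem exists_decay (k : ℕ) : ∃ c θ : ℝ, 0 < θ ∧
    ∀ x, x ≠ 0 → ‖iteratedDeriv (k + 1) Ubar x‖ ≤ c * Real.exp (-θ * |x|) := by
  obtain ⟨c, θ, hθ, hp, hm⟩ := h.decay (k + 1)
  simp only [iteratedDeriv_succ_sub_const] at hp hm
  exact ⟨c, θ, hθ, fun x hx => (lt_or_gt_of_ne hx).elim (hm x) (hp x)⟩

theorem memLp_iteratedDeriv (k : ℕ) : MemLp (iteratedDeriv (k + 1) Ubar) 2 volume := by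
  obtain ⟨c, θ, hθ, hc⟩ := h.exists_decay k
  exact memLp_two_of_exp_decay (h.continuous_iteratedDeriv _) hθ hc

theorem exists_norm_iteratedDeriv_le (k : ℕ) : ∃ C, ∀ x, ‖iteratedDeriv (k + 1) Ubar x‖ ≤ C := by
  obtain ⟨c, θ, hθ, hc⟩ := h.exists_decay k
  -- The decay estimates exclude `x = 0`, so the value there enters the bound separately.
  refine ⟨max |c| ‖iteratedDeriv (k + 1) Ubar 0‖, fun x => ?_⟩
  rcases eq_or_ne x 0 with rfl | hx
  · exact le_max_right _ _
  · refine (hc x hx).trans (le_trans ?_ (le_max_left _ _))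
    calc c * Real.exp (-θ * |x|) ≤ |c| * 1 := by
          gcongr
          · exact le_abs_self c
          · rw [Real.exp_le_one_iff]
            have := abs_nonneg x
            nlinarith
      _ = |c| := mul_one _

theorem tendsto_plus : Tendsto Ubar atTop (𝓝 Uplus) := by
  obtain ⟨c, θ, hθ, hp, -⟩ := h.decay 0
  simp only [iteratedDeriv_zero] at hp
  rw [tendsto_iff_norm_sub_tendsto_zero]
  refine squeeze_zero' (.of_forall fun x => norm_nonneg _) ?_
    (tendsto_mul_exp_neg_abs tendsto_abs_atTop_atTop hθ c)
  filter_upwards [eventually_gt_atTop 0] with x hx using hp x hx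

theorem tendsto_minus : Tendsto Ubar atBot (𝓝 Uminus) := by
  obtain ⟨c, θ, hθ, -, hm⟩ := h.decay 0
  simp only [iteratedDeriv_zero] at hm
  rw [tendsto_iff_norm_sub_tendsto_zero]
  refine squeeze_zero' (.of_forall fun x => norm_nonneg _) ?_
    (tendsto_mul_exp_neg_abs tendsto_abs_atBot_atTop hθ c)
  filter_upwards [eventually_lt_atBot 0] with x hx using hm x hx

theorem tendsto_deriv {l : Filter ℝ} (hl : Tendsto (fun x : ℝ => |x|) l atTop) :
    Tendsto (iteratedDeriv 1 Ubar) l (𝓝 0) := by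
  obtain ⟨c, θ, hθ, hc⟩ := h.exists_decay 0
  rw [tendsto_zero_iff_norm_tendsto_zero]
  refine squeeze_zero' (.of_forall fun x => norm_nonneg _) ?_ (tendsto_mul_exp_neg_abs hl hθ c)
  filter_upwards [hl.eventually_gt_atTop 0] with x hx using hc x (abs_pos.1 hx)

/-- An ultrafilter converging to a point of the closure is pulled back to the line. It either tends
to one of the two infinities, giving an end state, or contains a compact set, giving a value of the
profile. Hence the closure stays in `𝒰`. -/
theorem closure_range_subset : closure (range Ubar) ⊆ insert Uminus (insert Uplus (range Ubar)) := by
  intro z hz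
  obtain ⟨F, hF, hFz⟩ := mem_closure_iff_ultrafilter.1 hz
  obtain ⟨G, rfl⟩ : ∃ G : Ultrafilter ℝ, G.map Ubar = F := by
    have hne : (comap Ubar (F : Filter (StateSpace N))).NeBot := comap_neBot_iff_frequently.2 <|
      (show ∀ᶠ y in (F : Filter (StateSpace N)), y ∈ range Ubar from hF).frequently
    refine ⟨Ultrafilter.of (comap Ubar F), ?_⟩
    refine Ultrafilter.coe_le_coe.1 ?_
    exact (map_mono (Ultrafilter.of_le _)).trans map_comap_le
  have hT : Tendsto Ubar G (𝓝 z) := hFz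
  by_cases hco : (G : Filter ℝ) ≤ cocompact ℝ
  · rw [cocompact_eq_atBot_atTop] at hco
    rcases Ultrafilter.le_sup_iff.1 hco with hb | hb
    · exact Or.inl (tendsto_nhds_unique hT (h.tendsto_minus.mono_left hb))
    · exact Or.inr (Or.inl (tendsto_nhds_unique hT (h.tendsto_plus.mono_left hb)))
  · obtain ⟨s, hs, hsG⟩ : ∃ s : Set ℝ, IsCompact s ∧ s ∈ G := by
      by_contra hcon
      refine hco fun t ht => ?_
      obtain ⟨s, hs, hst⟩ := mem_cocompact.1 ht
      have h1 : sᶜ ∈ G := Ultrafilter.compl_mem_iff_notMem.2 fun h2 => hcon ⟨s, hs, h2⟩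
      exact mem_of_superset h1 hst
    obtain ⟨x, -, hx⟩ := hs.ultrafilter_le_nhds G (le_principal_iff.2 hsG)
    refine Or.inr (Or.inr ⟨x, ?_⟩)
    exact tendsto_nhds_unique ((h.smooth.continuous.tendsto x).mono_left hx) hT

theorem isCompact_closure_range : IsCompact (closure (range Ubar)) := by
  refine Bornology.IsBounded.isCompact_closure ?_
  obtain ⟨c, θ, hθ, hp, hm⟩ := h.decay 0
  simp only [iteratedDeriv_zero] at hp hm
  refine isBounded_iff_forall_norm_le.2 ⟨|c| + ‖Uplus‖ + ‖Uminus‖ + ‖Ubar 0‖, ?_⟩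
  rintro _ ⟨x, rfl⟩
  have hexp : c * Real.exp (-θ * |x|) ≤ |c| := by
    calc c * Real.exp (-θ * |x|) ≤ |c| * 1 := by
          gcongr
          · exact le_abs_self c
          · rw [Real.exp_le_one_iff]
            have := abs_nonneg x
            nlinarith
      _ = |c| := mul_one _
  have n1 := norm_nonneg Uplus
  have n2 := norm_nonneg Uminus
  have n3 := norm_nonneg (Ubar 0)
  have n4 := abs_nonneg c
  rcases lt_trichotomy x 0 with hx | rfl | hx
  · have h1 := norm_add_le (Ubar x - Uminus) Uminus
    rw [sub_add_cancel] at h1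
    linarith [hm x hx]
  · linarith
  · have h1 := norm_add_le (Ubar x - Uplus) Uplus
    rw [sub_add_cancel] at h1
    linarith [hp x hx]

theorem exists_profileJet : ∃ Cp, ProfileJet (closure (range Ubar))
    (fun u => Matrix.toEuclideanCLM (n := Fin N) (𝕜 := ℝ) (A u)) q Ubar (iteratedDeriv 1 Ubar)
    (iteratedDeriv 2 Ubar) (iteratedDeriv 3 Ubar) Uminus Uplus Cp := by
  obtain ⟨C₁, h₁⟩ := h.exists_norm_iteratedDeriv_le 0
  obtain ⟨C₂, h₂⟩ := h.exists_norm_iteratedDeriv_le 1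
  obtain ⟨C₃, h₃⟩ := h.exists_norm_iteratedDeriv_le 2
  refine ⟨max C₁ (max C₂ C₃), ?_⟩
  exact
  { isCompact := h.isCompact_closure_range
    mem := fun x => subset_closure (mem_range_self x)
    mem_minus := mem_closure_of_tendsto h.tendsto_minus (.of_forall mem_range_self)
    mem_plus := mem_closure_of_tendsto h.tendsto_plus (.of_forall mem_range_self)
    deriv₀ := fun x => by simpa using h.hasDerivAt_iteratedDeriv 0 x
    deriv₁ := h.hasDerivAt_iteratedDeriv 1
    deriv₂ := h.hasDerivAt_iteratedDeriv 2
    continuous₃ := h.continuous_iteratedDeriv 3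
    bound₁ := fun x => (h₁ x).trans (le_max_left _ _)
    bound₂ := fun x => (h₂ x).trans ((le_max_left _ _).trans (le_max_right _ _))
    bound₃ := fun x => (h₃ x).trans ((le_max_right _ _).trans (le_max_right _ _))
    memLp₁ := h.memLp_iteratedDeriv 0
    memLp₂ := h.memLp_iteratedDeriv 1
    memLp₃ := h.memLp_iteratedDeriv 2
    tendsto_minus := h.tendsto_minus
    tendsto_plus := h.tendsto_plus
    tendsto_deriv_minus := h.tendsto_deriv tendsto_abs_atBot_atTop
    tendsto_deriv_plus := h.tendsto_deriv tendsto_abs_atTop_atTop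
    stationary := fun x => by
      rw [iteratedDeriv_one]
      exact h.stationary x }

/-- The spectral data of the profile. -/
theorem exists_spectralSetting (hcoeff : SmoothCoefficients 𝒰 A q)
    (hhyp : StrictlyHyperbolicNoncharacteristic A (closure (range Ubar)))
    (hminus : HighFrequencyStable A q Uminus) (hplus : HighFrequencyStable A q Uplus) :
    ∃ (O : Set (StateSpace N)) (lam : Fin N → StateSpace N → ℝ)
      (P : Fin N → StateSpace N → StateSpace N →L[ℝ] StateSpace N) (c : ℝ),
      closure (range Ubar) ⊆ O ∧ 0 < c ∧
      SpectralSetting O (fun u => Matrix.toEuclideanCLM (n := Fin N) (𝕜 := ℝ) (A u)) q lam P ∧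
      (∀ j x, c ≤ |lam j (Ubar x)|) ∧
      (∀ j, ∃ μ : ℝ, μ < 0 ∧ P j Uminus * fderiv ℝ q Uminus * P j Uminus = μ • P j Uminus) ∧
      ∀ j, ∃ μ : ℝ, μ < 0 ∧ P j Uplus * fderiv ℝ q Uplus * P j Uplus = μ • P j Uplus := by
  have hK : closure (range Ubar) ⊆ 𝒰 := fun z hz => by
    rcases h.closure_range_subset hz with rfl | rfl | ⟨x, rfl⟩
    · exact h.mem_minus
    · exact h.mem_plus
    · exact h.mem x
  obtain ⟨c, hc, hspec⟩ := hhyp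
  have hsimple : ∀ u ∈ closure (range Ubar), ∃ ev, IsSimpleSpectrum (A u) ev ∧ ∀ j, c ≤ |ev j| :=
    fun u hu => by
      obtain ⟨ev, h1, h2, h3⟩ := hspec u hu
      refine ⟨ev, ⟨h1, fun j => ?_⟩, h3⟩
      have h4 := Module.End.hasEigenvalue_iff_isRoot_charpoly _ _ |>.1 (h2 j)
      rwa [Matrix.charpoly_toLin'] at h4
  obtain ⟨O, lam, P, hO, hKO, hOU, hlam, hP, hev, hPdef⟩ := exists_smooth_spectral_resolution
    hcoeff.isOpen hcoeff.smooth_matrix hK fun u hu => (hsimple u hu).imp fun _ h => h.1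
  have hres : ∀ u ∈ O, IsSpectralResolution (Matrix.toEuclideanCLM (n := Fin N) (𝕜 := ℝ) (A u))
      (fun j => lam j u) fun j => P j u := fun u hu => by
    obtain ⟨b, hb⟩ := (hev u hu).exists_basis
    have := isSpectralResolution_specProj (hev u hu).strictMono.injective hb
    convert this using 1
    funext j
    exact hPdef u j
  have hend : ∀ u ∈ O, HighFrequencyStable A q u → ∀ j, ∃ μ : ℝ, μ < 0 ∧
      P j u * fderiv ℝ q u * P j u = μ • P j u := fun u hu hst j => by
    obtain ⟨b, hb⟩ := (hev u hu).exists_basis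
    refine ⟨_, diagonal_neg_of_highFrequencyStable (hev u hu).strictMono.injective hb hst j, ?_⟩
    rw [hPdef, specProj_mul_mul (hev u hu).strictMono.injective hb, jacobianMatrix,
      StarAlgEquiv.apply_symm_apply]
  refine ⟨O, lam, P, c, hKO, hc, ?_, fun j x => ?_, hend _ ?_ hminus, hend _ ?_ hplus⟩
  · exact
    { isOpen := hO
      smooth_a := fun u hu => (contDiffAt_toEuclideanCLM fun i j =>
        (hcoeff.smooth_matrix i j).contDiffAt (hcoeff.isOpen.mem_nhds (hOU hu))).contDiffWithinAt
      smooth_q := hcoeff.smooth_source.mono hOU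
      smooth_lam := hlam
      smooth_P := hP
      injective := fun u hu => (hres u hu).injective
      mul_self := fun u hu => (hres u hu).mul_self
      mul_of_ne := fun u hu => (hres u hu).mul_of_ne
      sum_eq_one := fun u hu => (hres u hu).sum_eq_one
      mul_op := fun u hu => (hres u hu).mul_op }
  · have hu : Ubar x ∈ closure (range Ubar) := subset_closure (mem_range_self x)
    obtain ⟨ev, h1, h2⟩ := hsimple _ hu
    have h3 := congrFun (h1.unique (hev _ (hKO hu))) j
    rw [← h3]
    exact h2 j
  · exact hKO (mem_closure_of_tendsto h.tendsto_minus (.of_forall mem_range_self))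
  · exact hKO (mem_closure_of_tendsto h.tendsto_plus (.of_forall mem_range_self))

end IsProfile

end Profile

/-! ### The solution in the moving frame. -/

section Shift

variable {N : ℕ} {𝒰 : Set (StateSpace N)} {A : StateSpace N → Matrix (Fin N) (Fin N) ℝ}
  {q : StateSpace N → StateSpace N} {T : ℝ} {u : ℝ → ℝ → StateSpace N} {δ : ℝ → ℝ}

namespace IsSolution

theorem hasDerivAt_space (hu : IsSolution 𝒰 A q T u) {t : ℝ} (ht : t ∈ Icc 0 T) (x : ℝ) :
    HasDerivAt (u t) (deriv (u t) x) x := by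
  have h : ContDiff ℝ 1 (u t) :=
    hu.contDiffOn.comp_contDiff (f := fun x => (t, x)) (by fun_prop) fun x => ⟨ht, mem_univ x⟩
  exact (h.differentiable (by simp) x).hasDerivAt

/-- The spatial derivative is the derivative within the strip applied to `(0, 1)`, also at the end
times; `0 < T` makes derivatives within the strip unique. -/
theorem continuousOn_deriv (hu : IsSolution 𝒰 A q T u) (hT : 0 < T) :
    ContinuousOn (Function.uncurry fun t => deriv (u t)) (Icc 0 T ×ˢ univ) := by
  have hU : UniqueDiffOn ℝ (Icc 0 T ×ˢ (univ : Set ℝ)) :=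
    (uniqueDiffOn_Icc hT).prod uniqueDiffOn_univ
  have h1 := (hu.contDiffOn.continuousOn_fderivWithin hU le_rfl).clm_apply
    (continuousOn_const (c := ((0 : ℝ), (1 : ℝ))))
  refine h1.congr fun z hz => ?_
  have h2 := (hu.contDiffOn.differentiableOn (by simp) z hz).hasFDerivWithinAt
  have h3 : HasDerivWithinAt (fun x : ℝ => (z.1, x)) ((0 : ℝ), (1 : ℝ)) univ z.2 :=
    (hasDerivWithinAt_const _ _ _).prodMk (hasDerivWithinAt_id _ _)
  have hm : MapsTo (fun x : ℝ => (z.1, x)) univ (Icc 0 T ×ˢ univ) := fun x _ => ⟨hz.1, mem_univ x⟩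
  have h4 := h2.comp_hasDerivWithinAt z.2 h3 hm
  rw [hasDerivWithinAt_univ] at h4
  exact h4.deriv

theorem continuousOn_shift (hδ : ContinuousOn δ (Icc 0 T)) {G : Type*} [TopologicalSpace G]
    {f : ℝ → ℝ → G} (hf : ContinuousOn (Function.uncurry f) (Icc 0 T ×ˢ univ)) :
    ContinuousOn (Function.uncurry fun t x => f t (x + δ t)) (Icc 0 T ×ˢ univ) := by
  have h1 : ContinuousOn (fun z : ℝ × ℝ => (z.1, z.2 + δ z.1)) (Icc 0 T ×ˢ univ) :=
    continuousOn_fst.prodMk (continuousOn_snd.add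
      (hδ.comp continuousOn_fst fun z hz => hz.1))
  exact hf.comp h1 fun z hz => ⟨hz.1, mem_univ _⟩

/-- The chain rule along the curve `s ↦ (s, x + δ s)`. At interior times the one-sided derivatives
are genuine ones, so the equation identifies the time component. -/
theorem hasDerivAt_shift (hu : IsSolution 𝒰 A q T u) (hδ : ContDiffOn ℝ 1 δ (Icc 0 T)) (x : ℝ)
    {t : ℝ} (ht : t ∈ Ioo 0 T) : HasDerivAt (fun s => u s (x + δ s))
      (residual₀ (fun v => Matrix.toEuclideanCLM (n := Fin N) (𝕜 := ℝ) (A v)) q (u t (x + δ t))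
        (deriv (u t) (x + δ t)) + derivWithin δ (Icc 0 T) t • deriv (u t) (x + δ t)) t := by
  have hI : Icc 0 T ∈ 𝓝 t := Icc_mem_nhds ht.1 ht.2
  have htI : t ∈ Icc 0 T := Ioo_subset_Icc_self ht
  set y := x + δ t with hy
  have hn : Icc 0 T ×ˢ (univ : Set ℝ) ∈ 𝓝 (t, y) := prod_mem_nhds hI univ_mem
  have h1 : HasFDerivAt (Function.uncurry u) (fderiv ℝ (Function.uncurry u) (t, y)) (t, y) :=
    ((hu.contDiffOn.contDiffAt hn).differentiableAt (by simp)).hasFDerivAt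
  set L := fderiv ℝ (Function.uncurry u) (t, y)
  have h2 : HasDerivAt δ (derivWithin δ (Icc 0 T) t) t := by
    rw [derivWithin_of_mem_nhds hI]
    exact ((hδ.contDiffAt hI).differentiableAt (by simp)).hasDerivAt
  have hx : L (0, 1) = deriv (u t) y :=
    (h1.comp_hasDerivAt y ((hasDerivAt_const y t).prodMk (hasDerivAt_id y))).deriv.symm
  have ht' : L (1, 0) = residual₀ (fun v => Matrix.toEuclideanCLM (n := Fin N) (𝕜 := ℝ) (A v)) q
      (u t y) (deriv (u t) y) := by
    have h3 : HasDerivAt (fun s => u s y) (L (1, 0)) t :=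
      h1.comp_hasDerivAt (f := fun s => (s, y)) t ((hasDerivAt_id t).prodMk (hasDerivAt_const t y))
    have h4 := hu.equation t htI y
    rw [derivWithin_of_mem_nhds hI, h3.deriv] at h4
    exact eq_sub_of_add_eq h4
  have h5 : HasDerivAt (fun s => u s (x + δ s)) (L (1, derivWithin δ (Icc 0 T) t)) t :=
    h1.comp_hasDerivAt (f := fun s => (s, x + δ s)) t ((hasDerivAt_id t).prodMk (h2.const_add x))
  have h6 : ((1 : ℝ), derivWithin δ (Icc 0 T) t)
      = (1, 0) + derivWithin δ (Icc 0 T) t • ((0 : ℝ), (1 : ℝ)) := by simp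
  rwa [h6, map_add, map_smul, hx, ht'] at h5

end IsSolution

end Shift

/-! ### Classical derivatives of the shifted perturbation. -/

section ShiftedProfile

variable {N : ℕ} {𝒰 Kp : Set (StateSpace N)} {A : StateSpace N → Matrix (Fin N) (Fin N) ℝ}
  {q : StateSpace N → StateSpace N} {a : StateSpace N → StateSpace N →L[ℝ] StateSpace N}
  {U₀ U₁ U₂ U₃ : ℝ → StateSpace N} {um up : StateSpace N} {Cp T : ℝ} {u : ℝ → ℝ → StateSpace N}

theorem hasDerivAt_shiftedPerturbation (hu : IsSolution 𝒰 A q T u)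
    (hp : ProfileJet Kp a q U₀ U₁ U₂ U₃ um up Cp) {t : ℝ} (ht : t ∈ Icc 0 T) (δ : ℝ → ℝ) (x : ℝ) :
    HasDerivAt (shiftedPerturbation U₀ u δ t) (deriv (u t) (x + δ t) - U₁ x) x :=
  ((hu.hasDerivAt_space ht _).comp_add_const x (δ t)).sub (hp.deriv₀ x)

theorem continuous_shiftedPerturbation_deriv (hu : IsSolution 𝒰 A q T u) (hT : 0 < T)
    (hp : ProfileJet Kp a q U₀ U₁ U₂ U₃ um up Cp) {t : ℝ} (ht : t ∈ Icc 0 T) (δ : ℝ → ℝ) :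
    Continuous fun x => deriv (u t) (x + δ t) - U₁ x :=
  (((hu.continuousOn_deriv hT).slice ht).comp (continuous_add_const (δ t))).sub hp.continuous₁

end ShiftedProfile

/-! ### The theorem. -/

theorem mainTheorem2 (N : ℕ) (𝒰 : Set (StateSpace N))
    (A : StateSpace N → Matrix (Fin N) (Fin N) ℝ) (q : StateSpace N → StateSpace N)
    (Ubar : ℝ → StateSpace N) (Uminus Uplus : StateSpace N)
    (hcoeff : SmoothCoefficients 𝒰 A q)
    (hprofile : IsProfile 𝒰 A q Ubar Uminus Uplus)
    (hhyp : StrictlyHyperbolicNoncharacteristic A (closure (range Ubar)))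
    (hminus : HighFrequencyStable A q Uminus)
    (hplus : HighFrequencyStable A q Uplus) :
    ∃ C θ ε : ℝ, 0 < C ∧ 0 < θ ∧ 0 < ε ∧
      ∀ (T : ℝ) (u : ℝ → ℝ → StateSpace N) (δ : ℝ → ℝ), 0 < T →
        IsSolution 𝒰 A q T u →
        ContDiffOn ℝ 1 δ (Icc 0 T) →
        ContinuousInH 2 T (shiftedPerturbation Ubar u δ) →
        (∀ t ∈ Icc 0 T, hNorm 1 (shiftedPerturbation Ubar u δ t) ≤ ε) →
        (∀ t ∈ Icc 0 T, w1InfNorm (shiftedPerturbation Ubar u δ t) ≤ ENNReal.ofReal ε) →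
        (∀ t ∈ Icc 0 T, |derivWithin δ (Icc 0 T) t| ≤ ε) →
        ∀ t ∈ Icc 0 T,
          hNorm 2 (shiftedPerturbation Ubar u δ t) ^ 2 ≤
            C * Real.exp (-θ * t) * hNorm 2 (shiftedPerturbation Ubar u δ 0) ^ 2 +
            C * ∫ s in (0 : ℝ)..t, Real.exp (-θ * (t - s)) *
              (hNorm 0 (shiftedPerturbation Ubar u δ s) ^ 2 +
                |derivWithin δ (Icc 0 T) s| ^ 2) := by
  obtain ⟨Cp, hp⟩ := hprofile.exists_profileJet
  obtain ⟨O, lam, P, c, hKO, hc, hs, hlam, hm, hpl⟩ :=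
    hprofile.exists_spectralSetting hcoeff hhyp hminus hplus
  obtain ⟨C, θ, ε₁, hC, hθ, hε₁, hmain⟩ := exists_sobolev_estimate hs hp hKO hc hlam hm hpl
  -- Three smallness conditions: `ε₁` for the estimate itself, `ε₂` for the Lipschitz bound that
  -- makes the time derivative square integrable, and `ε₃` so that the solution stays in a compact
  -- neighbourhood of the profile inside `O`.
  obtain ⟨C', hC'⟩ := (eventually_nearProfile hs hp hKO).exists
  obtain ⟨ε₂, hnear, hε₂⟩ := (hC'.and self_mem_nhdsWithin).exists
  obtain ⟨ε₃, hε₃, hcth⟩ := hp.isCompact.exists_cthickening_subset_open hs.isOpen hKO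
  have hε₂ : 0 < ε₂ := hε₂
  refine ⟨C, θ, min ε₁ (min ε₂ ε₃), hC, hθ, by positivity, ?_⟩
  set ε := min ε₁ (min ε₂ ε₃) with hεdef
  have hε : 0 < ε := by positivity
  have e1 : ε ≤ ε₁ := min_le_left _ _
  have e2 : ε ≤ ε₂ := (min_le_right _ _).trans (min_le_left _ _)
  have e3 : ε ≤ ε₃ := (min_le_right _ _).trans (min_le_right _ _)
  intro T u δ hT hu hδ hV _ hsmall hdε
  set V := shiftedPerturbation Ubar u δ with hVdef
  obtain ⟨w, hw⟩ : ∃ w : ℝ → ℝ → StateSpace N, ∀ t ∈ Icc 0 T, StronglyMeasurable (w t) ∧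
      MemLp (V t) 2 volume ∧ MemLp (fun x => deriv (u t) (x + δ t) - iteratedDeriv 1 Ubar x) 2 volume ∧
      MemLp (w t) 2 volume ∧
      IsWeakDeriv (fun x => deriv (u t) (x + δ t) - iteratedDeriv 1 Ubar x) (w t) := by
    have h1 : ∀ t, ∃ w : ℝ → StateSpace N, t ∈ Icc 0 T → StronglyMeasurable w ∧
        MemLp (V t) 2 volume ∧
        MemLp (fun x => deriv (u t) (x + δ t) - iteratedDeriv 1 Ubar x) 2 volume ∧
        MemLp w 2 volume ∧
        IsWeakDeriv (fun x => deriv (u t) (x + δ t) - iteratedDeriv 1 Ubar x) w := fun t => by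
      by_cases ht : t ∈ Icc 0 T
      · obtain ⟨w, hw⟩ := (hV.1 t ht).exists_second_deriv (hasDerivAt_shiftedPerturbation hu hp ht δ)
          (continuous_shiftedPerturbation_deriv hu hT hp ht δ)
        exact ⟨w, fun _ => hw⟩
      · exact ⟨0, fun h => absurd h ht⟩
    choose w hw using h1
    exact ⟨w, fun t => hw t⟩
  have hgV : ∀ t ∈ Icc 0 T, IsWeakDeriv (V t)
      (fun x => deriv (u t) (x + δ t) - iteratedDeriv 1 Ubar x) := fun t ht =>
    isWeakDeriv_of_hasDerivAt (hasDerivAt_shiftedPerturbation hu hp ht δ)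
      (continuous_shiftedPerturbation_deriv hu hT hp ht δ)
  have hpt : ∀ t ∈ Icc 0 T, ∀ x, ‖V t x‖ ≤ ε ∧
      ‖deriv (u t) (x + δ t) - iteratedDeriv 1 Ubar x‖ ≤ ε := fun t ht =>
    norm_le_of_w1InfNorm_le (hasDerivAt_shiftedPerturbation hu hp ht δ)
      (continuous_shiftedPerturbation_deriv hu hT hp ht δ) hε.le (hsmall t ht)
  have htend := hV.tendsto_eLpNorm hgV fun t ht => (hw t ht).2.2.2.2
  have hdc : ContinuousOn (derivWithin δ (Icc 0 T)) (Icc 0 T) :=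
    hδ.continuousOn_derivWithin (uniqueDiffOn_Icc hT) le_rfl
  have b0 : L2Bdd fun t : Icc 0 T => V t :=
    l2Bdd_of_tendsto (fun t ht => (hw t ht).2.1) fun t ht => (htend t ht).1
  have b1 : L2Bdd fun (t : Icc 0 T) x => deriv (u t) (x + δ t) - iteratedDeriv 1 Ubar x :=
    l2Bdd_of_tendsto (F := fun t x => deriv (u t) (x + δ t) - iteratedDeriv 1 Ubar x)
      (fun t ht => (hw t ht).2.2.1) fun t ht => (htend t ht).2.1
  have b2 : L2Bdd fun t : Icc 0 T => w t :=
    l2Bdd_of_tendsto (fun t ht => (hw t ht).2.2.2.1) fun t ht => (htend t ht).2.2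
  have hmem : ∀ t ∈ Icc 0 T, ∀ x, u t (x + δ t) ∈ Metric.cthickening ε₃ (closure (range Ubar)) :=
    fun t ht x => Metric.mem_cthickening_of_dist_le _ (Ubar x) _ _
      (subset_closure (mem_range_self x)) (by
        rw [dist_eq_norm]; exact (hpt t ht x).1.trans e3)
  have cW : ContinuousOn (Function.uncurry fun t x => u t (x + δ t)) (Icc 0 T ×ˢ univ) :=
    IsSolution.continuousOn_shift hδ.continuousOn hu.contDiffOn.continuousOn
  have cW₁ : ContinuousOn (Function.uncurry fun t x => deriv (u t) (x + δ t)) (Icc 0 T ×ˢ univ) :=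
    IsSolution.continuousOn_shift hδ.continuousOn (hu.continuousOn_deriv hT)
  have H : PerturbedSolution O (Metric.cthickening ε₃ (closure (range Ubar)))
      (fun v => Matrix.toEuclideanCLM (n := Fin N) (𝕜 := ℝ) (A v)) q Ubar (iteratedDeriv 1 Ubar)
      (iteratedDeriv 2 Ubar) T (Cp + ε) (fun t x => u t (x + δ t))
      (fun t x => deriv (u t) (x + δ t))
      -- The time derivative is taken to be the right-hand side of the equation. It is thus defined
      -- and continuous up to the end times, the equation holds by definition, and differentiability
      -- is needed only at interior times.
      (fun t x => residual₀ (fun v => Matrix.toEuclideanCLM (n := Fin N) (𝕜 := ℝ) (A v)) q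
        (u t (x + δ t)) (deriv (u t) (x + δ t)) + derivWithin δ (Icc 0 T) t • deriv (u t) (x + δ t))
      w (derivWithin δ (Icc 0 T)) :=
    { jet :=
        { isOpen := hs.isOpen
          isCompact := hp.isCompact.cthickening
          subset := hcth
          mem := fun t x => hmem t t.2 x
          deriv := fun t x => (hu.hasDerivAt_space t.2 _).comp_add_const x (δ t)
          continuous₁ := fun t => cW₁.slice t.2
          bound := fun t x => by
            have h1 := norm_add_le (iteratedDeriv 1 Ubar x)
              (deriv (u t) (x + δ t) - iteratedDeriv 1 Ubar x)
            rw [add_sub_cancel] at h1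
            exact h1.trans (add_le_add (hp.bound₁ x) (hpt t t.2 x).2)
          l2Bdd₁ := by
            simpa only [sub_add_cancel] using b1.add (L2Bdd.of_memLp hp.memLp₁)
          l2Bdd₂ := b2.add (L2Bdd.of_memLp hp.memLp₂)
          stronglyMeasurable := fun t =>
            (hw t t.2).1.add hp.continuous₂.stronglyMeasurable
          weak := fun t a b => by
            obtain ⟨-, -, -, -, h1⟩ := hw t t.2
            have h2 := h1.sub_eq_integral (continuous_shiftedPerturbation_deriv hu hT hp t.2 δ) a b
            have h3 : IntervalIntegrable (w t) volume a b :=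
              (h1.locallyIntegrable_deriv.integrableOn_isCompact isCompact_uIcc).intervalIntegrable
            rw [intervalIntegral.integral_add h3 (hp.continuous₂.intervalIntegrable _ _), ← h2,
              intervalIntegral.integral_eq_sub_of_hasDerivAt (fun x _ => hp.deriv₁ x)
                (hp.continuous₂.intervalIntegrable _ _)]
            abel }
      deriv_time := fun x t ht => hu.hasDerivAt_shift hδ x ht
      continuousOn := cW
      continuousOn_time := by
        have hO : MapsTo (Function.uncurry fun t x => u t (x + δ t)) (Icc 0 T ×ˢ univ) O :=
          fun z hz => hcth (hmem z.1 hz.1 z.2)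
        exact ((hs.smooth_q.continuousOn.comp cW hO).sub
          ((hs.smooth_a.continuousOn.comp cW hO).clm_apply cW₁)).add
          ((hdc.comp continuousOn_fst fun z hz => hz.1).smul cW₁)
      equation := fun _ _ _ => rfl
      speed_le := fun t ht => (hdε t ht).trans (by
        linarith [(norm_nonneg _).trans (hp.bound₁ 0)])
      l2Bdd := b0
      l2Bdd₁ := b1
      l2Bdd₂ := b2
      l2Bdd_time := by
        -- The residual vanishes on the profile, so it is bounded by `‖V‖` plus the norm of the
        -- derivative of `V`; the remaining part of the time derivative is the speed times a square
        -- integrable function.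
        have bn : L2Bdd fun (t : Icc 0 T) x => ‖V t x‖
            + ‖deriv (u t) (x + δ t) - iteratedDeriv 1 Ubar x‖ :=
          (b0.mono (fun t => (b0.memLp t).1.norm) 1 fun t => .of_forall fun x => by simp).add
            (b1.mono (fun t => (b1.memLp t).1.norm) 1 fun t => .of_forall fun x => by simp)
        have cr : ∀ t : Icc 0 T, Continuous fun x => residual₀
            (fun v => Matrix.toEuclideanCLM (n := Fin N) (𝕜 := ℝ) (A v)) q
            (u t (x + δ t)) (deriv (u t) (x + δ t)) := fun t =>
          (hs.smooth_q.continuousOn.comp_continuous (cW.slice t.2) fun x => hcth (hmem t t.2 x)).sub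
            ((hs.smooth_a.continuousOn.comp_continuous (cW.slice t.2) fun x =>
              hcth (hmem t t.2 x)).clm_apply (cW₁.slice t.2))
        refine (bn.mono (fun t => (cr t).aestronglyMeasurable) C' fun t => .of_forall fun x => ?_).add
          (L2Bdd.mono (g := fun (t : Icc 0 T) x => deriv (u t) (x + δ t)) ?_
            (fun t => (cW₁.slice t.2).aestronglyMeasurable.const_smul (derivWithin δ (Icc 0 T) t)) ε
            fun t => .of_forall fun x => ?_)
        · obtain ⟨h1, h2⟩ := hpt t t.2 x
          have h3 := (hnear x _ _ 0 (h1.trans e2) (h2.trans e2) (by simpa using hε₂.le)).res₀_le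
          rw [add_sub_cancel, hVdef, shiftedPerturbation, add_sub_cancel] at h3
          rwa [Real.norm_of_nonneg (by positivity)]
        · simpa only [sub_add_cancel] using b1.add (L2Bdd.of_memLp hp.memLp₁)
        · rw [norm_smul]
          exact mul_le_mul_of_nonneg_right (hdε t t.2) (norm_nonneg _) }
  have hcont : ContinuousOn (fun t => ∫ x, ‖u t (x + δ t) - Ubar x‖ ^ 2) (Icc 0 T) :=
    ((continuousOn_eLpNorm_toReal (fun t ht => (hw t ht).2.1) fun t ht => (htend t ht).1).pow
      2).congr fun t ht => integral_norm_sq_eq (hw t ht).2.1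
  intro t ht
  have key := hmain T _ _ _ _ _ _ _ H (fun t ht x => (hpt t ht x).1.trans e1)
    (fun t ht x => (hpt t ht x).2.trans e1) (fun t ht => (hdε t ht).trans e1) hcont hdc t ht
  have h2 : ∀ s ∈ Icc 0 T, hNorm 2 (V s) ^ 2 = (∫ x, ‖u s (x + δ s) - Ubar x‖ ^ 2)
      + (∫ x, ‖deriv (u s) (x + δ s) - iteratedDeriv 1 Ubar x‖ ^ 2) + ∫ x, ‖w s x‖ ^ 2 :=
    fun s hs' => hNorm_two_sq (hgV s hs') (hw s hs').2.2.2.2 (hw s hs').2.1 (hw s hs').2.2.1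
      (hw s hs').2.2.2.1
  have h0 : (∫ s in (0 : ℝ)..t, Real.exp (-θ * (t - s)) *
        (hNorm 0 (V s) ^ 2 + |derivWithin δ (Icc 0 T) s| ^ 2))
      = ∫ s in (0 : ℝ)..t, Real.exp (-θ * (t - s)) *
        ((∫ x, ‖u s (x + δ s) - Ubar x‖ ^ 2) + |derivWithin δ (Icc 0 T) s| ^ 2) := by
    refine intervalIntegral.integral_congr fun s hs' => ?_
    rw [uIcc_of_le ht.1] at hs'
    simp only [hNorm_zero_sq (hw s ⟨hs'.1, hs'.2.trans ht.2⟩).2.1]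
    rfl
  rw [h2 t ht, h2 0 ⟨le_rfl, hT.le⟩, h0]
  exact key
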